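/- Let $\mathbb K$ be $\mathbb R$ or $\mathbb C$, let $M$ be a smooth manifold, let $L\to M$ be a Lie $\mathbb K$-algebroid with bracket $[\cdot,\cdot]_L$ and anchor $\rho_L\colon L\to TM\otimes_{\mathbb R}\mathbb K$, let $A\subset L$ be a Lie subalgebroid over $M$, and fix a subbundle $B$ with $L=A\oplus B$, with projections $\mathrm{pr}_A,\mathrm{pr}_B$. For $a\in\Gamma(A)$ and $b,b'\in\Gamma(B)$ put $$\nabla_ab=\mathrm{pr}_B[a,b]_L,\quad \eth_ba=\mathrm{pr}_A[b,a]_L,\quad [b,b']_B=\mathrm{pr}_B[b,b']_L,\quad \beta(b,b')=\mathrm{pr}_A[b,b']_L .$$ Let $\Omega_A^k(B)=\Gamma(\Lambda^kA^\vee\otimes B)$, in degree $k$, and $\Omega_A^\bullet(B)=\bigoplus_{k}\Omega_A^k(B)$. Let $\mathrm{Der}(L)$ be the Lie algebra (under the commutator, placed in degree $0$) of all $\mathbb K$-linear operators $\delta\colon\Gamma(L)\to\Gamma(L)$ for which there is an $s\in\mathfrak X(M)\otimes_{\mathbb R}\mathbb K$ with $\delta(fu)=s(f)u+f\delta(u)$,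 $[s,\rho_L(u)]=\rho_L(\delta(u))$ and $\delta[u,v]_L=[\delta(u),v]_L+[u,\delta(v)]_L$ for all $f\in C^\infty(M,\mathbb K)$ and $u,v\in\Gamma(L)$. An $L_\infty$ algebra is a $\mathbb Z$-graded vector space with graded skew-symmetric multilinear brackets $[\cdots]_k$ of degree $2-k$ ($k\ge1$) such that for all $n\ge1$ and homogeneous $x_1,\dots,x_n$ $$\sum_{i=1}^n\ \sum_{\sigma\in\mathrm{Sh}(i,n-i)}(-1)^i\chi(\sigma;x_1,\dots,x_n)\,[[x_{\sigma(1)},\dots,x_{\sigma(i)}]_i,x_{\sigma(i+1)},\dots,x_{\sigma(n)}]_{n-i+1}=0,$$ where $x_1\wedge\cdots\wedge x_n=\chi(\sigma;x_1,\dots,x_n)\,x_{\sigma(1)}\wedge\cdots\wedge x_{\sigma(n)}$; it is an $L_{\leqslant3}$ algebra if $[\cdots]_k=0$ for all $k\ge4$. Below, $\mathrm{Sh}(\dots)$ is the set of shuffles, sums over shuffles with a block of size $-1$ are zero, and forms of degree $-1$ are zero. **Statement.** (a) $\Omega_A^\bullet(B)$ is an $L_{\leqslant3}$ algebra with the following brackets,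 where $X\in\Omega^p_A(B)$, $Y\in\Omega^q_A(B)$, $Z\in\Omega^r_A(B)$ and $a_i\in\Gamma(A)$: $$\begin{aligned}{}[X]_1(a_1,\dots,a_{p+1})={}&\sum_i(-1)^{i+1}\nabla_{a_i}\big(X(\dots,\hat a_i,\dots)\big)+\sum_{i<j}(-1)^{i+j}X([a_i,a_j]_L,\dots,\hat a_i,\dots,\hat a_j,\dots),\\ [X,Y]_2(a_1,\dots,a_{p+q})={}&\sum_{\sigma\in\mathrm{Sh}(p,q)}\mathrm{sgn}(\sigma)\Big(\sum_{i=1}^pX(a_{\sigma(1)},\dots,\eth_{Y(a_{\sigma(p+1)},\dots)}a_{\sigma(i)},\dots,a_{\sigma(p)})\\&-\sum_{j=1}^qY(a_{\sigma(p+1)},\dots,\eth_{X(a_{\sigma(1)},\dots)}a_{\sigma(p+j)},\dots,a_{\sigma(p+q)})\\&+[X(a_{\sigma(1)},\dots,a_{\sigma(p)}),Y(a_{\sigma(p+1)},\dots,a_{\sigma(p+q)})]_B\Big),\\ [X,Y,Z]_3(a_1,\dots,a_{p+q+r-1})={}&(-1)^{p+q+1}\sum_{\sigma\in\mathrm{S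h}(p,q,r-1)}\mathrm{sgn}(\sigma)\,Z\big(\beta(X(a_{\sigma(1)},\dots),Y(a_{\sigma(p+1)},\dots)),a_{\sigma(p+q+1)},\dots\big)\\&+(-1)^p\sum_{\sigma\in\mathrm{Sh}(p,q-1,r)}\mathrm{sgn}(\sigma)\,Y\big(\beta(X(a_{\sigma(1)},\dots),Z(a_{\sigma(p+q)},\dots)),a_{\sigma(p+1)},\dots\big)\\&-\sum_{\sigma\in\mathrm{Sh}(p-1,q,r)}\mathrm{sgn}(\sigma)\,X\big(\beta(Y(a_{\sigma(p)},\dots),Z(a_{\sigma(p+q)},\dots)),a_{\sigma(1)},\dots\big).\end{aligned}$$ (b) The graded vector space $\mathrm{Der}(L)\oplus\Omega_A^\bullet(B)$ carries an $L_{\leqslant3}$ algebra structure that extends the $L_{\leqslant 3}$ structure of (a) and the Lie bracket of $\mathrm{Der}(L)$, in the following sense: the inclusion of $\Omega^\bullet_A(B)$ preserves all brackets; the projection to $\mathrm{Der}(L)$, whose only nonzero bracket is its Lie bracket, preserves all brackets; $[\delta,\delta']_2=[\delta,\delta']$ for $\delta,\delta'\in\mathrm{Der}(L)$; and every bracket with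 at least three entries vanishes if two of its entries are in $\mathrm{Der}(L)$. Its brackets with one entry $\delta\in\mathrm{Der}(L)$ are, for $X\in\Omega^i_A(B)$ and $Y\in\Omega_A^j(B)$, $$\begin{aligned}{}[\delta]_1(a)={}&-\mathrm{pr}_B\delta(a),\\ [\delta,X]_2(a_1,\dots,a_i)={}&-\sum_{l=1}^iX(a_1,\dots,\mathrm{pr}_A\delta(a_l),\dots,a_i)+\mathrm{pr}_B\delta\big(X(a_1,\dots,a_i)\big),\\ [\delta,X,Y]_3(a_1,\dots,a_{i+j-1})={}&(-1)^{i+1}\sum_{\sigma\in\mathrm{Sh}(i,j-1)}\mathrm{sgn}(\sigma)\,Y\big(\mathrm{pr}_A\delta(X(a_{\sigma(1)},\dots)),a_{\sigma(i+1)},\dots\big)\\&+\sum_{\sigma\in\mathrm{Sh}(i-1,j)}\mathrm{sgn}(\sigma)\,X\big(\mathrm{pr}_A\delta(Y(a_{\sigma(i)},\dots)),a_{\sigma(1)},\dots\big).\end{aligned}$$ -/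

import Mathlib

open Bundle Set Filter
open scoped Manifold ContDiff Topology DirectSum

noncomputable section

section SmoothSections

/-- The `𝕜`-algebra `C^∞(M, 𝕜)` of smooth `𝕜`-valued functions on a real manifold `M`
(`𝕜 = ℝ` or `ℂ`; smoothness is over `ℝ`). -/
def smoothFunctions (𝕜 : Type*) [RCLike 𝕜] (m : ℕ) (M : Type*) [TopologicalSpace M]
    [ChartedSpace (EuclideanSpace ℝ (Fin m)) M] : Subalgebra 𝕜 (M → 𝕜) where
  carrier := {f | ContMDiff (𝓡 m) 𝓘(ℝ, 𝕜) ∞ f}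
  mul_mem' {f g} hf hg := by
    have h : ContDiff ℝ ∞ (fun p : 𝕜 × 𝕜 => p.1 * p.2) := contDiff_fst.mul contDiff_snd
    exact h.contMDiff.comp (ContMDiff.prodMk_space hf hg)
  add_mem' {f g} hf hg := ContMDiff.add hf hg
  algebraMap_mem' r := contMDiff_const

variable {𝕜 : Type*} [RCLike 𝕜] {m : ℕ} {M : Type*} [TopologicalSpace M]
  [ChartedSpace (EuclideanSpace ℝ (Fin m)) M]
  {F : Type*} [NormedAddCommGroup F] [NormedSpace ℝ F] [NormedSpace 𝕜 F] [IsScalarTower ℝ 𝕜 F]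
  {L : M → Type*} [TopologicalSpace (TotalSpace F L)] [∀ x, AddCommGroup (L x)]
  [∀ x, Module 𝕜 (L x)] [∀ x, TopologicalSpace (L x)] [FiberBundle F L] [VectorBundle 𝕜 F L]

/-- Smoothness at a point is preserved by multiplication with a smooth `𝕜`-valued function. -/
theorem contMDiffAt_smul_section {f : M → 𝕜} {s : ∀ x, L x} {x₀ : M}
    (hf : ContMDiffAt (𝓡 m) 𝓘(ℝ, 𝕜) ∞ f x₀)
    (hs : ContMDiffAt (𝓡 m) ((𝓡 m).prod 𝓘(ℝ, F)) ∞ (fun x => TotalSpace.mk' F x (s x)) x₀) :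
    ContMDiffAt (𝓡 m) ((𝓡 m).prod 𝓘(ℝ, F)) ∞
      (fun x => TotalSpace.mk' F x (f x • s x)) x₀ := by
  rw [contMDiffAt_section] at hs ⊢
  have h : ContDiff ℝ ∞ (fun p : 𝕜 × F => p.1 • p.2) := contDiff_fst.smul contDiff_snd
  have h2 : ContMDiffAt (𝓡 m) 𝓘(ℝ, F) ∞
      (fun x => f x • (trivializationAt F L x₀ ⟨x, s x⟩).2) x₀ :=
    h.contMDiff.contMDiffAt.comp x₀ (ContMDiffAt.prodMk_space hf hs)
  refine h2.congr_of_eventuallyEq ?_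
  filter_upwards [(trivializationAt F L x₀).open_baseSet.mem_nhds
    (FiberBundle.mem_baseSet_trivializationAt' x₀)] with x hx
  exact ((trivializationAt F L x₀).linear 𝕜 hx).2 _ _

variable [∀ x, Module ℝ (L x)] [VectorBundle ℝ F L]

variable (𝕜 m F L) in
/-- The `C^∞(M, 𝕜)`-module `Γ(L)` of smooth sections of a smooth `𝕜`-vector bundle `L → M`. -/
def smoothSections : Submodule (smoothFunctions 𝕜 m M) (∀ x, L x) where
  carrier := {s | ContMDiff (𝓡 m) ((𝓡 m).prod 𝓘(ℝ, F)) ∞ fun x => TotalSpace.mk' F x (s x)}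
  add_mem' hs ht := ContMDiff.add_section hs ht
  zero_mem' := contMDiff_zeroSection ℝ L
  smul_mem' f _ hs := fun x => contMDiffAt_smul_section (f.2 x) (hs x)

/-- The ring `C^∞(M, 𝕜)`. -/
def SmoothFunction (𝕜 : Type*) [RCLike 𝕜] (m : ℕ) (M : Type*) [TopologicalSpace M]
    [ChartedSpace (EuclideanSpace ℝ (Fin m)) M] : Type _ :=
  smoothFunctions 𝕜 m M

namespace SmoothFunction

instance : CommRing (SmoothFunction 𝕜 m M) := inferInstanceAs (CommRing (smoothFunctions 𝕜 m M))

instance : Algebra 𝕜 (SmoothFunction 𝕜 m M) := inferInstanceAs (Algebra 𝕜 (smoothFunctions 𝕜 m M))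

end SmoothFunction

variable (𝕜 m F L) in
/-- The `C^∞(M, 𝕜)`-module `Γ(L)`. -/
def SmoothSection : Type _ := smoothSections 𝕜 m F L

namespace SmoothSection

instance : AddCommGroup (SmoothSection 𝕜 m F L) :=
  inferInstanceAs (AddCommGroup (smoothSections 𝕜 m F L))

instance : Module (SmoothFunction 𝕜 m M) (SmoothSection 𝕜 m F L) :=
  inferInstanceAs (Module (smoothFunctions 𝕜 m M) (smoothSections 𝕜 m F L))

/-- `Γ(L)` is a vector space over the constants `𝕜 ⊆ C^∞(M, 𝕜)`. -/
instance : Module 𝕜 (SmoothSection 𝕜 m F L) :=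
  Module.compHom _ (algebraMap 𝕜 (SmoothFunction 𝕜 m M))

instance : IsScalarTower 𝕜 (SmoothFunction 𝕜 m M) (SmoothSection 𝕜 m F L) :=
  IsScalarTower.of_algebraMap_smul fun _ _ => rfl

end SmoothSection

/-- A family of fibrewise subspaces `A x ⊆ L x` is a smooth vector subbundle of `L` if it
has, near every point, a frame consisting of smooth sections of `L` (local frames extend to
global sections after shrinking the neighbourhood, by bump functions). -/
def IsSmoothSubbundle (A : ∀ x, Submodule 𝕜 (L x)) : Prop :=
  ∀ x₀ : M, ∃ (r : ℕ) (s : Fin r → SmoothSection 𝕜 m F L), ∀ᶠ x in 𝓝 x₀,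
    LinearIndependent 𝕜 (fun i => (s i).1 x) ∧
      Submodule.span 𝕜 (range fun i => (s i).1 x) = A x

/-- `Γ(A)` as a submodule of `Γ(L)`, for a subbundle `A` of `L`. -/
def subbundleSections (A : ∀ x, Submodule 𝕜 (L x)) :
    Submodule (SmoothFunction 𝕜 m M) (SmoothSection 𝕜 m F L) where
  carrier := {s | ∀ x, s.1 x ∈ A x}
  add_mem' hs ht x := (A x).add_mem (hs x) (ht x)
  zero_mem' x := (A x).zero_mem
  smul_mem' f _ hs x := (A x).smul_mem (f.1 x) (hs x)

/-- Complementary subbundles decompose every smooth section into two smooth sections. -/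
theorem isCompl_subbundleSections [FiniteDimensional 𝕜 F] {A B : ∀ x, Submodule 𝕜 (L x)}
    (hA : IsSmoothSubbundle (m := m) (F := F) A) (hB : IsSmoothSubbundle (m := m) (F := F) B)
    (hAB : ∀ x, IsCompl (A x) (B x)) :
    IsCompl (subbundleSections (m := m) (F := F) A) (subbundleSections (m := m) (F := F) B) := by
  have : FiniteDimensional ℝ F := FiniteDimensional.trans ℝ 𝕜 F
  have key : ∀ u : SmoothSection 𝕜 m F L,
      (fun x => ((A x).projectionOnto (B x) (hAB x) (u.1 x) : L x)) ∈ smoothSections 𝕜 m F L := by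
    intro u x₀
    obtain ⟨r, s, hs⟩ := hA x₀
    obtain ⟨q, t, ht⟩ := hB x₀
    set e := trivializationAt F L x₀ with he
    let w : Fin r ⊕ Fin q → SmoothSection 𝕜 m F L := Sum.elim s t
    let T : Fin r ⊕ Fin q → F →ₗ[ℝ] ((Fin r ⊕ Fin q → 𝕜) →L[ℝ] F) := fun k =>
      { toFun := fun v => LinearMap.toContinuousLinearMap
          (((LinearMap.proj k : (Fin r ⊕ Fin q → 𝕜) →ₗ[𝕜] 𝕜).smulRight v).restrictScalars ℝ)
        map_add' := fun v v' => by ext c; simp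
        map_smul' := fun a v => by
          ext c
          simp [smul_comm (c k) a v] }
    let Φ : M → ((Fin r ⊕ Fin q → 𝕜) →L[ℝ] F) := fun x => ∑ k, T k (e ⟨x, (w k).1 x⟩).2
    have hΦapp : ∀ x c, Φ x c = ∑ k, c k • (e ⟨x, (w k).1 x⟩).2 := by
      intro x c
      simp [Φ, T]
    have hΦ : ContMDiffAt (𝓡 m) 𝓘(ℝ, (Fin r ⊕ Fin q → 𝕜) →L[ℝ] F) ∞ Φ x₀ := by
      refine ContMDiffAt.sum fun k _ => ?_
      have h1 := (contMDiffAt_section (F := F) x₀).1 ((w k).2 x₀)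
      have h2 : ContDiff ℝ ∞ (T k) := by
        let T' : F →L[ℝ] ((Fin r ⊕ Fin q → 𝕜) →L[ℝ] F) := ⟨T k, (T k).continuous_of_finiteDimensional⟩
        exact ContinuousLinearMap.contDiff (𝕜 := ℝ) (E := F)
          (F := (Fin r ⊕ Fin q → 𝕜) →L[ℝ] F) T'
      exact h2.contMDiff.contMDiffAt.comp x₀ h1
    have hbase : ∀ᶠ x in 𝓝 x₀, x ∈ e.baseSet :=
      e.open_baseSet.mem_nhds (FiberBundle.mem_baseSet_trivializationAt' x₀)
    -- at nearby points the frame expresses every vector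
    have hgood : ∀ᶠ x in 𝓝 x₀, (Φ x).IsInvertible ∧ ∀ v : L x,
        ((A x).projectionOnto (B x) (hAB x) v : L x) =
          ∑ i : Fin r, ((Φ x).inverse (e ⟨x, v⟩).2) (Sum.inl i) • (s i).1 x := by
      filter_upwards [hbase, hs, ht] with x hx hsx htx
      have hlin : ∀ (c : Fin r ⊕ Fin q → 𝕜),
          Φ x c = e.linearEquivAt 𝕜 x hx (∑ k, c k • (w k).1 x) := by
        intro c
        rw [hΦapp, map_sum]
        refine Finset.sum_congr rfl fun k _ => ?_
        rw [map_smul]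
        rfl
      have hli : LinearIndependent 𝕜 (fun k => (w k).1 x) := by
        have : (fun k => (w k).1 x) = Sum.elim (fun i => (s i).1 x) (fun i => (t i).1 x) := by
          ext k; cases k <;> rfl
        rw [this]
        refine LinearIndependent.sum_type hsx.1 htx.1 ?_
        rw [hsx.2, htx.2]
        exact (hAB x).disjoint
      have hsp : ⊤ ≤ Submodule.span 𝕜 (range fun k => (w k).1 x) := by
        have : (fun k => (w k).1 x) = Sum.elim (fun i => (s i).1 x) (fun i => (t i).1 x) := by
          ext k; cases k <;> rfl
        rw [this, Sum.elim_range, Submodule.span_union, hsx.2, htx.2]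
        exact (hAB x).codisjoint.top_le
      let b : Module.Basis (Fin r ⊕ Fin q) 𝕜 (L x) := Module.Basis.mk hli hsp
      have hb : ∀ k, b k = (w k).1 x := fun k => Module.Basis.mk_apply hli hsp k
      let Ψ : (Fin r ⊕ Fin q → 𝕜) ≃ₗ[ℝ] F :=
        ((b.equivFun.symm).trans (e.linearEquivAt 𝕜 x hx)).restrictScalars ℝ
      have hΨ : Φ x = (Ψ.toContinuousLinearEquiv : (Fin r ⊕ Fin q → 𝕜) →L[ℝ] F) := by
        ext1 c
        rw [hlin c]
        simp [Ψ, Module.Basis.equivFun_symm_apply, hb]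
      refine ⟨⟨_, hΨ.symm⟩, fun v => ?_⟩
      have hinv : (Φ x).inverse (e ⟨x, v⟩).2 = b.equivFun v := by
        rw [hΨ, ContinuousLinearMap.inverse_equiv]
        change Ψ.symm _ = _
        rw [LinearEquiv.symm_apply_eq]
        change _ = (e.linearEquivAt 𝕜 x hx) (b.equivFun.symm (b.equivFun v))
        rw [LinearEquiv.symm_apply_apply]
        rfl
      rw [hinv]
      have hv : v = ∑ i, b.equivFun v (Sum.inl i) • (s i).1 x
          + ∑ i, b.equivFun v (Sum.inr i) • (t i).1 x := by
        conv_lhs => rw [← b.sum_equivFun v, Fintype.sum_sum_type]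
        simp only [hb]
        rfl
      have hmA : ∑ i, b.equivFun v (Sum.inl i) • (s i).1 x ∈ A x :=
        Submodule.sum_mem _ fun i _ => (A x).smul_mem _
          (hsx.2 ▸ Submodule.subset_span (mem_range_self i))
      have hmB : ∑ i, b.equivFun v (Sum.inr i) • (t i).1 x ∈ B x :=
        Submodule.sum_mem _ fun i _ => (B x).smul_mem _
          (htx.2 ▸ Submodule.subset_span (mem_range_self i))
      conv_lhs => rw [hv]
      rw [map_add, Submodule.projectionOnto_apply_left (hAB x) ⟨_, hmA⟩,
        Submodule.projectionOnto_apply_right (hAB x) ⟨_, hmB⟩, add_zero]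
    have hc : ContMDiffAt (𝓡 m) 𝓘(ℝ, Fin r ⊕ Fin q → 𝕜) ∞
        (fun x => (Φ x).inverse (e ⟨x, u.1 x⟩).2) x₀ := by
      have h1 : ContMDiffAt (𝓡 m) 𝓘(ℝ, F →L[ℝ] (Fin r ⊕ Fin q → 𝕜)) ∞
          (fun x => (Φ x).inverse) x₀ :=
        (hgood.self_of_nhds.1.contDiffAt_map_inverse (n := ∞)).contMDiffAt.comp x₀ hΦ
      exact h1.clm_apply ((contMDiffAt_section (F := F) x₀).1 (u.2 x₀))
    have hsum : ContMDiffAt (𝓡 m) ((𝓡 m).prod 𝓘(ℝ, F)) ∞ (fun x => TotalSpace.mk' F x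
        (∑ i : Fin r, ((Φ x).inverse (e ⟨x, u.1 x⟩).2) (Sum.inl i) • (s i).1 x)) x₀ := by
      refine ContMDiffAt.sum_section fun i _ => ?_
      refine contMDiffAt_smul_section ?_ ((s i).2 x₀)
      have h2 : ContDiff ℝ ∞ (fun c : Fin r ⊕ Fin q → 𝕜 => c (Sum.inl i)) := contDiff_apply _ _ _
      exact h2.contMDiff.contMDiffAt.comp x₀ hc
    refine hsum.congr_of_eventuallyEq ?_
    filter_upwards [hgood] with x hx
    rw [hx.2]
  constructor
  · rw [Submodule.disjoint_def]
    intro u hu hu'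
    refine Subtype.ext (funext fun x => ?_)
    exact Submodule.disjoint_def.1 (hAB x).disjoint _ (hu x) (hu' x)
  · rw [codisjoint_iff_le_sup]
    intro u _
    rw [Submodule.mem_sup]
    let v : SmoothSection 𝕜 m F L := ⟨_, key u⟩
    refine ⟨v, fun x => Subtype.property _, u - v, fun x => ?_, add_sub_cancel v u⟩
    change u.1 x - ((A x).projectionOnto (B x) (hAB x) (u.1 x) : L x) ∈ B x
    rw [← Submodule.projectionOnto_apply_eq_zero_iff (hAB x)]
    rw [map_sub, Submodule.projectionOnto_apply_left, sub_self]

end SmoothSections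

/-! ### Graded `L_∞` algebras -/

section LInfinity

/-- The `(i, n - i)`-shuffles among the permutations of `n` letters: `σ` is increasing on the
first `i` letters and on the remaining ones. -/
def shuffles (n i : ℕ) : Finset (Equiv.Perm (Fin n)) :=
  {σ | ∀ a b : Fin n, a < b → (b.val < i ∨ i ≤ a.val) → σ a < σ b}

/-- The `(i, j, n - i - j)`-shuffles among the permutations of `n` letters. -/
def shuffles₃ (n i j : ℕ) : Finset (Equiv.Perm (Fin n)) :=
  {σ | ∀ a b : Fin n, a < b →
    (b.val < i ∨ (i ≤ a.val ∧ b.val < i + j) ∨ i + j ≤ a.val) → σ a < σ b}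

/-- The sign `χ(σ; x₁, …, xₙ)` for homogeneous `xᵢ` of degree `d i`, determined by
`x₁ ∧ ⋯ ∧ xₙ = χ x_{σ(1)} ∧ ⋯ ∧ x_{σ(n)}`: the sign of `σ` times the Koszul sign, which has a factor
`(-1)^{|x||y|}` for every pair of letters `x`, `y` that `σ` puts in the opposite order. -/
def koszulChi {n : ℕ} (σ : Equiv.Perm (Fin n)) (d : Fin n → ℤ) : ℤˣ :=
  Equiv.Perm.sign σ *
    ∏ a : Fin n, ∏ b : Fin n,
      if a < b ∧ σ b < σ a then (d (σ a) * d (σ b)).negOnePow else 1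

/-- The consecutive letters `a_{σ(s+1)}, …, a_{σ(s+l)}`. -/
def block {α : Type*} {n : ℕ} (a : Fin n → α) (σ : Equiv.Perm (Fin n)) (s l : ℕ) (h : s + l ≤ n) :
    Fin l → α :=
  fun i => a (σ ⟨s + i.val, by omega⟩)

/-- An `L_∞` algebra structure on the graded vector space `W = ⨁ᵢ 𝒱 i`: graded skew-symmetric
brackets `[⋯]_k` of degree `2 - k` for `k ≥ 1` subject to the higher Jacobi rules
`∑ᵢ ∑_σ (-1)^i χ(σ; x) [[x_{σ(1)}, …, x_{σ(i)}]_i, x_{σ(i+1)}, …, x_{σ(n)}]_{n-i+1} = 0`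
(`i = 1, …, n`, `σ ∈ Sh(i, n - i)`). The value of `bracket` at `k = 0` is set to zero. -/
structure LInfinityAlgebra (𝕜 W : Type*) [Field 𝕜] [AddCommGroup W] [Module 𝕜 W]
    (𝒱 : ℤ → Submodule 𝕜 W) where
  isInternal : DirectSum.IsInternal 𝒱
  bracket : (k : ℕ) → MultilinearMap 𝕜 (fun _ : Fin k => W) W
  bracket_zero : bracket 0 = 0
  bracket_mem : ∀ (k : ℕ) (d : Fin k → ℤ) (x : Fin k → W), (∀ i, x i ∈ 𝒱 (d i)) →
    bracket k x ∈ 𝒱 (∑ i, d i + 2 - k)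
  bracket_perm : ∀ (k : ℕ) (d : Fin k → ℤ) (x : Fin k → W), (∀ i, x i ∈ 𝒱 (d i)) →
    ∀ σ : Equiv.Perm (Fin k), bracket k x = koszulChi σ d • bracket k (x ∘ σ)
  jacobi : ∀ (n : ℕ) (d : Fin n → ℤ) (x : Fin n → W), 1 ≤ n → (∀ i, x i ∈ 𝒱 (d i)) →
    ∑ i : Fin n, ∑ σ ∈ shuffles n (i.val + 1),
      ((-1 : ℤˣ) ^ (i.val + 1) * koszulChi σ d) •
        bracket (n - (i.val + 1) + 1)
          (Fin.cons (bracket (i.val + 1) (block x σ 0 (i.val + 1) (by omega)))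
            (block x σ (i.val + 1) (n - (i.val + 1)) (by omega))) = 0

/-- An `L_{≤ 3}` algebra: an `L_∞` algebra whose brackets with at least four entries vanish. -/
def LInfinityAlgebra.IsLThree {𝕜 W : Type*} [Field 𝕜] [AddCommGroup W] [Module 𝕜 W]
    {𝒱 : ℤ → Submodule 𝕜 W} (𝔤 : LInfinityAlgebra 𝕜 W 𝒱) : Prop :=
  ∀ k, 4 ≤ k → 𝔤.bracket k = 0

end LInfinity

/-! ### Lie–Rinehart algebras, derivations and the brackets of a split Lie pair -/

section LieRinehart

attribute [local instance] LieRing.ofAssociativeRing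

/-- A Lie–Rinehart `𝕜`-algebra structure on the `R`-module `𝓛`: a Lie bracket over `𝕜` and an
`R`-linear anchor into the derivations of `R` which is a Lie algebra homomorphism and satisfies
the Leibniz rule. -/
structure LieRinehart (𝕜 R 𝓛 : Type*) [Field 𝕜] [CommRing R] [Algebra 𝕜 R] [AddCommGroup 𝓛]
    [Module 𝕜 𝓛] [Module R 𝓛] [IsScalarTower 𝕜 R 𝓛] where
  bracket : 𝓛 →ₗ[𝕜] 𝓛 →ₗ[𝕜] 𝓛
  bracket_self : ∀ u, bracket u u = 0
  jacobi : ∀ u v w, bracket u (bracket v w) = bracket (bracket u v) w + bracket v (bracket u w)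
  anchor : 𝓛 →ₗ[R] Derivation 𝕜 R R
  anchor_bracket : ∀ u v, anchor (bracket u v) = ⁅anchor u, anchor v⁆
  leibniz : ∀ u (f : R) v, bracket u (f • v) = anchor u f • v + f • bracket u v

variable {𝕜 R 𝓛 : Type*} [Field 𝕜] [CommRing R] [Algebra 𝕜 R] [AddCommGroup 𝓛]
    [Module 𝕜 𝓛] [Module R 𝓛] [IsScalarTower 𝕜 R 𝓛]

namespace LieRinehart

/-- `δ` is a derivation of the Lie–Rinehart algebra with symbol `s`. -/
structure IsDerivation (𝓔 : LieRinehart 𝕜 R 𝓛) (s : Derivation 𝕜 R R) (δ : Module.End 𝕜 𝓛) :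
    Prop where
  map_smul : ∀ (f : R) (u : 𝓛), δ (f • u) = s f • u + f • δ u
  symbol_anchor : ∀ u, ⁅s, 𝓔.anchor u⁆ = 𝓔.anchor (δ u)
  map_bracket : ∀ u v, δ (𝓔.bracket u v) = 𝓔.bracket (δ u) v + 𝓔.bracket u (δ v)

/-- `Der(L)`: the Lie algebra, under the commutator, of the operators on sections which are
derivations for some symbol. -/
def der (𝓔 : LieRinehart 𝕜 R 𝓛) : LieSubalgebra 𝕜 (Module.End 𝕜 𝓛) where
  carrier := {δ | ∃ s, 𝓔.IsDerivation s δ}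
  add_mem' := by
    rintro δ δ' ⟨s, h⟩ ⟨s', h'⟩
    refine ⟨s + s', fun f u => ?_, fun u => ?_, fun u v => ?_⟩
    · simp only [LinearMap.add_apply, h.map_smul, h'.map_smul, Derivation.add_apply, add_smul,
        smul_add]
      abel
    · simp [add_lie, h.symbol_anchor, h'.symbol_anchor]
    · simp only [LinearMap.add_apply, h.map_bracket, h'.map_bracket, map_add]
      abel
  zero_mem' := ⟨0, by simp, by simp, by simp⟩
  smul_mem' := by
    rintro c δ ⟨s, h⟩
    refine ⟨c • s, fun f u => ?_, fun u => ?_, fun u v => ?_⟩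
    · simp only [LinearMap.smul_apply, h.map_smul, Derivation.smul_apply, smul_add, smul_assoc]
      rw [smul_comm f c]
    · rw [smul_lie, h.symbol_anchor, LinearMap.smul_apply]
      exact ((𝓔.anchor.restrictScalars 𝕜).map_smul c (δ u)).symm
    · simp [h.map_bracket]
  lie_mem' := by
    rintro δ δ' ⟨s, h⟩ ⟨s', h'⟩
    refine ⟨⁅s, s'⁆, fun f u => ?_, fun u => ?_, fun u v => ?_⟩
    · simp only [LieRing.of_associative_ring_bracket, LinearMap.sub_apply, Module.End.mul_apply,
        h.map_smul, h'.map_smul, map_add, Derivation.commutator_apply, sub_smul, smul_sub]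
      abel
    · rw [lie_lie, h'.symbol_anchor, h.symbol_anchor, h.symbol_anchor, h'.symbol_anchor, ← map_sub]
      rfl
    · simp only [LieRing.of_associative_ring_bracket, LinearMap.sub_apply, Module.End.mul_apply,
        h.map_bracket, h'.map_bracket, map_add, map_sub]
      abel

end LieRinehart

/-- A subalgebra `A` of a Lie–Rinehart algebra together with a complementary submodule `B`. -/
structure SplitLiePair (𝓔 : LieRinehart 𝕜 R 𝓛) where
  A : Submodule R 𝓛
  B : Submodule R 𝓛
  bracket_mem : ∀ u ∈ A, ∀ v ∈ A, 𝓔.bracket u v ∈ A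
  isCompl : IsCompl A B

namespace SplitLiePair

variable {𝓔 : LieRinehart 𝕜 R 𝓛} (P : SplitLiePair 𝓔)

/-- `pr_A`. -/
def prA : 𝓛 →ₗ[R] P.A := P.A.projectionOnto P.B P.isCompl

/-- `pr_B`. -/
def prB : 𝓛 →ₗ[R] P.B := P.B.projectionOnto P.A P.isCompl.symm

/-- The bracket of `A`. -/
def bracketA (a a' : P.A) : P.A := ⟨𝓔.bracket a a', P.bracket_mem _ a.2 _ a'.2⟩

/-- The Bott connection `∇_a b = pr_B [a, b]`. -/
def bott (a : P.A) (b : P.B) : P.B := P.prB (𝓔.bracket a b)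

/-- `ð_b a = pr_A [b, a]`. -/
def eth (b : P.B) (a : P.A) : P.A := P.prA (𝓔.bracket b a)

/-- `[b, b']_B = pr_B [b, b']`. -/
def bracketB (b b' : P.B) : P.B := P.prB (𝓔.bracket b b')

/-- `β(b, b') = pr_A [b, b']`. -/
def beta (b b' : P.B) : P.A := P.prA (𝓔.bracket b b')

/-- `Ω_A^k(B)`: alternating `R`-multilinear maps of `k` arguments in `A` with values in `B`. -/
abbrev Form (k : ℕ) : Type _ := P.A [⋀^Fin k]→ₗ[R] P.B

/-- `Ω_A^•(B) = ⨁ₖ Ω_A^k(B)`. -/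
abbrev Forms : Type _ := ⨁ k : ℕ, P.Form k

/-- A `k`-form as an element of `Ω_A^•(B)`. -/
abbrev of {k : ℕ} (X : P.Form k) : P.Forms := DirectSum.lof 𝕜 ℕ P.Form k X

/-- The `ℤ`-grading of `Ω_A^•(B)`; its components of negative degree are zero. -/
def formsDeg (i : ℤ) : Submodule 𝕜 P.Forms where
  carrier := {X | ∀ k : ℕ, (k : ℤ) ≠ i → X k = 0}
  add_mem' hX hY k hk := by simp [hX k hk, hY k hk]
  zero_mem' k _ := rfl
  smul_mem' c X hX k hk := by simp [DirectSum.smul_apply, hX k hk]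

/-- The terms `∑_{i<j} (-1)^{i+j} X([a_i, a_j], a_1, …, â_i, …, â_j, …, a_{k+1})`. -/
def bottBracketTerm : {k : ℕ} → P.Form k → (Fin (k + 1) → P.A) → P.B
  | 0, _, _ => 0
  | k + 1, X, a => ∑ j : Fin (k + 2), ∑ i : Fin (k + 1),
      if i.castSucc < j then
        (-1 : ℤˣ) ^ (i.val + j.val) •
          X (Fin.cons (P.bracketA (a i.castSucc) (a j)) (i.removeNth (j.removeNth a)))
      else 0

/-- The value of `d_A^Bott X` at `a_1, …, a_{k+1}`. -/
def bottDiff {k : ℕ} (X : P.Form k) (a : Fin (k + 1) → P.A) : P.B :=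
  ∑ i : Fin (k + 1), (-1 : ℤˣ) ^ i.val • P.bott (a i) (X (i.removeNth a)) + P.bottBracketTerm X a

/-- The value of `[X, Y]_2` at `a_1, …, a_{p+q}`. -/
def bracket₂ {p q : ℕ} (X : P.Form p) (Y : P.Form q) (a : Fin (p + q) → P.A) : P.B :=
  ∑ σ ∈ shuffles (p + q) p, ∑ i : Fin p, Equiv.Perm.sign σ •
      X (Function.update (block a σ 0 p (by omega)) i
        (P.eth (Y (block a σ p q le_rfl)) (block a σ 0 p (by omega) i)))
  - ∑ τ ∈ shuffles (p + q) p, ∑ j : Fin q, Equiv.Perm.sign τ •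
      Y (Function.update (block a τ p q le_rfl) j
        (P.eth (X (block a τ 0 p (by omega))) (block a τ p q le_rfl j)))
  + ∑ α ∈ shuffles (p + q) p, Equiv.Perm.sign α •
      P.bracketB (X (block a α 0 p (by omega))) (Y (block a α p q le_rfl))

/-- `∑_{σ ∈ Sh(p,q,r-1)} sgn(σ) Z(β(X(a_{σ(1)}, …), Y(a_{σ(p+1)}, …)), a_{σ(p+q+1)}, …)`,
which is an empty sum for `r = 0`. -/
def bracket₃Z {p q n : ℕ} (X : P.Form p) (Y : P.Form q) :
    {r : ℕ} → P.Form r → p + q + r = n + 1 → (Fin n → P.A) → P.B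
  | 0, _, _, _ => 0
  | r + 1, Z, h, a => ∑ σ ∈ shuffles₃ n p q, Equiv.Perm.sign σ •
      Z (Fin.cons
        (P.beta (X (block a σ 0 p (by omega))) (Y (block a σ p q (by omega))))
        (block a σ (p + q) r (by omega)))

/-- `∑_{τ ∈ Sh(p,q-1,r)} sgn(τ) Y(β(X(a_{τ(1)}, …), Z(a_{τ(p+q)}, …)), a_{τ(p+1)}, …)`,
which is an empty sum for `q = 0`. -/
def bracket₃Y {p r n : ℕ} (X : P.Form p) :
    {q : ℕ} → P.Form q → P.Form r → p + q + r = n + 1 → (Fin n → P.A) → P.B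
  | 0, _, _, _, _ => 0
  | q + 1, Y, Z, h, a => ∑ τ ∈ shuffles₃ n p q, Equiv.Perm.sign τ •
      Y (Fin.cons
        (P.beta (X (block a τ 0 p (by omega))) (Z (block a τ (p + q) r (by omega))))
        (block a τ p q (by omega)))

/-- `∑_{α ∈ Sh(p-1,q,r)} sgn(α) X(β(Y(a_{α(p)}, …), Z(a_{α(p+q)}, …)), a_{α(1)}, …)`,
which is an empty sum for `p = 0`. -/
def bracket₃X {q r n : ℕ} :
    {p : ℕ} → P.Form p → P.Form q → P.Form r → p + q + r = n + 1 → (Fin n → P.A) → P.B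
  | 0, _, _, _, _, _ => 0
  | p + 1, X, Y, Z, h, a => ∑ α ∈ shuffles₃ n p q, Equiv.Perm.sign α •
      X (Fin.cons
        (P.beta (Y (block a α p q (by omega))) (Z (block a α (p + q) r (by omega))))
        (block a α 0 p (by omega)))

/-- The value of `[X, Y, Z]_3` at `a_1, …, a_n`, where `n = p + q + r - 1`. -/
def bracket₃ {p q r n : ℕ} (X : P.Form p) (Y : P.Form q) (Z : P.Form r) (h : p + q + r = n + 1)
    (a : Fin n → P.A) : P.B :=
  (-1 : ℤˣ) ^ (p + q + 1) • P.bracket₃Z X Y Z h a + (-1 : ℤˣ) ^ p • P.bracket₃Y X Y Z h a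
    - P.bracket₃X X Y Z h a

/-- `𝔤` is the `L_{≤ 3}` algebra `Ω_A^•(B)` of the Lie pair with its chosen decomposition: its
brackets are `d_A^Bott`, `[·,·]_2` and `[·,·,·]_3`, and the others vanish. (A ternary bracket of
three `0`-forms has degree `-1`, so it vanishes as well.) -/
structure IsFormsAlgebra (𝔤 : LInfinityAlgebra 𝕜 P.Forms P.formsDeg) : Prop where
  isLThree : 𝔤.IsLThree
  unary : ∀ {k : ℕ} (X : P.Form k) (a : Fin (k + 1) → P.A),
    (𝔤.bracket 1 ![P.of X]) (k + 1) a = P.bottDiff X a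
  binary : ∀ {p q : ℕ} (X : P.Form p) (Y : P.Form q) (a : Fin (p + q) → P.A),
    (𝔤.bracket 2 ![P.of X, P.of Y]) (p + q) a = P.bracket₂ X Y a
  ternary : ∀ {p q r n : ℕ} (X : P.Form p) (Y : P.Form q) (Z : P.Form r)
    (h : p + q + r = n + 1) (a : Fin n → P.A),
    (𝔤.bracket 3 ![P.of X, P.of Y, P.of Z]) n a = P.bracket₃ X Y Z h a

/-- The value of `κ(δ)` at `a`. -/
def kappa (δ : 𝓔.der) (a : P.A) : P.B := - P.prB (δ.1 a)

/-- The value of `δ ▷ X` at `a_1, …, a_k`. -/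
def act₁ (δ : 𝓔.der) {k : ℕ} (X : P.Form k) (a : Fin k → P.A) : P.B :=
  - ∑ j : Fin k, X (Function.update a j (P.prA (δ.1 (a j)))) + P.prB (δ.1 (X a))

/-- `∑_{σ ∈ Sh(i,j-1)} sgn(σ) Y(pr_A δ(X(a_{σ(1)}, …)), a_{σ(i+1)}, …)`,
which is an empty sum for `j = 0`. -/
def act₂Y (δ : 𝓔.der) {i n : ℕ} (X : P.Form i) :
    {j : ℕ} → P.Form j → i + j = n + 1 → (Fin n → P.A) → P.B
  | 0, _, _, _ => 0
  | j + 1, Y, h, a => ∑ σ ∈ shuffles n i, Equiv.Perm.sign σ •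
      Y (Fin.cons (P.prA (δ.1 (X (block a σ 0 i (by omega))))) (block a σ i j (by omega)))

/-- `∑_{σ ∈ Sh(i-1,j)} sgn(σ) X(pr_A δ(Y(a_{σ(i)}, …)), a_{σ(1)}, …)`,
which is an empty sum for `i = 0`. -/
def act₂X (δ : 𝓔.der) {j n : ℕ} :
    {i : ℕ} → P.Form i → P.Form j → i + j = n + 1 → (Fin n → P.A) → P.B
  | 0, _, _, _, _ => 0
  | i + 1, X, Y, h, a => ∑ σ ∈ shuffles n i, Equiv.Perm.sign σ •
      X (Fin.cons (P.prA (δ.1 (Y (block a σ i j (by omega))))) (block a σ 0 i (by omega)))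

/-- The value of `δ ▷ (X, Y)` at `a_1, …, a_n`, where `n = i + j - 1`. -/
def act₂ (δ : 𝓔.der) {i j n : ℕ} (X : P.Form i) (Y : P.Form j) (h : i + j = n + 1)
    (a : Fin n → P.A) : P.B :=
  (-1 : ℤˣ) ^ (i + 1) • P.act₂Y δ X Y h a + P.act₂X δ X Y h a

/-- The `ℤ`-grading of `Der(L) ⊕ Ω_A^•(B)`, with `Der(L)` in degree zero. -/
def sumDeg (i : ℤ) : Submodule 𝕜 (𝓔.der × P.Forms) :=
  Submodule.prod (if i = 0 then ⊤ else ⊥) (P.formsDeg i)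

/-- The `L_∞` structure `𝔥` on `Der(L) ⊕ Ω_A^•(B)` extends the `L_∞` structure `𝔤` on `Ω_A^•(B)`
and the Lie algebra structure on `Der(L)`: the inclusion of `Ω_A^•(B)` and the projection to
`Der(L)` are (strict) `L_∞` morphisms, where the only bracket of `Der(L)` is its Lie bracket; the
subspace `Der(L)` is closed under the binary bracket; and every bracket with at least three entries
vanishes as soon as two entries are from `Der(L)`. -/
structure IsExtension (𝔤 : LInfinityAlgebra 𝕜 P.Forms P.formsDeg)
    (𝔥 : LInfinityAlgebra 𝕜 (𝓔.der × P.Forms) P.sumDeg) : Prop where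
  incl : ∀ (k : ℕ) (X : Fin k → P.Forms), 𝔥.bracket k (fun i => (0, X i)) = (0, 𝔤.bracket k X)
  proj_two : ∀ y : Fin 2 → 𝓔.der × P.Forms, (𝔥.bracket 2 y).1 = ⁅(y 0).1, (y 1).1⁆
  proj_ne_two : ∀ (k : ℕ) (y : Fin k → 𝓔.der × P.Forms), k ≠ 2 → (𝔥.bracket k y).1 = 0
  lie : ∀ δ δ' : 𝓔.der, 𝔥.bracket 2 ![(δ, 0), (δ', 0)] = (⁅δ, δ'⁆, 0)
  vanish : ∀ (k : ℕ) (y : Fin k → 𝓔.der × P.Forms), 3 ≤ k →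
    ∀ i j, i ≠ j → (y i).2 = 0 → (y j).2 = 0 → 𝔥.bracket k y = 0

/-- The brackets of `𝔥` with exactly one entry `δ` in `Der(L)` (and at most two others) are the
action maps: `[δ]_1 = κ(δ)`, `[δ, X]_2 = δ ▷ X` and `[δ, X, Y]_3 = δ ▷ (X, Y)`. -/
structure HasActionMaps (𝔥 : LInfinityAlgebra 𝕜 (𝓔.der × P.Forms) P.sumDeg) : Prop where
  zero : ∀ (δ : 𝓔.der) (a : Fin 1 → P.A),
    (𝔥.bracket 1 ![(δ, 0)]).2 1 a = P.kappa δ (a 0)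
  one : ∀ (δ : 𝓔.der) {k : ℕ} (X : P.Form k) (a : Fin k → P.A),
    (𝔥.bracket 2 ![(δ, 0), (0, P.of X)]).2 k a = P.act₁ δ X a
  two : ∀ (δ : 𝓔.der) {i j n : ℕ} (X : P.Form i) (Y : P.Form j) (h : i + j = n + 1)
    (a : Fin n → P.A),
    (𝔥.bracket 3 ![(δ, 0), (0, P.of X), (0, P.of Y)]).2 n a = P.act₂ δ X Y h a

end SplitLiePair

end LieRinehart

/-! ### Lie algebroids and Lie pairs over a manifold -/

section LieAlgebroids

attribute [local instance] LieRing.ofAssociativeRing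

variable {𝕜 : Type*} [RCLike 𝕜] {m : ℕ} {M : Type*} [TopologicalSpace M]
  [ChartedSpace (EuclideanSpace ℝ (Fin m)) M]
  {F : Type*} [NormedAddCommGroup F] [NormedSpace ℝ F] [NormedSpace 𝕜 F] [IsScalarTower ℝ 𝕜 F]
  {L : M → Type*} [TopologicalSpace (TotalSpace F L)] [∀ x, AddCommGroup (L x)]
  [∀ x, Module ℝ (L x)] [∀ x, Module 𝕜 (L x)] [∀ x, TopologicalSpace (L x)]
  [FiberBundle F L] [VectorBundle ℝ F L] [VectorBundle 𝕜 F L]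

variable (𝕜 m F L) in
/-- A Lie `𝕜`-algebroid structure on the `𝕜`-vector bundle `L → M`: a Lie–Rinehart structure on
`Γ(L)` over `C^∞(M, 𝕜)`. The anchor, a bundle map `L → TM ⊗ 𝕜`, is given by the `C^∞(M, 𝕜)`-linear
map it induces from `Γ(L)` to `Γ(TM ⊗ 𝕜) = Der_𝕜(C^∞(M, 𝕜))`. -/
abbrev LieAlgebroid : Type _ :=
  LieRinehart 𝕜 (SmoothFunction 𝕜 m M) (SmoothSection 𝕜 m F L)

/-- A Lie pair `(L, A)`: a Lie algebroid `L` with a Lie subalgebroid `A` over the same base, that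
is, a smooth subbundle whose sections are closed under the bracket. -/
structure LiePair (𝓔 : LieAlgebroid 𝕜 m F L) where
  A : ∀ x, Submodule 𝕜 (L x)
  isSmoothSubbundle : IsSmoothSubbundle (m := m) (F := F) A
  bracket_mem : ∀ u ∈ subbundleSections (m := m) (F := F) A,
    ∀ v ∈ subbundleSections (m := m) (F := F) A,
      𝓔.bracket u v ∈ subbundleSections (m := m) (F := F) A

/-- A decomposition `L = A ⊕ B`: a smooth subbundle `B` complementary to `A`. -/
structure LiePair.Decomposition {𝓔 : LieAlgebroid 𝕜 m F L} (P : LiePair 𝓔) where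
  B : ∀ x, Submodule 𝕜 (L x)
  isSmoothSubbundle : IsSmoothSubbundle (m := m) (F := F) B
  isCompl : ∀ x, IsCompl (P.A x) (B x)

/-- The decomposition `Γ(L) = Γ(A) ⊕ Γ(B)`. -/
def LiePair.Decomposition.split [FiniteDimensional 𝕜 F] {𝓔 : LieAlgebroid 𝕜 m F L}
    {P : LiePair 𝓔} (D : P.Decomposition) : SplitLiePair 𝓔 where
  A := subbundleSections P.A
  B := subbundleSections D.B
  bracket_mem := P.bracket_mem
  isCompl := isCompl_subbundleSections P.isSmoothSubbundle D.isSmoothSubbundle D.isCompl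

end LieAlgebroids

end

/-! Apart from the splitting `Γ(L) = Γ(A) ⊕ Γ(B)` of modules of sections, the argument is algebraic.
Start with a Lie bracket on `A × B` over a field of characteristic zero for which `A` is a
subalgebra. A `B`-valued form `X` on `A` perturbs the inclusion of `A` to `ℓ = id + X`, and has the
curvature `pr_B ½[ℓ, ℓ] - ι_u X` with `u = pr_A ½[ℓ, ℓ]`. (For a linear map `X`, this vanishes
exactly when the graph of `X` is a subalgebra.) As a function of `X` the curvature is a polynomial
of degree three without constant term. Viewed as a vector field on the graded space of forms it is
homological: its derivative along itself is zero, see `curvatureDeriv_curvature`. This follows from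
`[[ℓ, ℓ], ℓ] = 0` (`wedge_wedge_self`) and from two rules for the even operator `ι_u`
(`insertForm_wedge`, `insertForm_insertForm`). The Taylor coefficients of a homological vector field
that vanishes at the origin are the brackets of an `L_∞` algebra, and a cubic field gives an
`L_{≤3}` algebra.

To make polynomials in graded variables concrete, they are treated as graded symmetric functions on
lists of letters. The letters are the elements of `A`, in degree `-1`, and the `k`-forms, in degree
`k - 1`; the product is the shuffle product `shuffleSum`. The universal `X` is `univForm`, `ℓ` is
`totalForm`, and the curvature is `univBracket`: its value on `x₁, …, xₖ, a₁, …, aₙ` is `[x₁, …,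
xₖ](a₁, …, aₙ)` up to the sign `bracketSign` of the degree shift. Filling in a form letter
differentiates the curvature (`univBracket_inr`), so the nested brackets of the Jacobi rule add up
to the derivative of the curvature along itself (`shuffleSum_univBracket`, `altBracket_jacobi`).

Both parts of the theorem come from one instance of this: the Lie algebra `Der(L) ⋉ L`, decomposed
as `A ⊕ (Der(L) ⊕ B)` (`semidirect`). Among its `𝕜`-multilinear forms are the constants from
`Der(L)` and the `B`-valued forms that are linear over functions. These are closed under the
brackets. The terms that contain derivatives of functions cancel between the two summands of the
curvature (`univBracket_inl_smul`), and the components in `Der(L)` are controlled because `Der(L)`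
is a quotient Lie algebra (`univBracket_inl_fst`, `univBracket_fst`). Restriction to these forms
gives the structure on `Der(L) ⊕ Ω_A(B)`, and a second restriction the one on `Ω_A(B)`. The explicit
formulas are the terms of order one, two and three of the curvature:
`bracketSign_smul_univBracket_one`, `bracketSign_smul_univBracket_two` and
`bracketSign_smul_univBracket_three`. -/

/-! ### Sums over the ways to split a list in two, with signs -/

section ShuffleSum

variable {S M N : Type*} [AddCommGroup M] [AddCommGroup N] (c : S → S → ℤˣ)

/-- The sum of `F l₁ l₂` over all ways to distribute the letters of `l` over two sublists `l₁` and
`l₂`, with a sign `c s t` whenever a letter `s` of `l₂` precedes a letter `t` of `l₁`. -/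
def shuffleSum : (List S → List S → M) → List S → M
  | F, [] => F [] []
  | F, s :: l => shuffleSum (fun l₁ l₂ => F (s :: l₁) l₂) l +
      shuffleSum (fun l₁ l₂ => (l₁.map (c s)).prod • F l₁ (s :: l₂)) l

@[simp] theorem shuffleSum_nil (F : List S → List S → M) : shuffleSum c F [] = F [] [] := rfl

theorem shuffleSum_cons (F : List S → List S → M) (s : S) (l : List S) :
    shuffleSum c F (s :: l) = shuffleSum c (fun l₁ l₂ => F (s :: l₁) l₂) l +
      shuffleSum c (fun l₁ l₂ => (l₁.map (c s)).prod • F l₁ (s :: l₂)) l := rfl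

variable {c}

/-- The permutation hypothesis is what later arguments on degrees, lengths and kinds of letters rest
on: the two parts of a splitting together have exactly the letters of `l`. -/
theorem shuffleSum_congr {F G : List S → List S → M} {l : List S}
    (h : ∀ l₁ l₂, (l₁ ++ l₂).Perm l → F l₁ l₂ = G l₁ l₂) :
    shuffleSum c F l = shuffleSum c G l := by
  induction l generalizing F G with
  | nil => exact h [] [] (List.Perm.refl _)
  | cons s l ih =>
    rw [shuffleSum_cons, shuffleSum_cons]
    congr 1
    · exact ih fun l₁ l₂ hl => h _ _ (hl.cons s)
    · refine ih fun l₁ l₂ hl => ?_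
      rw [h l₁ (s :: l₂) (List.perm_middle.trans (hl.cons s))]

theorem map_shuffleSum {φ : Type*} [FunLike φ M N] [AddMonoidHomClass φ M N] (f : φ)
    (F : List S → List S → M) (l : List S) :
    f (shuffleSum c F l) = shuffleSum c (fun l₁ l₂ => f (F l₁ l₂)) l := by
  induction l generalizing F with
  | nil => rfl
  | cons s l ih =>
    rw [shuffleSum_cons, shuffleSum_cons, map_add, ih, ih]
    simp only [Units.smul_def, map_zsmul]

theorem shuffleSum_add (F G : List S → List S → M) (l : List S) :
    shuffleSum c (fun l₁ l₂ => F l₁ l₂ + G l₁ l₂) l = shuffleSum c F l + shuffleSum c G l := by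
  induction l generalizing F G with
  | nil => rfl
  | cons s l ih =>
    simp only [shuffleSum_cons, smul_add, ih]
    abel

theorem shuffleSum_units_smul (r : ℤˣ) (F : List S → List S → M) (l : List S) :
    shuffleSum c (fun l₁ l₂ => r • F l₁ l₂) l = r • shuffleSum c F l :=
  (map_shuffleSum (DistribSMul.toAddMonoidHom M r) F l).symm

theorem shuffleSum_smul {R : Type*} [Monoid R] [DistribMulAction R M] (r : R)
    (F : List S → List S → M) (l : List S) :
    shuffleSum c (fun l₁ l₂ => r • F l₁ l₂) l = r • shuffleSum c F l :=
  (map_shuffleSum (DistribSMul.toAddMonoidHom M r) F l).symm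

theorem shuffleSum_neg (F : List S → List S → M) (l : List S) :
    shuffleSum c (fun l₁ l₂ => - F l₁ l₂) l = - shuffleSum c F l :=
  (map_shuffleSum (negAddMonoidHom : M →+ M) F l).symm

theorem shuffleSum_sub (F G : List S → List S → M) (l : List S) :
    shuffleSum c (fun l₁ l₂ => F l₁ l₂ - G l₁ l₂) l = shuffleSum c F l - shuffleSum c G l := by
  simp only [sub_eq_add_neg, shuffleSum_add, shuffleSum_neg]

theorem shuffleSum_finset_sum {ι : Type*} (t : Finset ι) (F : ι → List S → List S → M)
    (l : List S) :
    shuffleSum c (fun l₁ l₂ => ∑ i ∈ t, F i l₁ l₂) l = ∑ i ∈ t, shuffleSum c (F i) l := by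
  induction l generalizing F with
  | nil => rfl
  | cons s l ih => simp only [shuffleSum_cons, Finset.smul_sum, ih, Finset.sum_add_distrib]

theorem shuffleSum_eq_zero {F : List S → List S → M} {l : List S}
    (h : ∀ l₁ l₂, (l₁ ++ l₂).Perm l → F l₁ l₂ = 0) : shuffleSum c F l = 0 := by
  rw [shuffleSum_congr (G := fun _ _ => 0) h]
  simpa using shuffleSum_smul (c := c) (0 : ℤ) (fun _ _ => (0 : M)) l

/-- When all letters are in the second part no letter is out of order, so the surviving term carries
no sign. -/
theorem shuffleSum_of_left_nil {F : List S → List S → M} {l : List S}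
    (h : ∀ l₁ l₂, l₁ ≠ [] → F l₁ l₂ = 0) : shuffleSum c F l = F [] l := by
  induction l generalizing F with
  | nil => rfl
  | cons s l ih =>
    rw [shuffleSum_cons, shuffleSum_eq_zero fun l₁ l₂ _ => h _ _ (by simp), zero_add, ih]
    · simp
    · intro l₁ l₂ hl
      rw [h l₁ _ hl, smul_zero]

theorem shuffleSum_of_right_nil {F : List S → List S → M} {l : List S}
    (h : ∀ l₁ l₂, l₂ ≠ [] → F l₁ l₂ = 0) : shuffleSum c F l = F l [] := by
  induction l generalizing F with
  | nil => rfl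
  | cons s l ih =>
    rw [shuffleSum_cons, shuffleSum_eq_zero (F := fun l₁ l₂ => _ • F l₁ (s :: l₂)), add_zero, ih]
    · exact fun l₁ l₂ hl => h _ _ hl
    · intro l₁ l₂ _
      rw [h _ _ (by simp), smul_zero]

/-- Both sides run over the distributions of `l` over three sublists. A letter sent to the third
list passes those of the first two at once, and the product of its factors over their union does not
depend on the order. -/
theorem shuffleSum_assoc (F : List S → List S → List S → M) (l : List S) :
    shuffleSum c (fun l₁ l' => shuffleSum c (fun l₂ l₃ => F l₁ l₂ l₃) l') l =
      shuffleSum c (fun l' l₃ => shuffleSum c (fun l₁ l₂ => F l₁ l₂ l₃) l') l := by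
  induction l generalizing F with
  | nil => rfl
  | cons s l ih =>
    simp only [shuffleSum_cons, smul_add, shuffleSum_add, ← shuffleSum_units_smul]
    rw [ih, ih, ih, add_assoc]
    congr 2
    refine shuffleSum_congr fun l' l₃ _ => shuffleSum_congr fun l₁ l₂ h => ?_
    rw [smul_smul, ← (h.map (c s)).prod_eq, List.map_append, List.prod_append]

/-- Exchanging the two lists turns the pairs that were in order into those out of order. As the
factors are symmetric and square to one, the signs differ by the product over all pairs. -/
theorem shuffleSum_comm (hc : ∀ s t, c s t = c t s) (F : List S → List S → M) (l : List S) :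
    shuffleSum c F l =
      shuffleSum c (fun l₁ l₂ => (l₁.map fun s => (l₂.map (c s)).prod).prod • F l₂ l₁) l := by
  induction l generalizing F with
  | nil => simp
  | cons s l ih =>
    rw [shuffleSum_cons, shuffleSum_cons, ih (fun l₁ l₂ => F (s :: l₁) l₂),
      ih (fun l₁ l₂ => (l₁.map (c s)).prod • F l₁ (s :: l₂)), add_comm]
    congr 1
    · refine shuffleSum_congr fun l₁ l₂ _ => ?_
      simp [smul_smul, mul_comm]
    · refine shuffleSum_congr fun l₁ l₂ _ => ?_
      rw [smul_smul]
      congr 1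
      simp only [List.map_cons, List.prod_cons, List.prod_map_mul]
      rw [show (fun t => c t s) = c s from funext fun t => hc t s, ← mul_assoc,
        Int.units_mul_self, one_mul]

/-- Every letter of `l` precedes every letter of `m`, so a letter of `l` in the second list and one
of `m` in the first are always out of order; these pairs give the extra sign. -/
theorem shuffleSum_append (F : List S → List S → M) (l m : List S) :
    shuffleSum c F (l ++ m) = shuffleSum c (fun l₁ l₂ => shuffleSum c (fun m₁ m₂ =>
      (l₂.map fun s => (m₁.map (c s)).prod).prod • F (l₁ ++ m₁) (l₂ ++ m₂)) m) l := by
  induction l generalizing F with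
  | nil => simp
  | cons s l ih =>
    rw [List.cons_append, shuffleSum_cons, shuffleSum_cons, ih, ih]
    congr 1
    refine shuffleSum_congr fun l₁ l₂ _ => ?_
    rw [← shuffleSum_units_smul]
    refine shuffleSum_congr fun m₁ m₂ _ => ?_
    simp only [List.map_append, List.prod_append, List.map_cons, List.prod_cons, List.cons_append,
      smul_smul]
    congr 1
    ac_rfl

/-- Changing the commutation factor by a coboundary. -/
theorem shuffleSum_twist {c' h : S → S → ℤˣ} (hc : ∀ s t, c' s t = c s t * h s t * h t s)
    (H : List S → ℤˣ) (H_cons : ∀ s l, H (s :: l) = (l.map (h s)).prod * H l)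
    (F : List S → List S → M) (l : List S) :
    shuffleSum c (fun l₁ l₂ => H (l₁ ++ l₂) • F l₁ l₂) l = H l • shuffleSum c' F l := by
  -- `H` is the product of `h` over all ordered pairs; removing `s` splits off its pairs with the
  -- earlier and with the later letters.
  have key : ∀ (s : S) (l₁ l₂ : List S),
      H (l₁ ++ s :: l₂) = (l₁.map fun t => h t s).prod * (l₂.map (h s)).prod * H (l₁ ++ l₂) := by
    intro s l₁ l₂
    induction l₁ with
    | nil => simp [H_cons]
    | cons t l₁ ih =>
      simp only [List.cons_append, H_cons, ih, List.map_append, List.map_cons, List.prod_append,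
        List.prod_cons]
      ac_rfl
  induction l generalizing F with
  | nil => simp
  | cons s l ih =>
    rw [shuffleSum_cons, shuffleSum_cons, smul_add, H_cons, mul_smul, mul_smul, ← ih, ← ih,
      ← shuffleSum_units_smul, ← shuffleSum_units_smul]
    congr 1
    · refine shuffleSum_congr fun l₁ l₂ hl => ?_
      rw [List.cons_append, H_cons, smul_smul, (hl.map (h s)).prod_eq]
    · refine shuffleSum_congr fun l₁ l₂ hl => ?_
      rw [smul_smul, smul_smul, smul_smul, key, ← (hl.map (h s)).prod_eq]
      congr 1
      rw [show c' s = fun t => c s t * h s t * h t s from funext fun t => hc s t]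
      simp only [List.prod_map_mul, List.map_append, List.prod_append]
      have := Int.units_mul_self (l₁.map (h s)).prod
      calc _ = (l₁.map (c s)).prod * (l₁.map fun t => h t s).prod * (l₂.map (h s)).prod *
            H (l₁ ++ l₂) * 1 := by rw [mul_one]; ac_rfl
        _ = _ := by rw [← this]; ac_rfl

/-- If `s` and `t` land in the same list, the symmetry of `F` gives the factor. If they land in
different lists, they are out of order in exactly one of the two arrangements, and the shuffle sign
gives it. Hence shuffle products of graded symmetric forms are graded symmetric. -/
theorem shuffleSum_swap (hc : ∀ s t, c s t = c t s) {F : List S → List S → M}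
    (h₁ : ∀ k l s t m, F (k ++ s :: t :: l) m = c s t • F (k ++ t :: s :: l) m)
    (h₂ : ∀ k l s t m, F m (k ++ s :: t :: l) = c s t • F m (k ++ t :: s :: l))
    (k l : List S) (s t : S) :
    shuffleSum c F (k ++ s :: t :: l) = c s t • shuffleSum c F (k ++ t :: s :: l) := by
  induction k generalizing F with
  | nil =>
    simp only [List.nil_append, shuffleSum_cons, smul_add, ← shuffleSum_units_smul]
    have e₁ := fun l₁ l₂ => h₁ [] l₁ s t l₂
    have e₂ := fun l₁ l₂ => h₂ [] l₂ s t l₁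
    simp only [List.nil_append] at e₁ e₂
    have a1 : shuffleSum c (fun l₁ l₂ => F (s :: t :: l₁) l₂) l =
        shuffleSum c (fun l₁ l₂ => c s t • F (t :: s :: l₁) l₂) l := by simp only [e₁]
    have a2 : shuffleSum c (fun l₁ l₂ => (l₁.map (c t)).prod • F (s :: l₁) (t :: l₂)) l =
        shuffleSum c (fun l₁ l₂ => c s t • ((s :: l₁).map (c t)).prod • F (s :: l₁) (t :: l₂)) l := by
      refine shuffleSum_congr fun l₁ l₂ _ => ?_
      rw [smul_smul, List.map_cons, List.prod_cons, hc t s, ← mul_assoc, Int.units_mul_self, one_mul]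
    have a3 : shuffleSum c (fun l₁ l₂ => ((t :: l₁).map (c s)).prod • F (t :: l₁) (s :: l₂)) l =
        shuffleSum c (fun l₁ l₂ => c s t • (l₁.map (c s)).prod • F (t :: l₁) (s :: l₂)) l := by
      refine shuffleSum_congr fun l₁ l₂ _ => ?_
      rw [smul_smul, List.map_cons, List.prod_cons]
    have a4 : shuffleSum c (fun l₁ l₂ => (l₁.map (c t)).prod • (l₁.map (c s)).prod •
          F l₁ (s :: t :: l₂)) l =
        shuffleSum c (fun l₁ l₂ => c s t • (l₁.map (c s)).prod • (l₁.map (c t)).prod •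
          F l₁ (t :: s :: l₂)) l := by
      refine shuffleSum_congr fun l₁ l₂ _ => ?_
      rw [e₂, smul_smul, smul_smul, smul_smul, smul_smul]
      congr 1
      ac_rfl
    rw [a1, a2, a3, a4]
    abel
  | cons r k ih =>
    rw [List.cons_append, List.cons_append, shuffleSum_cons, shuffleSum_cons, smul_add, ih, ih]
    · intro k l s t m
      rw [h₁ k l s t, smul_smul, smul_smul, mul_comm, (((List.Perm.swap _ _ l).append_left k).map (c r)).prod_eq]
    · intro k l s t m
      have := h₂ (r :: k) l s t m
      simp only [List.cons_append] at this
      rw [this, smul_comm]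
    · exact fun k l s t m => h₁ (r :: k) l s t m
    · exact fun k l s t m => h₂ k l s t (r :: m)

end ShuffleSum

/-! ### Sums over shuffle permutations -/

section ShufflePermutations

open Equiv (Perm)

variable {S M : Type*} [AddCommGroup M]

/-- The permutation of `n + 1` letters which takes the value `0` at `k` and is `σ` otherwise. -/
def permInsert {n : ℕ} (k : Fin (n + 1)) (σ : Perm (Fin n)) : Perm (Fin (n + 1)) :=
  Equiv.Perm.decomposeFin.symm (0, σ) * k.cycleRange

@[simp] theorem permInsert_self {n : ℕ} (k : Fin (n + 1)) (σ : Perm (Fin n)) :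
    permInsert k σ k = 0 := by
  simp [permInsert]

@[simp] theorem permInsert_succAbove {n : ℕ} (k : Fin (n + 1)) (σ : Perm (Fin n)) (j : Fin n) :
    permInsert k σ (k.succAbove j) = (σ j).succ := by
  simp [permInsert, Fin.cycleRange_succAbove]

theorem sign_permInsert {n : ℕ} (k : Fin (n + 1)) (σ : Perm (Fin n)) :
    Perm.sign (permInsert k σ) = (-1) ^ k.val * Perm.sign σ := by
  simp [permInsert, Fin.sign_cycleRange, mul_comm]

/-- A permutation is determined by the position of the value `0` and by the permutation of the rest.
This makes induction on permutations parallel to the recursion of `shuffleSum` on the first letter.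
-/
theorem permInsert_bijective (n : ℕ) :
    Function.Bijective fun y : Fin (n + 1) × Perm (Fin n) => permInsert y.1 y.2 := by
  rw [Fintype.bijective_iff_injective_and_card]
  constructor
  · rintro ⟨k, σ⟩ ⟨k', σ'⟩ h
    have h : permInsert k σ = permInsert k' σ' := h
    have hk : k = k' := by
      apply (permInsert k' σ').injective
      rw [permInsert_self, ← h, permInsert_self]
    subst hk
    refine Prod.ext rfl (Equiv.ext fun j => ?_)
    have := congrArg (fun τ : Perm (Fin (n + 1)) => τ (k.succAbove j)) h
    simpa using this
  · simp [Fintype.card_perm, Nat.factorial_succ]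

theorem sum_perm_succ {n : ℕ} (f : Perm (Fin (n + 1)) → M) :
    ∑ σ, f σ = ∑ k, ∑ σ, f (permInsert k σ) := by
  rw [← Fintype.sum_prod_type']
  exact (Fintype.sum_bijective _ (permInsert_bijective n) _ _ fun _ => rfl).symm

theorem perm_succ_induction {n : ℕ} {motive : Perm (Fin (n + 1)) → Prop}
    (h : ∀ k σ, motive (permInsert k σ)) (σ : Perm (Fin (n + 1))) : motive σ := by
  obtain ⟨⟨k, σ⟩, rfl⟩ := (permInsert_bijective n).surjective σ
  exact h k σ

theorem ofFn_comp_permInsert {n : ℕ} (k : Fin (n + 1)) (σ : Perm (Fin n)) (x : Fin (n + 1) → S) :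
    List.ofFn (x ∘ permInsert k σ) = (List.ofFn (x ∘ Fin.succ ∘ σ)).take k ++
      x 0 :: (List.ofFn (x ∘ Fin.succ ∘ σ)).drop k := by
  have e : x ∘ permInsert k σ = k.insertNth (x 0) (x ∘ Fin.succ ∘ σ) := by
    funext a
    refine Fin.succAboveCases k ?_ (fun j => ?_) a <;> simp
  rw [e]
  apply List.ext_getElem
  · simp; omega
  · intro i h₁ h₂
    simp only [List.length_ofFn] at h₁
    rw [List.getElem_ofFn]
    rcases lt_trichotomy i k.val with h | h | h
    · have : (⟨i, h₁⟩ : Fin (n + 1)) = k.succAbove ⟨i, by omega⟩ := by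
        rw [Fin.succAbove_of_castSucc_lt _ _ h]; rfl
      rw [this, Fin.insertNth_apply_succAbove, List.getElem_append_left (by simp; omega)]
      simp
    · have : (⟨i, h₁⟩ : Fin (n + 1)) = k := Fin.ext h
      rw [this, Fin.insertNth_apply_same, List.getElem_append_right (by simp; omega)]
      simp [h, show k.val - min k.val n = 0 by omega]
    · have : (⟨i, h₁⟩ : Fin (n + 1)) = k.succAbove ⟨i - 1, by omega⟩ := by
        rw [Fin.succAbove_of_le_castSucc _ _ (by rw [Fin.le_def]; simp; omega)]
        ext; simp; omega
      have h' : min k.val n = k := by omega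
      rw [this, Fin.insertNth_apply_succAbove, List.getElem_append_right (by simp; omega),
        List.getElem_cons]
      simp only [List.length_take, List.length_ofFn, h', List.getElem_drop, List.getElem_ofFn]
      rw [dif_neg (by omega)]
      congr 2
      omega

/-- The product of the commutation factors over the inversions of `σ`. -/
def invSign (c : S → S → ℤˣ) {n : ℕ} (x : Fin n → S) (σ : Perm (Fin n)) : ℤˣ :=
  ∏ a : Fin n, ∏ b : Fin n, if a < b ∧ σ b < σ a then c (x (σ b)) (x (σ a)) else 1

/-- The inversions that involve the value `0` are those with the positions before `k`; the others
are the inversions of `σ`. -/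
theorem invSign_permInsert (c : S → S → ℤˣ) {n : ℕ} (k : Fin (n + 1)) (σ : Perm (Fin n))
    (x : Fin (n + 1) → S) :
    invSign c x (permInsert k σ) =
      (((List.ofFn (x ∘ Fin.succ ∘ σ)).take k).map (c (x 0))).prod *
        invSign c (x ∘ Fin.succ) σ := by
  have h1 : (((List.ofFn (x ∘ Fin.succ ∘ σ)).take k).map (c (x 0))).prod =
      ∏ j : Fin n, if k.succAbove j < k then c (x 0) (x (σ j).succ) else 1 := by
    rw [List.map_take, List.map_ofFn, List.prod_take_ofFn, Finset.prod_filter]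
    refine Finset.prod_congr rfl fun j _ => ?_
    have : k.succAbove j < k ↔ j.val < k.val := Fin.succAbove_lt_iff_castSucc_lt k j
    simp [this]
  rw [h1, invSign, Fin.prod_univ_succAbove _ k]
  have h2 : ∏ b, (if k < b ∧ permInsert k σ b < permInsert k σ k then
      c (x (permInsert k σ b)) (x (permInsert k σ k)) else 1) = 1 :=
    Finset.prod_eq_one fun b _ => by simp
  rw [h2, one_mul, invSign, ← Finset.prod_mul_distrib]
  refine Finset.prod_congr rfl fun a _ => ?_
  rw [Fin.prod_univ_succAbove _ k]
  simp

theorem invSign_neg_one {n : ℕ} (σ : Perm (Fin n)) (x : Fin n → S) :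
    invSign (fun _ _ => -1) x σ = Perm.sign σ := by
  induction n with
  | zero => simp [invSign, Subsingleton.elim σ 1]
  | succ n ih =>
    induction σ using perm_succ_induction with
    | h k σ =>
      rw [invSign_permInsert, ih, sign_permInsert]
      congr 1
      rw [List.prod_eq_pow_card _ (-1 : ℤˣ) (by
        intro y hy
        obtain ⟨j, _, rfl⟩ := List.mem_map.1 hy
        rfl)]
      simp [show min k.val n = k by omega]

theorem koszulChi_eq_invSign {n : ℕ} (σ : Perm (Fin n)) (d : Fin n → ℤ) :
    koszulChi σ d = invSign (fun i j => - (i * j).negOnePow) d σ := by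
  rw [koszulChi, ← invSign_neg_one σ d, invSign, invSign, ← Finset.prod_mul_distrib]
  refine Finset.prod_congr rfl fun a _ => ?_
  rw [← Finset.prod_mul_distrib]
  refine Finset.prod_congr rfl fun b _ => ?_
  split_ifs <;> simp [mul_comm]

/-- The least value must stand first in one of the blocks, at position `0`, `p` or `p + q`. The
conditions `0 < p` and `0 < q` keep the cases apart when a block is empty; no such condition is
needed for the third block, since `k = p + q` is itself a position in it. -/
theorem permInsert_mem_shuffles₃ {n p q : ℕ} (k : Fin (n + 1))
    (σ : Perm (Fin n)) :
    permInsert k σ ∈ shuffles₃ (n + 1) p q ↔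
      (k.val = 0 ∧ 0 < p ∧ σ ∈ shuffles₃ n (p - 1) q) ∨
      (k.val = p ∧ 0 < q ∧ σ ∈ shuffles₃ n p (q - 1)) ∨
      (k.val = p + q ∧ σ ∈ shuffles₃ n p q) := by
  have val_sA : ∀ j : Fin n, (k.succAbove j).val = if j.val < k.val then j.val else j.val + 1 := by
    intro j
    rw [Fin.succAbove]
    simp only [Fin.lt_def, Fin.val_castSucc]
    split_ifs <;> rfl
  simp only [shuffles₃, Finset.mem_filter, Finset.mem_univ, true_and]
  constructor
  · intro hτ
    have hk : k.val = 0 ∧ 0 < p ∨ k.val = p ∧ 0 < q ∨ k.val = p + q := by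
      by_contra hk
      have hpos : 0 < k.val := by omega
      have := hτ ⟨k.val - 1, by omega⟩ k (by rw [Fin.lt_def]; simp only; omega) (by simp only; omega)
      simp at this
    have step : ∀ j j' : Fin n, j < j' → (((k.succAbove j').val < p) ∨
        (p ≤ (k.succAbove j).val ∧ (k.succAbove j').val < p + q) ∨
          p + q ≤ (k.succAbove j).val) → σ j < σ j' := by
      intro j j' hj hb
      have := hτ (k.succAbove j) (k.succAbove j') (Fin.strictMono_succAbove k hj) hb
      simpa using this
    simp only [val_sA] at step
    rcases hk with ⟨hk, hp⟩ | ⟨hk, hq⟩ | hk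
    · refine Or.inl ⟨hk, hp, fun a b hab hb => step a b hab ?_⟩
      split_ifs <;> omega
    · refine Or.inr (Or.inl ⟨hk, hq, fun a b hab hb => step a b hab ?_⟩)
      rw [Fin.lt_def] at hab
      split_ifs <;> omega
    · refine Or.inr (Or.inr ⟨hk, fun a b hab hb => step a b hab ?_⟩)
      rw [Fin.lt_def] at hab
      split_ifs <;> omega
  · intro hσ a b
    refine Fin.succAboveCases k ?_ (fun j => ?_) a
    · refine Fin.succAboveCases k ?_ (fun j' => ?_) b
      · intro hab; exact absurd hab (lt_irrefl _)
      · intro _ _; simp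
    · refine Fin.succAboveCases k ?_ (fun j' => ?_) b
      · intro hab hb
        rw [Fin.lt_def] at hab
        exfalso
        rcases hσ with h | h | h <;> omega
      · intro hab hb
        rw [permInsert_succAbove, permInsert_succAbove, Fin.succ_lt_succ_iff]
        have hjj := (Fin.strictMono_succAbove k).lt_iff_lt.1 hab
        have hjj' := Fin.lt_def.1 hjj
        rw [val_sA, val_sA] at hb
        rcases hσ with ⟨hk, hp, h⟩ | ⟨hk, hp, h⟩ | ⟨hk, h⟩ <;> apply h _ _ hjj <;>
          split_ifs at hb <;> omega

/-- The dictionary between shuffle permutations and the recursive `shuffleSum`: the three possible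
positions of the value `0` correspond to the three lists that the first letter of `x` can join, with
equal signs. -/
theorem sum_shuffles₃_take_drop (c : S → S → ℤˣ) {n p q : ℕ} (h : p + q ≤ n) (x : Fin n → S)
    (F : List S → List S → List S → M) :
    ∑ σ ∈ shuffles₃ n p q, invSign c x σ • F ((List.ofFn (x ∘ σ)).take p)
        (((List.ofFn (x ∘ σ)).drop p).take q) ((List.ofFn (x ∘ σ)).drop (p + q)) =
      shuffleSum c (fun l₁ l' => if l₁.length = p then
        shuffleSum c (fun l₂ l₃ => if l₂.length = q then F l₁ l₂ l₃ else 0) l' else 0)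
        (List.ofFn x) := by
  induction n generalizing p q F with
  | zero =>
    obtain ⟨rfl, rfl⟩ : p = 0 ∧ q = 0 := by omega
    have : shuffles₃ 0 0 0 = {1} := by
      ext σ
      simp [shuffles₃, Subsingleton.elim σ 1]
    simp [this, invSign]
  | succ n ih =>
    set x' := x ∘ Fin.succ with hx'
    set L := fun σ : Perm (Fin n) => List.ofFn (x' ∘ σ) with hL
    have hlen : ∀ σ, (L σ).length = n := fun σ => by simp [hL]
    set T : Perm (Fin (n + 1)) → M := fun σ => invSign c x σ • F ((List.ofFn (x ∘ σ)).take p)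
        (((List.ofFn (x ∘ σ)).drop p).take q) ((List.ofFn (x ∘ σ)).drop (p + q)) with hT
    -- At most one of the three summands is nonzero, as the cases of `permInsert_mem_shuffles₃`
    -- exclude each other even for empty blocks.
    have hmem : ∀ (k : Fin (n + 1)) σ,
        (if permInsert k σ ∈ shuffles₃ (n + 1) p q then T (permInsert k σ) else 0) =
        (if k.val = 0 then if 0 < p ∧ σ ∈ shuffles₃ n (p - 1) q then T (permInsert k σ) else 0
          else 0) +
        (if k.val = p then if 0 < q ∧ σ ∈ shuffles₃ n p (q - 1) then T (permInsert k σ) else 0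
          else 0) +
        (if k.val = p + q then if σ ∈ shuffles₃ n p q then T (permInsert k σ) else 0 else 0) := by
      intro k σ
      simp only [permInsert_mem_shuffles₃]
      by_cases h0 : k.val = 0 ∧ 0 < p
      · have h1 : ¬ k.val = p := by omega
        have h2 : ¬ k.val = p + q := by omega
        simp [h0, show ¬ 0 = p by omega, show ¬ 0 = p + q by omega]
      by_cases h1 : k.val = p ∧ 0 < q
      · have h2 : ¬ k.val = p + q := by omega
        have h3 : ¬ (k.val = 0 ∧ 0 < p) := h0
        obtain ⟨hk, hq⟩ := h1
        have e1 : ¬ 0 < q ↔ False := by simp [hq]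
        by_cases hp : p = 0
        · simp [hk, hp, hq, hq.ne]
        · simp [hk, hp, hq, hq.ne']
      · have h3 : (k.val = 0 ∧ 0 < p ∧ σ ∈ shuffles₃ n (p - 1) q) ↔ False := by tauto
        have h4 : (k.val = p ∧ 0 < q ∧ σ ∈ shuffles₃ n p (q - 1)) ↔ False := by tauto
        have h5 : (if k.val = 0 then if 0 < p ∧ σ ∈ shuffles₃ n (p - 1) q then T (permInsert k σ)
          else 0 else 0) = 0 := by
          split_ifs <;> first | rfl | tauto
        have h6 : (if k.val = p then if 0 < q ∧ σ ∈ shuffles₃ n p (q - 1) then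
            T (permInsert k σ) else 0 else 0) = 0 := by
          split_ifs <;> first | rfl | tauto
        rw [h5, h6, zero_add, zero_add]
        simp only [h3, h4, false_or, ite_and]
    have hsum : ∑ σ ∈ shuffles₃ (n + 1) p q, T σ =
        (if 0 < p then ∑ σ ∈ shuffles₃ n (p - 1) q, T (permInsert 0 σ) else 0) +
        (if hq : 0 < q then ∑ σ ∈ shuffles₃ n p (q - 1), T (permInsert ⟨p, by omega⟩ σ) else 0) +
        (if hn : p + q ≤ n then ∑ σ ∈ shuffles₃ n p q, T (permInsert ⟨p + q, by omega⟩ σ)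
          else 0) := by
      have e0 : ∑ σ ∈ shuffles₃ (n + 1) p q, T σ =
          ∑ σ, if σ ∈ shuffles₃ (n + 1) p q then T σ else 0 := by
        rw [Finset.sum_ite_mem, Finset.univ_inter]
      rw [e0, sum_perm_succ]
      simp only [hmem, Finset.sum_add_distrib]
      congr 1
      · congr 1
        · rw [Finset.sum_eq_single 0]
          · by_cases hp : 0 < p <;> simp [hp, Finset.sum_ite_mem]
          · intro k _ hk
            have : ¬ k.val = 0 := fun e => hk (Fin.ext e)
            simp [this]
          · simp
        · by_cases hq : 0 < q
          · rw [Finset.sum_eq_single ⟨p, by omega⟩]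
            · simp [hq, Finset.sum_ite_mem]
            · intro k _ hk
              have : ¬ k.val = p := fun e => hk (Fin.ext e)
              simp [this]
            · simp
          · simp [hq]
      · by_cases hn : p + q ≤ n
        · rw [Finset.sum_eq_single ⟨p + q, by omega⟩]
          · simp [hn, Finset.sum_ite_mem]
          · intro k _ hk
            have : ¬ k.val = p + q := fun e => hk (Fin.ext e)
            simp [this]
          · simp
        · rw [dif_neg hn]
          refine Finset.sum_eq_zero fun k _ => Finset.sum_eq_zero fun σ _ => ?_
          rw [if_neg (by omega)]
    rw [hsum, List.ofFn_succ, shuffleSum_cons, add_assoc]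
    congr 1
    · by_cases hp : 0 < p
      · obtain ⟨p, rfl⟩ : ∃ p', p = p' + 1 := ⟨p - 1, by omega⟩
        rw [if_pos hp]
        have := ih (p := p) (q := q) (by omega) x' (fun l₁ l₂ l₃ => F (x 0 :: l₁) l₂ l₃)
        simp only [List.length_cons, add_left_inj]
        refine Eq.trans ?_ this
        refine Finset.sum_congr rfl fun σ _ => ?_
        simp only [hT, ofFn_comp_permInsert, invSign_permInsert]
        simp [← hx', Nat.add_right_comm p 1 q, ← Function.comp_assoc]
      · rw [if_neg hp, shuffleSum_eq_zero]
        intro l₁ l₂ _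
        rw [if_neg (by simp; omega)]
    · have e : ∀ l₁ l' : List S, (l₁.map (c (x 0))).prod • (if l₁.length = p then
          shuffleSum c (fun l₂ l₃ => if l₂.length = q then F l₁ l₂ l₃ else 0) (x 0 :: l') else 0) =
          (if l₁.length = p then shuffleSum c (fun l₂ l₃ => if l₂.length = q - 1 then
            (if 0 < q then (l₁.map (c (x 0))).prod • F l₁ (x 0 :: l₂) l₃ else 0) else 0) l' else 0) +
          (if l₁.length = p then shuffleSum c (fun l₂ l₃ => if l₂.length = q then
            ((l₁.map (c (x 0))).prod * (l₂.map (c (x 0))).prod) • F l₁ l₂ (x 0 :: l₃)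
              else 0) l' else 0) := by
        intro l₁ l'
        by_cases hl : l₁.length = p
        · simp only [if_pos hl]
          rw [shuffleSum_cons, smul_add, ← shuffleSum_units_smul, ← shuffleSum_units_smul]
          congr 1
          · refine shuffleSum_congr fun l₂ l₃ _ => ?_
            simp only [List.length_cons]
            split_ifs <;> first | rfl | omega | simp
          · refine shuffleSum_congr fun l₂ l₃ _ => ?_
            split_ifs <;> simp [mul_smul]
        · simp only [if_neg hl]
          rw [smul_zero, add_zero]
      simp only [e, shuffleSum_add]
      congr 1
      · by_cases hq : 0 < q
        · rw [dif_pos hq]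
          obtain ⟨q, rfl⟩ : ∃ q', q = q' + 1 := ⟨q - 1, by omega⟩
          have := ih (p := p) (q := q) (by omega) x'
            (fun l₁ l₂ l₃ => (l₁.map (c (x 0))).prod • F l₁ (x 0 :: l₂) l₃)
          simp only [hq, if_true]
          refine Eq.trans ?_ this
          refine Finset.sum_congr rfl fun σ _ => ?_
          have hl : (List.ofFn (x' ∘ σ)).length = n := hlen σ
          simp only [hT, ofFn_comp_permInsert, invSign_permInsert]
          rw [← Function.comp_assoc, ← hx', mul_comm, mul_smul]
          have hp : min p n = p := by omega
          congr 2
          congr 1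
          · simp [hp]
          · simp [hp]
          · rw [← add_assoc]
            simp [List.drop_append, hp, List.drop_of_length_le, add_assoc]
        · rw [dif_neg hq, shuffleSum_eq_zero]
          intro l₁ l' _
          simp only [hq, if_false, ite_self]
          split_ifs
          · exact shuffleSum_eq_zero fun _ _ _ => rfl
          · rfl
      · by_cases hn : p + q ≤ n
        · rw [dif_pos hn]
          have := ih (p := p) (q := q) hn x'
            (fun l₁ l₂ l₃ => ((l₁.map (c (x 0))).prod * (l₂.map (c (x 0))).prod) •
              F l₁ l₂ (x 0 :: l₃))
          refine Eq.trans ?_ this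
          refine Finset.sum_congr rfl fun σ _ => ?_
          have hl : (List.ofFn (x' ∘ σ)).length = n := hlen σ
          simp only [hT, ofFn_comp_permInsert, invSign_permInsert]
          rw [← Function.comp_assoc, ← hx', mul_comm, mul_smul]
          have hp : min (p + q) n = p + q := by omega
          have hp' : min p (p + q) = p := by omega
          set K := (List.ofFn (x' ∘ σ)).take (p + q) with hK
          have hKl : K.length = p + q := by rw [hK, List.length_take, hl, hp]
          have e1 : K.take p = (List.ofFn (x' ∘ σ)).take p := by rw [hK, List.take_take, hp']
          have e2 : K.drop p = ((List.ofFn (x' ∘ σ)).drop p).take q := by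
            rw [hK, List.drop_take, Nat.add_sub_cancel_left]
          congr 1
          rw [← e1, ← e2, ← List.prod_append, ← List.map_append, List.take_append_drop,
            List.take_append_of_le_length (by omega), List.drop_append_of_le_length (by omega),
            List.take_left' (by simp [hKl]), List.drop_left' hKl]
        · rw [dif_neg hn, shuffleSum_eq_zero]
          intro l₁ l' hl
          split_ifs with h1
          · refine shuffleSum_eq_zero fun l₂ l₃ hl' => ?_
            rw [if_neg]
            have a := hl.length_eq
            have b := hl'.length_eq
            simp only [List.length_append, List.length_ofFn] at a b
            omega
          · rfl

theorem ofFn_block {n s l : ℕ} (x : Fin n → S) (σ : Perm (Fin n)) (h : s + l ≤ n) :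
    List.ofFn (block x σ s l h) = ((List.ofFn (x ∘ σ)).drop s).take l := by
  apply List.ext_getElem
  · simp; omega
  · intro i h₁ h₂
    simp [block]

theorem sum_shuffles₃ (c : S → S → ℤˣ) {n p q r : ℕ} (h : p + q + r = n) (x : Fin n → S)
    (F : List S → List S → List S → M) :
    ∑ σ ∈ shuffles₃ n p q, invSign c x σ • F (List.ofFn (block x σ 0 p (by omega)))
        (List.ofFn (block x σ p q (by omega))) (List.ofFn (block x σ (p + q) r (by omega))) =
      shuffleSum c (fun l₁ l' => if l₁.length = p then
        shuffleSum c (fun l₂ l₃ => if l₂.length = q then F l₁ l₂ l₃ else 0) l' else 0)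
        (List.ofFn x) := by
  rw [← sum_shuffles₃_take_drop c (by omega)]
  refine Finset.sum_congr rfl fun σ _ => ?_
  rw [ofFn_block, ofFn_block, ofFn_block, List.drop_zero,
    List.take_of_length_le (l := (List.ofFn (x ∘ σ)).drop (p + q)) (by simp; omega)]

theorem shuffles_eq_shuffles₃ {n p q : ℕ} (h : p + q = n) : shuffles n p = shuffles₃ n p q := by
  ext σ
  simp only [shuffles, shuffles₃, Finset.mem_filter, Finset.mem_univ, true_and]
  refine forall_congr' fun a => forall_congr' fun b => imp_congr_right fun _ => ?_
  have : (b.val < p ∨ p ≤ a.val) ↔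
      (b.val < p ∨ (p ≤ a.val ∧ b.val < p + q) ∨ p + q ≤ a.val) := by omega
  rw [this]

theorem sum_shuffles (c : S → S → ℤˣ) {n p q : ℕ} (h : p + q = n) (x : Fin n → S)
    (F : List S → List S → M) :
    ∑ σ ∈ shuffles n p, invSign c x σ • F (List.ofFn (block x σ 0 p (by omega)))
        (List.ofFn (block x σ p q h.le)) =
      shuffleSum c (fun l₁ l₂ => if l₁.length = p then F l₁ l₂ else 0) (List.ofFn x) := by
  rw [shuffles_eq_shuffles₃ h, sum_shuffles₃ c (r := 0) h x (fun l₁ l₂ _ => F l₁ l₂)]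
  refine shuffleSum_congr fun l₁ l' hl => ?_
  split_ifs with h1
  · have a := hl.length_eq
    simp only [List.length_append, List.length_ofFn] at a
    rw [shuffleSum_congr (G := fun l₂ l₃ => if l₃ = [] then F l₁ l₂ else 0),
      shuffleSum_of_right_nil]
    · simp
    · intro _ _ h3
      simp [h3]
    · intro l₂ l₃ h3
      have b := h3.length_eq
      simp only [List.length_append] at b
      have : l₂.length = q ↔ l₃ = [] := by
        rw [← List.length_eq_zero_iff]; omega
      simp [this]
  · rfl

end ShufflePermutations

/-! ### Forms on lists of graded letters -/

section GradedForms

variable {S : Type*} (deg : S → ℤ)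

/-- The Koszul sign of two letters. -/
def koszulFactor (s t : S) : ℤˣ := (deg s * deg t).negOnePow

/-- The degree of a list of letters. -/
def degSum (l : List S) : ℤ := (l.map deg).sum

@[simp] theorem degSum_nil : degSum deg [] = 0 := rfl

@[simp] theorem degSum_cons (s : S) (l : List S) : degSum deg (s :: l) = deg s + degSum deg l := by
  simp [degSum]

@[simp] theorem degSum_append (l m : List S) :
    degSum deg (l ++ m) = degSum deg l + degSum deg m := by
  simp [degSum]

variable {deg}

theorem degSum_perm {l m : List S} (h : l.Perm m) : degSum deg l = degSum deg m :=
  (h.map deg).sum_eq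

theorem koszulFactor_comm (s t : S) : koszulFactor deg s t = koszulFactor deg t s := by
  rw [koszulFactor, koszulFactor, mul_comm]

theorem koszulFactor_prod (s : S) (l : List S) :
    (l.map (koszulFactor deg s)).prod = (deg s * degSum deg l).negOnePow := by
  induction l with
  | nil => simp
  | cons t l ih => simp [ih, koszulFactor, mul_add, Int.negOnePow_add]

theorem koszulFactor_prod_prod (l m : List S) :
    (l.map fun s => (m.map (koszulFactor deg s)).prod).prod =
      (degSum deg l * degSum deg m).negOnePow := by
  induction l with
  | nil => simp
  | cons t l ih =>
    rw [List.map_cons, List.prod_cons, ih, koszulFactor_prod, degSum_cons, add_mul,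
      Int.negOnePow_add]

variable (deg) in
/-- The form `f` is supported on lists of degree `g`. -/
def HasDegree {C : Type*} [Zero C] (f : List S → C) (g : ℤ) : Prop :=
  ∀ l, degSum deg l ≠ g → f l = 0

/-! ### Products and insertions of forms, and their commutation rules -/

section Operations

variable {𝕜 A C₁ C₂ C₃ C₄ C₅ : Type*} [Field 𝕜] [AddCommGroup A] [Module 𝕜 A]
  [AddCommGroup C₁] [Module 𝕜 C₁] [AddCommGroup C₂] [Module 𝕜 C₂] [AddCommGroup C₃] [Module 𝕜 C₃]
  [AddCommGroup C₄] [Module 𝕜 C₄] [AddCommGroup C₅] [Module 𝕜 C₅]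

variable (deg) in
/-- The product of two forms along a bilinear map. -/
def wedge (μ : C₁ →ₗ[𝕜] C₂ →ₗ[𝕜] C₃) (α : List S → C₁) (β : List S → C₂) (l : List S) : C₃ :=
  shuffleSum (koszulFactor deg) (fun l₁ l₂ => μ (α l₁) (β l₂)) l

variable (deg) in
/-- The insertion of the `A`-valued form `u` into the first argument of `X`, where `j` embeds `A`
into the letters. -/
def insertForm (j : A → S) (u : List S → A) (X : List S → C₁) (l : List S) : C₁ :=
  shuffleSum (koszulFactor deg) (fun l₁ l₂ => X (j (u l₁) :: l₂)) l

theorem HasDegree.wedge {μ : C₁ →ₗ[𝕜] C₂ →ₗ[𝕜] C₃} {α : List S → C₁} {β : List S → C₂} {g h k : ℤ}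
    (hα : HasDegree deg α g) (hβ : HasDegree deg β h) (hk : g + h = k) :
    HasDegree deg (wedge deg μ α β) k := by
  intro l hl
  refine shuffleSum_eq_zero fun l₁ l₂ hp => ?_
  have := degSum_perm (deg := deg) hp
  rw [degSum_append] at this
  by_cases h1 : degSum deg l₁ = g
  · rw [hβ l₂ (by omega), map_zero]
  · rw [hα l₁ h1, map_zero, LinearMap.zero_apply]

theorem HasDegree.insertForm {j : A → S} (hj : ∀ a, deg (j a) = -1) {u : List S → A}
    {X : List S → C₁} (hX : ∀ l, X (j 0 :: l) = 0) {g h k : ℤ}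
    (hu : HasDegree deg u g) (hX' : HasDegree deg X h) (hk : g + h + 1 = k) :
    HasDegree deg (insertForm deg j u X) k := by
  intro l hl
  refine shuffleSum_eq_zero fun l₁ l₂ hp => ?_
  have := degSum_perm (deg := deg) hp
  rw [degSum_append] at this
  by_cases h1 : degSum deg l₁ = g
  · rw [hX' _ (by rw [degSum_cons, hj]; omega)]
  · rw [hu l₁ h1, hX]

theorem wedge_comm (μ : C₁ →ₗ[𝕜] C₂ →ₗ[𝕜] C₃) {α : List S → C₁} {β : List S → C₂} {g h : ℤ}
    (hα : HasDegree deg α g) (hβ : HasDegree deg β h) (l : List S) :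
    wedge deg μ α β l = (g * h).negOnePow • wedge deg μ.flip β α l := by
  rw [wedge, shuffleSum_comm koszulFactor_comm, wedge, ← shuffleSum_units_smul]
  refine shuffleSum_congr fun l₁ l₂ _ => ?_
  rw [koszulFactor_prod_prod, LinearMap.flip_apply]
  by_cases h1 : degSum deg l₁ = h
  · by_cases h2 : degSum deg l₂ = g
    · rw [h1, h2, mul_comm]
    · rw [hα _ h2]; simp
  · rw [hβ _ h1]; simp

theorem wedge_assoc {ν : C₁ →ₗ[𝕜] C₂ →ₗ[𝕜] C₄} {μ : C₄ →ₗ[𝕜] C₃ →ₗ[𝕜] C₅}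
    (α : List S → C₁) (β : List S → C₂) (γ : List S → C₃) (l : List S) :
    wedge deg μ (wedge deg ν α β) γ l = shuffleSum (koszulFactor deg) (fun l₁ l' =>
      shuffleSum (koszulFactor deg) (fun l₂ l₃ => μ (ν (α l₁) (β l₂)) (γ l₃)) l') l := by
  rw [shuffleSum_assoc]
  refine shuffleSum_congr fun l' l₃ _ => ?_
  rw [wedge, ← LinearMap.flip_apply, map_shuffleSum]
  rfl

theorem wedge_assoc_right {ν : C₂ →ₗ[𝕜] C₃ →ₗ[𝕜] C₄} {μ : C₁ →ₗ[𝕜] C₄ →ₗ[𝕜] C₅}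
    (α : List S → C₁) (β : List S → C₂) (γ : List S → C₃) (l : List S) :
    wedge deg μ α (wedge deg ν β γ) l = shuffleSum (koszulFactor deg) (fun l₁ l' =>
      shuffleSum (koszulFactor deg) (fun l₂ l₃ => μ (α l₁) (ν (β l₂) (γ l₃))) l') l := by
  refine shuffleSum_congr fun l' l₃ _ => ?_
  rw [wedge, map_shuffleSum]

theorem wedge_add_left (μ : C₁ →ₗ[𝕜] C₂ →ₗ[𝕜] C₃) (α α' : List S → C₁) (β : List S → C₂) :
    wedge deg μ (α + α') β = wedge deg μ α β + wedge deg μ α' β := by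
  funext l
  simp only [wedge, Pi.add_apply, map_add, LinearMap.add_apply, shuffleSum_add]

theorem wedge_smul_left (μ : C₁ →ₗ[𝕜] C₂ →ₗ[𝕜] C₃) (r : 𝕜) (α : List S → C₁) (β : List S → C₂) :
    wedge deg μ (r • α) β = r • wedge deg μ α β := by
  funext l
  simp only [wedge, Pi.smul_apply, map_smul, LinearMap.smul_apply, shuffleSum_smul]

theorem insertForm_sub_right (j : A → S) (u : List S → A) (X Y : List S → C₁) :
    insertForm deg j u (X - Y) = insertForm deg j u X - insertForm deg j u Y := by
  funext l
  simp only [insertForm, Pi.sub_apply, shuffleSum_sub]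

theorem insertForm_comp (j : A → S) (u : List S → A) (X : List S → C₁) (f : C₁ →ₗ[𝕜] C₂) :
    insertForm deg j u (fun l => f (X l)) = fun l => f (insertForm deg j u X l) := by
  funext l
  simp only [insertForm, map_shuffleSum]

/-- Inserting a form of even degree is a derivation of products. -/
theorem insertForm_wedge {j : A → S} (hj : ∀ a, deg (j a) = -1) {u : List S → A}
    (hu : HasDegree deg u (-2)) (μ : C₁ →ₗ[𝕜] C₂ →ₗ[𝕜] C₃) {α : List S → C₁} {β : List S → C₂}
    (hβ : ∀ l, β (j 0 :: l) = 0)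
    {g : ℤ} (hα : HasDegree deg α g) :
    insertForm deg j u (wedge deg μ α β) = wedge deg μ (insertForm deg j u α) β +
      g.negOnePow • wedge deg μ α (insertForm deg j u β) := by
  funext l
  -- The inserted letter goes to one of the two factors; on its way to the second it passes the
  -- arguments of `α`, which gives the sign `(-1)^g`.
  have e : insertForm deg j u (wedge deg μ α β) l =
      shuffleSum (koszulFactor deg) (fun l₁ l₂ => shuffleSum (koszulFactor deg)
        (fun m₁ m₂ => μ (α (j (u l₁) :: m₁)) (β m₂)) l₂) l +
      g.negOnePow • shuffleSum (koszulFactor deg) (fun l₁ l₂ => shuffleSum (koszulFactor deg)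
        (fun m₁ m₂ => μ (α m₁) (β (j (u l₁) :: m₂))) l₂) l := by
    rw [insertForm, ← shuffleSum_units_smul, ← shuffleSum_add]
    refine shuffleSum_congr fun l₁ l₂ _ => ?_
    rw [wedge, shuffleSum_cons, ← shuffleSum_units_smul]
    congr 1
    refine shuffleSum_congr fun m₁ m₂ _ => ?_
    rw [koszulFactor_prod, hj]
    by_cases h : degSum deg m₁ = g
    · rw [h, neg_one_mul, Int.negOnePow_neg]
    · rw [hα _ h]; simp
  rw [e, Pi.add_apply, Pi.smul_apply]
  congr 1
  · rw [shuffleSum_assoc]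
    refine shuffleSum_congr fun l' l₃ _ => ?_
    rw [insertForm, ← LinearMap.flip_apply, map_shuffleSum]
    rfl
  · congr 1
    rw [shuffleSum_assoc, wedge]
    have : (fun l₁ l₂ => μ (α l₁) (insertForm deg j u β l₂)) = fun l₁ l₂ =>
        shuffleSum (koszulFactor deg) (fun m₁ m₂ => μ (α l₁) (β (j (u m₁) :: m₂))) l₂ := by
      funext l₁ l₂
      rw [insertForm, map_shuffleSum]
    rw [this, shuffleSum_assoc]
    refine shuffleSum_congr fun l' l₃ _ => ?_
    rw [shuffleSum_comm koszulFactor_comm]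
    refine shuffleSum_congr fun l₁ l₂ _ => ?_
    rw [koszulFactor_prod_prod]
    by_cases h : degSum deg l₂ = -2
    · rw [h, mul_neg, Int.negOnePow_neg, mul_two, Int.negOnePow_add, Int.units_mul_self, one_smul]
    · rw [hu _ h, hβ]; simp

theorem eq_zero_of_eq_neg (𝕜 : Type*) {C : Type*} [Field 𝕜] [CharZero 𝕜] [AddCommGroup C]
    [Module 𝕜 C] {x : C} (h : x = -x) : x = 0 := by
  have : (2 : 𝕜) • x = 0 := by
    rw [two_smul]
    nth_rewrite 1 [h]
    exact neg_add_cancel x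
  exact (smul_eq_zero.1 this).resolve_left two_ne_zero

/-- The second insertion hits either an argument of the first inserted `u` or another argument of
`X`. Terms of the latter kind cancel in pairs, because the two copies of `u` are even and commute
while the two arguments of `X` anticommute. -/
theorem insertForm_insertForm [CharZero 𝕜] {j : A → S} (hj : ∀ a, deg (j a) = -1) {u : List S → A}
    (hu : HasDegree deg u (-2)) {X : List S → C₁}
    (hX : ∀ l, IsLinearMap 𝕜 fun a => X (j a :: l))
    (hX' : ∀ a b l, X (j a :: j b :: l) = - X (j b :: j a :: l)) :
    insertForm deg j u (insertForm deg j u X) = insertForm deg j (insertForm deg j u u) X := by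
  funext l
  have e : insertForm deg j u (insertForm deg j u X) l =
      shuffleSum (koszulFactor deg) (fun l₁ l₂ => shuffleSum (koszulFactor deg)
        (fun m₁ m₂ => X (j (u (j (u l₁) :: m₁)) :: m₂)) l₂) l +
      shuffleSum (koszulFactor deg) (fun l₁ l₂ => shuffleSum (koszulFactor deg)
        (fun m₁ m₂ => X (j (u m₁) :: j (u l₁) :: m₂)) l₂) l := by
    rw [insertForm, ← shuffleSum_add]
    refine shuffleSum_congr fun l₁ l₂ _ => ?_
    rw [insertForm, shuffleSum_cons]
    congr 1
    refine shuffleSum_congr fun m₁ m₂ _ => ?_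
    rw [koszulFactor_prod, hj]
    by_cases h : degSum deg m₁ = -2
    · rw [h]; simp [Int.negOnePow_even]
    · rw [hu _ h, (hX _).map_zero, smul_zero]
  rw [e]
  have z : shuffleSum (koszulFactor deg) (fun l₁ l₂ => shuffleSum (koszulFactor deg)
        (fun m₁ m₂ => X (j (u m₁) :: j (u l₁) :: m₂)) l₂) l = 0 := by
    rw [shuffleSum_assoc]
    refine shuffleSum_eq_zero fun l' m₂ _ => ?_
    refine eq_zero_of_eq_neg 𝕜 ?_
    · have := shuffleSum_comm (M := C₁) (koszulFactor_comm (deg := deg))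
        (fun l₁ m₁ => X (j (u m₁) :: j (u l₁) :: m₂)) l'
      conv_lhs => rw [this]
      rw [← shuffleSum_neg]
      refine shuffleSum_congr fun l₁ l₂ _ => ?_
      rw [koszulFactor_prod_prod]
      by_cases h : degSum deg l₂ = -2
      · rw [h, mul_neg, Int.negOnePow_neg, mul_two, Int.negOnePow_add, Int.units_mul_self, one_smul,
          hX']
      · rw [hu _ h, hX', (hX _).map_zero]; simp
  rw [z, add_zero, shuffleSum_assoc]
  refine shuffleSum_congr fun l' l₃ _ => ?_
  exact (map_shuffleSum ((hX l₃).mk' _) _ _).symm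

end Operations

/-! ### The universal curvature form -/

section Curvature

variable {𝕜 A B : Type*} [Field 𝕜] [CharZero 𝕜] [AddCommGroup A] [Module 𝕜 A]
  [AddCommGroup B] [Module 𝕜 B] {br : (A × B) →ₗ[𝕜] (A × B) →ₗ[𝕜] (A × B)}

theorem bracket_skew (hself : ∀ x, br x x = 0) (x y : A × B) : br x y = - br y x := by
  have := hself (x + y)
  simp only [map_add, LinearMap.add_apply, hself, zero_add, add_zero] at this
  exact eq_neg_of_add_eq_zero_right this

theorem flip_eq_neg (hself : ∀ x, br x x = 0) : br.flip = - br := by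
  refine LinearMap.ext fun x => LinearMap.ext fun y => ?_
  rw [LinearMap.flip_apply, bracket_skew hself]
  rfl

/-- For the odd form `ℓ` the Jacobi identity reads `[[ℓ, ℓ], ℓ] = 2[ℓ, [ℓ, ℓ]]`, whereas
skew-symmetry gives `[ℓ, [ℓ, ℓ]] = -[[ℓ, ℓ], ℓ]`. Hence three times the form is zero. -/
theorem wedge_wedge_self (hself : ∀ x, br x x = 0)
    (hjac : ∀ x y z, br x (br y z) = br (br x y) z + br y (br x z))
    {ℓ : List S → A × B} (hℓ : HasDegree deg ℓ (-1)) (l : List S) :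
    wedge deg br (wedge deg br ℓ ℓ) ℓ l = 0 := by
  set T := wedge deg br (wedge deg br ℓ ℓ) ℓ l with hT
  have e1 : wedge deg br ℓ (wedge deg br ℓ ℓ) l = - T := by
    rw [wedge_comm br hℓ (hℓ.wedge hℓ (k := -2) rfl), flip_eq_neg hself, hT]
    rw [Int.negOnePow_even _ (by decide), one_smul]
    simp [wedge, shuffleSum_neg]
  have e2 : T = wedge deg br ℓ (wedge deg br ℓ ℓ) l + wedge deg br ℓ (wedge deg br ℓ ℓ) l := by
    rw [hT, wedge_assoc]
    have : ∀ x y z : A × B, br (br x y) z = br x (br y z) - br y (br x z) := by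
      intro x y z; rw [hjac x y z]; abel
    simp only [this, shuffleSum_sub]
    rw [wedge_assoc_right, sub_eq_add_neg]
    congr 1
    rw [shuffleSum_assoc, shuffleSum_assoc, ← shuffleSum_neg]
    refine shuffleSum_congr fun l' l₃ _ => ?_
    rw [shuffleSum_comm koszulFactor_comm, ← shuffleSum_neg]
    refine shuffleSum_congr fun l₁ l₂ _ => ?_
    rw [koszulFactor_prod_prod]
    by_cases h1 : degSum deg l₁ = -1
    · by_cases h2 : degSum deg l₂ = -1
      · rw [h1, h2]; simp
      · rw [hℓ l₂ h2]; simp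
    · rw [hℓ l₁ h1]; simp
  rw [e1] at e2
  have : (3 : 𝕜) • T = 0 := by
    have h3 : (3 : 𝕜) • T = T + T + T := by
      rw [show (3 : 𝕜) = 1 + 1 + 1 by norm_num, add_smul, add_smul, one_smul]
    rw [h3]
    nth_rewrite 1 [e2]
    abel
  exact (smul_eq_zero.1 this).resolve_left (by norm_num)

variable (deg) in
/-- `½[ℓ, ℓ]`. -/
def halfSquare (br : (A × B) →ₗ[𝕜] (A × B) →ₗ[𝕜] (A × B)) (ℓ : List S → A × B) (l : List S) :
    A × B :=
  (2⁻¹ : 𝕜) • wedge deg br ℓ ℓ l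

variable (deg) in
/-- The curvature `pr_B ½[ℓ, ℓ] - ι_{pr_A ½[ℓ, ℓ]} X`, where `X = pr_B ℓ`. -/
def curvature (br : (A × B) →ₗ[𝕜] (A × B) →ₗ[𝕜] (A × B)) (j : A → S) (ℓ : List S → A × B)
    (l : List S) : B :=
  (halfSquare deg br ℓ l).2 -
    insertForm deg j (fun l => (halfSquare deg br ℓ l).1) (fun l => (ℓ l).2) l

variable (deg) in
/-- The derivative of the curvature in the direction of `w`, a form of even degree. -/
def curvatureDeriv (br : (A × B) →ₗ[𝕜] (A × B) →ₗ[𝕜] (A × B)) (j : A → S) (ℓ : List S → A × B)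
    (w : List S → B) (l : List S) : B :=
  (wedge deg br (fun l => (0, w l)) ℓ l).2 -
    insertForm deg j (fun l => (wedge deg br (fun l => (0, w l)) ℓ l).1) (fun l => (ℓ l).2) l +
    insertForm deg j (fun l => (halfSquare deg br ℓ l).1) w l

/-- The curvature is a homological vector field. -/
theorem curvatureDeriv_curvature (hself : ∀ x, br x x = 0)
    (hjac : ∀ x y z, br x (br y z) = br (br x y) z + br y (br x z))
    {j : A → S} (hj : ∀ a, deg (j a) = -1) {ℓ : List S → A × B} (hℓ : HasDegree deg ℓ (-1))
    (hlin : ∀ l, IsLinearMap 𝕜 fun a => ℓ (j a :: l))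
    (hswap : ∀ a b l, ℓ (j a :: j b :: l) = - ℓ (j b :: j a :: l))
    (hξ : ∀ a, (ℓ [j a]).1 = a) (hξ' : ∀ a l, l ≠ [] → (ℓ (j a :: l)).1 = 0) (l : List S) :
    curvatureDeriv deg br j ℓ (curvature deg br j ℓ) l = 0 := by
  set X : List S → B := fun l => (ℓ l).2 with hX
  set u : List S → A := fun l => (halfSquare deg br ℓ l).1 with hu
  set v : List S → B := fun l => (halfSquare deg br ℓ l).2 with hv
  have hXlin : ∀ l, IsLinearMap 𝕜 fun a => X (j a :: l) := fun l =>
    ((LinearMap.snd 𝕜 A B).comp ((hlin l).mk' _)).isLinear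
  have hq : HasDegree deg (halfSquare deg br ℓ) (-2) := by
    intro l hl
    rw [halfSquare, hℓ.wedge hℓ (k := -2) rfl l hl, smul_zero]
  have hud : HasDegree deg u (-2) := by
    intro l hl
    simp only [hu, hq l hl, Prod.fst_zero]
  -- Inserting `u` into the tautological part of `ℓ` returns `u` itself, so `ι_u ℓ = (u, ι_u X)`.
  -- This form is called `e` below.
  have hins : insertForm deg j u ℓ = fun l => (u l, insertForm deg j u X l) := by
    funext l
    refine Prod.ext ?_ ?_
    · change LinearMap.fst 𝕜 A B _ = _
      rw [insertForm, map_shuffleSum, shuffleSum_of_right_nil]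
      · exact hξ _
      · exact fun l₁ l₂ h => hξ' _ _ h
    · change LinearMap.snd 𝕜 A B _ = _
      rw [insertForm, map_shuffleSum]
      rfl
  set e : List S → A × B := fun l => (u l, insertForm deg j u X l) with he
  have hXdeg : HasDegree deg X (-1) := fun l hl => by simp only [hX, hℓ l hl, Prod.snd_zero]
  have hXu : HasDegree deg (insertForm deg j u X) (-2) :=
    HasDegree.insertForm hj (fun l => (hXlin l).map_zero) hud hXdeg (by norm_num)
  have hed : HasDegree deg e (-2) := fun l hl => by
    rw [he]; exact Prod.ext (hud l hl) (hXu l hl)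
  -- `ι_u` is a derivation, and its two terms agree by skew-symmetry, which cancels the factor `½`:
  -- `ι_u ½[ℓ, ℓ] = [e, ℓ]`.
  have hq' : insertForm deg j u (halfSquare deg br ℓ) = wedge deg br e ℓ := by
    have h1 : halfSquare deg br ℓ =
        fun l => ((2⁻¹ : 𝕜) • (LinearMap.id : A × B →ₗ[𝕜] A × B)) (wedge deg br ℓ ℓ l) := rfl
    rw [h1, insertForm_comp, insertForm_wedge hj hud br (fun l => (hlin l).map_zero) hℓ, hins]
    funext l
    have h2 : wedge deg br ℓ e l = - wedge deg br e ℓ l := by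
      rw [wedge_comm br hℓ hed, flip_eq_neg hself, Int.negOnePow_even _ (by decide), one_smul]
      simp [wedge, shuffleSum_neg]
    rw [Pi.add_apply, Pi.smul_apply, h2]
    have h3 : ∀ y : A × B, y + (-1 : ℤ).negOnePow • -y = (2 : 𝕜) • y := by
      intro y
      simp [two_smul]
    rw [h3]
    simp
  have hu' : insertForm deg j u u = fun l => (wedge deg br e ℓ l).1 := by
    rw [← hq']
    exact insertForm_comp j u (halfSquare deg br ℓ) (LinearMap.fst 𝕜 A B)
  have hv' : insertForm deg j u v = fun l => (wedge deg br e ℓ l).2 := by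
    rw [← hq']
    exact insertForm_comp j u (halfSquare deg br ℓ) (LinearMap.snd 𝕜 A B)
  have hcurv : curvature deg br j ℓ = v - insertForm deg j u X := rfl
  -- `½[ℓ, ℓ]` and `e` have the same `A`-component and differ by the curvature. After bracketing
  -- with `ℓ`, the identity `[[ℓ, ℓ], ℓ] = 0` allows the curvature to be replaced by `-e`.
  have hsum : (fun l => ((0 : A), curvature deg br j ℓ l)) + e = halfSquare deg br ℓ := by
    funext l
    rw [hcurv]
    refine Prod.ext (zero_add _) ?_
    exact sub_add_cancel _ _
  have hz : wedge deg br (fun l => ((0 : A), curvature deg br j ℓ l)) ℓ = - wedge deg br e ℓ := by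
    rw [eq_neg_iff_add_eq_zero, ← wedge_add_left, hsum]
    have h1 : halfSquare deg br ℓ = (2⁻¹ : 𝕜) • wedge deg br ℓ ℓ := rfl
    rw [h1, wedge_smul_left]
    funext l
    rw [Pi.smul_apply, wedge_wedge_self hself hjac hℓ, smul_zero]
    rfl
  have hXswap : ∀ a b l, X (j a :: j b :: l) = - X (j b :: j a :: l) := by
    intro a b l
    simp only [hX, hswap a b l, Prod.snd_neg]
  -- The insertion rules turn the last term of the derivative into an expression in `[e, ℓ]`; the
  -- first two terms give the same one with the opposite sign.
  have hlast : insertForm deg j u (curvature deg br j ℓ) l =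
      (wedge deg br e ℓ l).2 - insertForm deg j (fun l => (wedge deg br e ℓ l).1) X l := by
    rw [hcurv, insertForm_sub_right, insertForm_insertForm hj hud hXlin hXswap, hu', hv']
    rfl
  rw [curvatureDeriv, hlast, hz]
  have hneg : insertForm deg j (fun l => ((- wedge deg br e ℓ) l).1) X l =
      - insertForm deg j (fun l => (wedge deg br e ℓ l).1) X l := by
    rw [insertForm, insertForm, ← shuffleSum_neg]
    refine shuffleSum_congr fun l₁ l₂ _ => ?_
    rw [Pi.neg_apply, Prod.fst_neg, (hXlin _).map_neg]
  rw [hneg, Pi.neg_apply, Prod.snd_neg]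
  abel

end Curvature

end GradedForms

/-! ### Multilinear and graded symmetric forms on letters -/

section LinearShuffle

variable {S M : Type*} [AddCommGroup M] {c : S → S → ℤˣ} {𝕜 : Type*} [Field 𝕜] [Module 𝕜 M]
  {N : Type*} [AddCommGroup N] [Module 𝕜 N]

theorem IsLinearMap.units_smul {f : N → M} (hf : IsLinearMap 𝕜 f) (r : ℤˣ) :
    IsLinearMap 𝕜 fun v => r • f v :=
  ⟨fun v w => by rw [hf.map_add, smul_add], fun a v => by rw [hf.map_smul, smul_comm]⟩

theorem IsLinearMap.shuffleSum {F : N → List S → List S → M}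
    (h : ∀ l₁ l₂, IsLinearMap 𝕜 fun v => F v l₁ l₂) (l : List S) :
    IsLinearMap 𝕜 fun v => shuffleSum c (F v) l :=
  ⟨fun v w => by simp only [← shuffleSum_add, ← (h _ _).map_add],
    fun a v => by simp only [← shuffleSum_smul, ← (h _ _).map_smul]⟩

/-- The signs must not vary with `v`: the commutation factors may see the letter `g v` only through
data such as its degree. -/
theorem shuffleSum_isLinearMap {g : N → S} (hg : ∀ v s, c (g v) s = c (g 0) s)
    (hg' : ∀ v s, c s (g v) = c s (g 0)) {F : List S → List S → M}
    (h₁ : ∀ k l m, IsLinearMap 𝕜 fun v => F (k ++ g v :: l) m)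
    (h₂ : ∀ k l m, IsLinearMap 𝕜 fun v => F m (k ++ g v :: l)) (k l : List S) :
    IsLinearMap 𝕜 fun v => shuffleSum c F (k ++ g v :: l) := by
  induction k generalizing F with
  | nil =>
    have e : ∀ v, c (g v) = c (g 0) := fun v => funext (hg v)
    simp only [List.nil_append, shuffleSum_cons, e]
    have a1 := IsLinearMap.shuffleSum (c := c) (fun l₁ l₂ => h₁ [] l₁ l₂) l
    have a2 := IsLinearMap.shuffleSum (c := c)
      (fun l₁ l₂ => (h₂ [] l₂ l₁).units_smul (l₁.map (c (g 0))).prod) l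
    exact (a1.mk' _ + a2.mk' _).isLinear
  | cons r k ih =>
    simp only [List.cons_append, shuffleSum_cons]
    have a1 := ih (F := fun l₁ l₂ => F (r :: l₁) l₂) (fun k l m => h₁ (r :: k) l m)
      (fun k l m => h₂ k l (r :: m))
    have a2 := ih (F := fun l₁ l₂ => (l₁.map (c r)).prod • F l₁ (r :: l₂))
      (fun k l m => by
        simp only [List.map_append, List.map_cons, hg']
        exact (h₁ k l (r :: m)).units_smul _)
      (fun k l m => (h₂ (r :: k) l m).units_smul _)
    exact (a1.mk' _ + a2.mk' _).isLinear

end LinearShuffle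

/-! ### Reordering the arguments of a graded symmetric form -/

section SymmetricForms

variable {S C : Type*} [AddCommGroup C] {c : S → S → ℤˣ} {f : List S → C}

theorem apply_move (hf : ∀ k l s t, f (k ++ s :: t :: l) = c s t • f (k ++ t :: s :: l)) (k l m : List S) (s : S) :
    f (k ++ s :: (l ++ m)) = (l.map (c s)).prod • f (k ++ (l ++ s :: m)) := by
  induction l generalizing k with
  | nil => simp
  | cons t l ih =>
    have := ih (k ++ [t])
    simp only [List.append_assoc, List.cons_append, List.nil_append] at this
    rw [List.cons_append, hf, this, List.map_cons, List.prod_cons, mul_smul, List.cons_append]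

/-- The first letter is moved past the letters that `σ` places before it, and the others are
permuted by induction. -/
theorem apply_perm (hf : ∀ k l s t, f (k ++ s :: t :: l) = c s t • f (k ++ t :: s :: l)) {n : ℕ} (x : Fin n → S) (σ : Equiv.Perm (Fin n)) (k m : List S) :
    f (k ++ (List.ofFn x ++ m)) = invSign c x σ • f (k ++ (List.ofFn (x ∘ σ) ++ m)) := by
  induction n generalizing k with
  | zero => simp [invSign]
  | succ n ih =>
    induction σ using perm_succ_induction with
    | h i σ =>
      have := ih (x ∘ Fin.succ) σ (k ++ [x 0])
      simp only [List.append_assoc, List.cons_append, List.nil_append] at this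
      rw [List.ofFn_succ, List.cons_append]
      refine this.trans ?_
      rw [invSign_permInsert, ofFn_comp_permInsert, mul_comm, mul_smul]
      congr 1
      set L := List.ofFn (x ∘ Fin.succ ∘ σ) with hL
      have hL' : List.ofFn ((x ∘ Fin.succ) ∘ σ) = L.take i ++ L.drop i := by
        rw [List.take_append_drop]; rfl
      rw [hL', List.append_assoc, apply_move hf]
      simp

end SymmetricForms

/-! ### Letters: elements of `A` and alternating forms, in shifted degrees -/

section Letters

variable (𝕜 A B : Type*) [Field 𝕜] [AddCommGroup A] [Module 𝕜 A] [AddCommGroup B] [Module 𝕜 B]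

/-- The alternating forms of all degrees. -/
abbrev FormLetter : Type _ := Σ k : ℕ, A [⋀^Fin k]→ₗ[𝕜] B

/-- The letters: elements of `A` and alternating forms. -/
abbrev Letter : Type _ := A ⊕ FormLetter 𝕜 A B

variable {𝕜 A B}

/-- Elements of `A` have degree `-1` and a `k`-form has degree `k - 1`. -/
def letterDeg : Letter 𝕜 A B → ℤ
  | .inl _ => -1
  | .inr x => x.1 - 1

@[simp] theorem letterDeg_inl (a : A) : letterDeg (.inl a : Letter 𝕜 A B) = -1 := rfl

@[simp] theorem letterDeg_inr (x : FormLetter 𝕜 A B) :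
    letterDeg (.inr x : Letter 𝕜 A B) = x.1 - 1 := rfl

/-- A `k`-form as a form on lists: its value is zero on all lists other than lists of `k` elements
of `A`. -/
def formHat : {k : ℕ} → A [⋀^Fin k]→ₗ[𝕜] B → List (Letter 𝕜 A B) → B
  | 0, x, [] => x ![]
  | _ + 1, x, .inl a :: l => formHat (x.curryLeft a) l
  | _, _, _ => 0

@[simp] theorem formHat_zero_nil (x : A [⋀^Fin 0]→ₗ[𝕜] B) : formHat x [] = x ![] := rfl

@[simp] theorem formHat_zero_cons (x : A [⋀^Fin 0]→ₗ[𝕜] B) (s : Letter 𝕜 A B)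
    (l : List (Letter 𝕜 A B)) : formHat x (s :: l) = 0 := by
  cases s <;> rfl

@[simp] theorem formHat_succ_nil {k : ℕ} (x : A [⋀^Fin (k + 1)]→ₗ[𝕜] B) : formHat x [] = 0 := rfl

@[simp] theorem formHat_succ_inl {k : ℕ} (x : A [⋀^Fin (k + 1)]→ₗ[𝕜] B) (a : A)
    (l : List (Letter 𝕜 A B)) : formHat x (.inl a :: l) = formHat (x.curryLeft a) l := rfl

@[simp] theorem formHat_inr {k : ℕ} (x : A [⋀^Fin k]→ₗ[𝕜] B) (y : FormLetter 𝕜 A B)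
    (l : List (Letter 𝕜 A B)) : formHat x (.inr y :: l) = 0 := by
  cases k <;> rfl

theorem formHat_ofFn {k : ℕ} (x : A [⋀^Fin k]→ₗ[𝕜] B) (a : Fin k → A) :
    formHat x (List.ofFn fun i => .inl (a i)) = x a := by
  induction k with
  | zero => simp [Subsingleton.elim a ![]]
  | succ k ih =>
    rw [List.ofFn_succ, formHat_succ_inl, ih, AlternatingMap.curryLeft_apply_apply]
    congr 1
    funext i
    refine Fin.cases rfl (fun i => ?_) i
    simp [Matrix.vecCons]

theorem formHat_isLinearMap {k : ℕ} (l : List (Letter 𝕜 A B)) :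
    IsLinearMap 𝕜 fun x : A [⋀^Fin k]→ₗ[𝕜] B => formHat x l := by
  induction l generalizing k with
  | nil => cases k <;> exact ⟨fun _ _ => by simp, fun _ _ => by simp⟩
  | cons s l ih =>
    cases k with
    | zero => exact ⟨fun _ _ => by simp, fun _ _ => by simp⟩
    | succ k =>
      cases s with
      | inr y => exact ⟨fun _ _ => by simp, fun _ _ => by simp⟩
      | inl a =>
        simp only [formHat_succ_inl]
        exact ⟨fun x y => by rw [← ih.map_add]; rfl, fun r x => by rw [← ih.map_smul]; rfl⟩

theorem formHat_of_degSum {k : ℕ} (x : A [⋀^Fin k]→ₗ[𝕜] B) :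
    HasDegree letterDeg (formHat x) (-k) := by
  intro l hl
  induction l generalizing k with
  | nil =>
    cases k with
    | zero => simp at hl
    | succ k => rfl
  | cons s l ih =>
    cases k with
    | zero => simp
    | succ k =>
      cases s with
      | inr y => simp
      | inl a =>
        rw [formHat_succ_inl]
        refine ih _ ?_
        rw [degSum_cons, letterDeg_inl] at hl
        push_cast at hl
        omega

theorem formHat_append_inr {k : ℕ} (x : A [⋀^Fin k]→ₗ[𝕜] B) (y : FormLetter 𝕜 A B)
    (l m : List (Letter 𝕜 A B)) : formHat x (l ++ .inr y :: m) = 0 := by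
  induction l generalizing k with
  | nil => simp
  | cons s l ih =>
    cases k with
    | zero => simp
    | succ k => cases s <;> simp [ih]

theorem formHat_append_inl_isLinearMap {k : ℕ} (x : A [⋀^Fin k]→ₗ[𝕜] B)
    (l m : List (Letter 𝕜 A B)) :
    IsLinearMap 𝕜 fun a => formHat x (l ++ .inl a :: m) := by
  induction l generalizing k with
  | nil =>
    cases k with
    | zero => exact ⟨fun _ _ => by simp, fun _ _ => by simp⟩
    | succ k =>
      simp only [List.nil_append, formHat_succ_inl]
      exact ⟨fun a b => by rw [map_add, (formHat_isLinearMap m).map_add],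
        fun r a => by rw [map_smul, (formHat_isLinearMap m).map_smul]⟩
  | cons s l ih =>
    cases k with
    | zero => exact ⟨fun _ _ => by simp, fun _ _ => by simp⟩
    | succ k =>
      cases s with
      | inr y => exact ⟨fun _ _ => by simp, fun _ _ => by simp⟩
      | inl a => exact ih _

/-- Both sides vanish unless both letters are elements of `A`; these are odd, and the claim is then
the alternation of `x`. -/
theorem formHat_swap {k : ℕ} (x : A [⋀^Fin k]→ₗ[𝕜] B) (l m : List (Letter 𝕜 A B))
    (s t : Letter 𝕜 A B) :
    formHat x (l ++ s :: t :: m) = koszulFactor letterDeg s t • formHat x (l ++ t :: s :: m) := by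
  cases s with
  | inr y =>
    rw [formHat_append_inr]
    have := formHat_append_inr x y (l ++ [t]) m
    rw [List.append_assoc] at this
    change formHat x (l ++ t :: .inr y :: m) = 0 at this
    rw [this, smul_zero]
  | inl a =>
    cases t with
    | inr y =>
      rw [formHat_append_inr]
      have := formHat_append_inr x y (l ++ [.inl a]) m
      rw [List.append_assoc] at this
      change formHat x (l ++ .inl a :: .inr y :: m) = 0 at this
      rw [this, smul_zero]
    | inl b =>
      have e : koszulFactor letterDeg (.inl a : Letter 𝕜 A B) (.inl b) = -1 := by
        simp [koszulFactor]
      rw [e, Units.neg_smul, one_smul]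
      induction l generalizing k with
      | nil =>
        rcases k with _ | _ | k
        · simp
        · simp
        · simp only [List.nil_append, formHat_succ_inl]
          have h : (x.curryLeft a).curryLeft b = - (x.curryLeft b).curryLeft a := by
            rw [eq_neg_iff_add_eq_zero]
            have := AlternatingMap.curryLeft_same x (a + b)
            simp only [map_add, AlternatingMap.curryLeft_add, LinearMap.add_apply] at this
            simpa [AlternatingMap.curryLeft_same, add_comm] using this
          rw [h, (formHat_isLinearMap m).map_neg]
      | cons s l ih =>
        cases k with
        | zero => simp
        | succ k => cases s <;> simp [ih]

/-- A form on lists of letters which is linear in each letter and graded symmetric. -/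
structure IsSymmForm {C : Type*} [AddCommGroup C] [Module 𝕜 C] (f : List (Letter 𝕜 A B) → C) :
    Prop where
  linear_inl : ∀ l m, IsLinearMap 𝕜 fun a => f (l ++ .inl a :: m)
  linear_inr : ∀ (k : ℕ) l m,
    IsLinearMap 𝕜 fun x : A [⋀^Fin k]→ₗ[𝕜] B => f (l ++ .inr ⟨k, x⟩ :: m)
  swap : ∀ l m s t, f (l ++ s :: t :: m) = koszulFactor letterDeg s t • f (l ++ t :: s :: m)

namespace IsSymmForm

variable {C D E : Type*} [AddCommGroup C] [Module 𝕜 C] [AddCommGroup D] [Module 𝕜 D]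
  [AddCommGroup E] [Module 𝕜 E] {f g : List (Letter 𝕜 A B) → C}

theorem shuffleSum {F : List (Letter 𝕜 A B) → List (Letter 𝕜 A B) → C}
    (h₁ : ∀ m, IsSymmForm fun l => F l m) (h₂ : ∀ m, IsSymmForm fun l => F m l) :
    IsSymmForm (shuffleSum (koszulFactor letterDeg) F) where
  linear_inl l m := shuffleSum_isLinearMap (fun _ _ => rfl)
    (fun _ _ => by simp [koszulFactor])
    (fun k l m => (h₁ m).linear_inl k l) (fun k l m => (h₂ m).linear_inl k l) l m
  linear_inr n l m := shuffleSum_isLinearMap (fun _ _ => rfl)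
    (fun _ _ => by simp [koszulFactor])
    (fun k l m => (h₁ m).linear_inr n k l) (fun k l m => (h₂ m).linear_inr n k l) l m
  swap l m s t := shuffleSum_swap koszulFactor_comm
    (fun k l s t m => (h₁ m).swap k l s t) (fun k l s t m => (h₂ m).swap k l s t) l m s t

theorem map (hf : IsSymmForm f) (φ : C →ₗ[𝕜] D) : IsSymmForm fun l => φ (f l) where
  linear_inl l m := (φ.comp ((hf.linear_inl l m).mk' _)).isLinear
  linear_inr k l m := (φ.comp ((hf.linear_inr k l m).mk' _)).isLinear
  swap l m s t := by rw [hf.swap, Units.smul_def, map_zsmul, Units.smul_def]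

theorem sub (hf : IsSymmForm f) (hg : IsSymmForm g) : IsSymmForm fun l => f l - g l where
  linear_inl l m := ((hf.linear_inl l m).mk' _ - (hg.linear_inl l m).mk' _).isLinear
  linear_inr k l m := ((hf.linear_inr k l m).mk' _ - (hg.linear_inr k l m).mk' _).isLinear
  swap l m s t := by rw [hf.swap, hg.swap, smul_sub]

theorem prodMk {g : List (Letter 𝕜 A B) → D} (hf : IsSymmForm f) (hg : IsSymmForm g) :
    IsSymmForm fun l => (f l, g l) where
  linear_inl l m := ((hf.linear_inl l m).mk' _ |>.prod <| (hg.linear_inl l m).mk' _).isLinear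
  linear_inr k l m := ((hf.linear_inr k l m).mk' _ |>.prod <| (hg.linear_inr k l m).mk' _).isLinear
  swap l m s t := by rw [hf.swap, hg.swap]; rfl

theorem cons (hf : IsSymmForm f) (s : Letter 𝕜 A B) : IsSymmForm fun l => f (s :: l) where
  linear_inl l m := hf.linear_inl (s :: l) m
  linear_inr k l m := hf.linear_inr k (s :: l) m
  swap l m := hf.swap (s :: l) m

theorem wedge {g : List (Letter 𝕜 A B) → D} (hf : IsSymmForm f) (hg : IsSymmForm g)
    (μ : C →ₗ[𝕜] D →ₗ[𝕜] E) : IsSymmForm (wedge letterDeg μ f g) :=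
  shuffleSum (fun m => hf.map (μ.flip (g m))) fun m => hg.map (μ (f m))

theorem insertForm {u : List (Letter 𝕜 A B) → A} (hu : IsSymmForm u) (hf : IsSymmForm f) :
    IsSymmForm (insertForm letterDeg .inl u f) :=
  shuffleSum (fun m => hu.map ((hf.linear_inl [] m).mk' _)) fun _ => hf.cons _

theorem perm (hf : IsSymmForm f) {n : ℕ} (x : Fin n → Letter 𝕜 A B) (σ : Equiv.Perm (Fin n))
    (m : List (Letter 𝕜 A B)) :
    f (List.ofFn x ++ m) = invSign (koszulFactor letterDeg) x σ • f (List.ofFn (x ∘ σ) ++ m) :=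
  apply_perm (k := []) (fun l m s t => hf.swap l m s t) x σ m

end IsSymmForm

end Letters

/-! ### The universal form and its curvature -/

section UniversalForm

variable {𝕜 A B : Type*} [Field 𝕜] [AddCommGroup A] [Module 𝕜 A] [AddCommGroup B] [Module 𝕜 B]

/-- The tautological `A`-valued form. -/
def tautForm : List (Letter 𝕜 A B) → A
  | [.inl a] => a
  | _ => 0

@[simp] theorem tautForm_singleton (a : A) : tautForm ([.inl a] : List (Letter 𝕜 A B)) = a := rfl

@[simp] theorem tautForm_nil : tautForm ([] : List (Letter 𝕜 A B)) = 0 := rfl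

@[simp] theorem tautForm_cons_cons (s t : Letter 𝕜 A B) (l : List (Letter 𝕜 A B)) :
    tautForm (s :: t :: l) = 0 := by
  cases s <;> rfl

theorem tautForm_of_two_le {l : List (Letter 𝕜 A B)} (h : 2 ≤ l.length) : tautForm l = 0 := by
  match l, h with
  | _ :: _ :: _, _ => simp

theorem tautForm_isSymmForm : IsSymmForm (tautForm : List (Letter 𝕜 A B) → A) where
  linear_inl l m := by
    by_cases h : l = [] ∧ m = []
    · obtain ⟨rfl, rfl⟩ := h
      exact ⟨fun _ _ => rfl, fun _ _ => rfl⟩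
    · have : ∀ a, tautForm (l ++ (.inl a : Letter 𝕜 A B) :: m) = 0 := fun a =>
        tautForm_of_two_le (by
          rw [← List.length_eq_zero_iff, ← List.length_eq_zero_iff] at h
          simp; omega)
      simp only [this]
      exact ⟨by simp, by simp⟩
  linear_inr k l m := by
    have : ∀ x, tautForm (l ++ (.inr ⟨k, x⟩ : Letter 𝕜 A B) :: m) = 0 := fun x => by
      cases l with
      | nil => rfl
      | cons s l => exact tautForm_of_two_le (by simp; omega)
    simp only [this]
    exact ⟨by simp, by simp⟩
  swap l m s t := by
    rw [tautForm_of_two_le (by simp; omega), tautForm_of_two_le (by simp; omega), smul_zero]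

/-- The first factor of `univForm` is concentrated on lists of one form. -/
def univCore : List (Letter 𝕜 A B) → List (Letter 𝕜 A B) → B
  | [.inr y], m => formHat y.2 m
  | _, _ => 0

theorem univCore_of_two_le {l : List (Letter 𝕜 A B)} (h : 2 ≤ l.length)
    (m : List (Letter 𝕜 A B)) : univCore l m = 0 := by
  match l, h with
  | s :: _ :: _, _ => cases s <;> rfl

/-- The universal `B`-valued form, with value `x(a₁, …, aₖ)` on `x, a₁, …, aₖ`. -/
def univForm (l : List (Letter 𝕜 A B)) : B :=
  shuffleSum (koszulFactor letterDeg) univCore l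

theorem univForm_isSymmForm : IsSymmForm (univForm : List (Letter 𝕜 A B) → B) := by
  refine IsSymmForm.shuffleSum (fun m => ⟨fun k l => ?_, fun d k l => ?_, fun k l s t => ?_⟩)
    fun k => ?_
  · have : ∀ a, univCore (k ++ (.inl a : Letter 𝕜 A B) :: l) m = 0 := fun a => by
      cases k with
      | nil => cases l <;> rfl
      | cons s k => exact univCore_of_two_le (by simp; omega) m
    simp only [this]
    exact ⟨by simp, by simp⟩
  · by_cases h : k = [] ∧ l = []
    · obtain ⟨rfl, rfl⟩ := h
      exact formHat_isLinearMap m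
    · have : ∀ x, univCore (k ++ (.inr ⟨d, x⟩ : Letter 𝕜 A B) :: l) m = 0 := fun a =>
        univCore_of_two_le (by
          rw [← List.length_eq_zero_iff, ← List.length_eq_zero_iff] at h
          simp; omega) m
      simp only [this]
      exact ⟨by simp, by simp⟩
  · rw [univCore_of_two_le (by simp; omega), univCore_of_two_le (by simp; omega), smul_zero]
  · match k with
    | [.inr y] =>
      exact ⟨formHat_append_inl_isLinearMap y.2, fun k l m => by
        change IsLinearMap 𝕜 fun x => formHat y.2 (l ++ .inr ⟨k, x⟩ :: m)
        simp only [formHat_append_inr]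
        exact ⟨by simp, by simp⟩, formHat_swap y.2⟩
    | [] => exact ⟨fun _ _ => ⟨by simp [univCore], by simp [univCore]⟩,
        fun _ _ _ => ⟨by simp [univCore], by simp [univCore]⟩, by simp [univCore]⟩
    | [.inl a] => exact ⟨fun _ _ => ⟨by simp [univCore], by simp [univCore]⟩,
        fun _ _ _ => ⟨by simp [univCore], by simp [univCore]⟩, by simp [univCore]⟩
    | s :: t :: k =>
      have h : ∀ m, univCore (s :: t :: k) m = 0 := univCore_of_two_le (by simp)
      exact ⟨fun _ _ => ⟨by simp [h], by simp [h]⟩,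
        fun _ _ _ => ⟨by simp [h], by simp [h]⟩, by simp [h]⟩

/-- A form letter at the head must go to the list on which `univCore` expects a single form, and no
other letter fits there. -/
theorem univForm_inr (y : FormLetter 𝕜 A B) (l : List (Letter 𝕜 A B)) :
    univForm (.inr y :: l) = formHat y.2 l := by
  rw [univForm, shuffleSum_cons, shuffleSum_of_left_nil,
    shuffleSum_eq_zero (F := fun l₁ l₂ => _ • univCore l₁ (.inr y :: l₂))]
  · exact add_zero _
  · intro l₁ l₂ _
    match l₁ with
    | [.inr z] => simp [univCore]
    | [] => simp [univCore]
    | [.inl a] => simp [univCore]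
    | s :: t :: k => rw [univCore_of_two_le (by simp), smul_zero]
  · intro l₁ l₂ h
    refine univCore_of_two_le ?_ l₂
    have := List.length_pos_iff.2 h
    simp; omega

theorem univForm_hasDegree : HasDegree letterDeg (univForm : List (Letter 𝕜 A B) → B) (-1) := by
  intro l hl
  refine shuffleSum_eq_zero fun l₁ l₂ h => ?_
  match l₁ with
  | [.inr y] =>
    have := degSum_perm (deg := letterDeg) h
    simp only [List.cons_append, degSum_cons, letterDeg_inr, List.nil_append] at this
    exact formHat_of_degSum y.2 l₂ (by omega)
  | [] => rfl
  | [.inl a] => rfl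
  | s :: t :: k => exact univCore_of_two_le (by simp) _

/-- A list which consists of elements of `A`. -/
theorem exists_eq_map_inl {m : List (Letter 𝕜 A B)} (h : m.all Sum.isLeft) :
    ∃ a : List A, m = a.map .inl := by
  induction m with
  | nil => exact ⟨[], rfl⟩
  | cons s m ih =>
    rw [List.all_cons, Bool.and_eq_true] at h
    obtain ⟨a, rfl⟩ := ih h.2
    cases s with
    | inl b => exact ⟨b :: a, rfl⟩
    | inr y => simp at h

theorem all_isLeft_perm {l m : List (Letter 𝕜 A B)} (h : l.Perm m) (hm : m.all Sum.isLeft) :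
    l.all Sum.isLeft := by
  rw [List.all_eq_true] at hm ⊢
  exact fun s hs => hm s (h.mem_iff.1 hs)

theorem univForm_of_all_isLeft {l : List (Letter 𝕜 A B)} (hl : l.all Sum.isLeft) :
    univForm l = 0 := by
  refine shuffleSum_eq_zero fun l₁ l₂ h => ?_
  have := all_isLeft_perm h hl
  match l₁ with
  | [.inr y] => simp at this
  | [] => rfl
  | [.inl a] => rfl
  | s :: t :: k => exact univCore_of_two_le (by simp) _

theorem formHat_of_not_all {k : ℕ} (x : A [⋀^Fin k]→ₗ[𝕜] B) {l : List (Letter 𝕜 A B)}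
    (h : ¬ l.all Sum.isLeft) : formHat x l = 0 := by
  rw [List.all_eq_true] at h
  push Not at h
  obtain ⟨s, hs, hs'⟩ := h
  obtain ⟨l₁, l₂, rfl⟩ := List.append_of_mem hs
  cases s with
  | inl a => simp at hs'
  | inr y => exact formHat_append_inr x y l₁ l₂

/-- The sum of the tautological form and the universal form. -/
def totalForm (l : List (Letter 𝕜 A B)) : A × B := (tautForm l, univForm l)

theorem totalForm_isSymmForm : IsSymmForm (totalForm : List (Letter 𝕜 A B) → A × B) :=
  tautForm_isSymmForm.prodMk univForm_isSymmForm

theorem totalForm_hasDegree :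
    HasDegree letterDeg (totalForm : List (Letter 𝕜 A B) → A × B) (-1) := by
  intro l hl
  refine Prod.ext ?_ (univForm_hasDegree l hl)
  match l with
  | [] => rfl
  | [.inl a] => simp at hl
  | .inr y :: l => rfl
  | s :: t :: l => exact tautForm_cons_cons s t l

theorem totalForm_inr (y : FormLetter 𝕜 A B) (l : List (Letter 𝕜 A B)) :
    totalForm (.inr y :: l) = (0, formHat y.2 l) :=
  Prod.ext rfl (univForm_inr y l)

variable (br : (A × B) →ₗ[𝕜] (A × B) →ₗ[𝕜] (A × B))

/-- The generating function of all the brackets: its value on `x₁, …, xₖ, a₁, …, aₘ` is, up to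
sign, `[x₁, …, xₖ](a₁, …, aₘ)`. -/
def univBracket : List (Letter 𝕜 A B) → B := curvature letterDeg br .inl totalForm

theorem halfSquare_totalForm_isSymmForm :
    IsSymmForm (halfSquare letterDeg br (totalForm : List (Letter 𝕜 A B) → A × B)) :=
  (totalForm_isSymmForm.wedge totalForm_isSymmForm br).map
    ((2⁻¹ : 𝕜) • (LinearMap.id : A × B →ₗ[𝕜] A × B))

theorem univBracket_isSymmForm : IsSymmForm (univBracket br) :=
  ((halfSquare_totalForm_isSymmForm br).map (LinearMap.snd 𝕜 A B)).sub
    (((halfSquare_totalForm_isSymmForm br).map (LinearMap.fst 𝕜 A B)).insertForm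
      univForm_isSymmForm)

theorem univForm_isLinearMap (l : List (Letter 𝕜 A B)) :
    IsLinearMap 𝕜 fun a : A => univForm (.inl a :: l) :=
  univForm_isSymmForm.linear_inl [] l

theorem halfSquare_totalForm_hasDegree :
    HasDegree letterDeg (halfSquare letterDeg br (totalForm : List (Letter 𝕜 A B) → A × B)) (-2) := by
  intro l hl
  rw [halfSquare, totalForm_hasDegree.wedge totalForm_hasDegree (k := -2) rfl l hl, smul_zero]

theorem univBracket_hasDegree : HasDegree letterDeg (univBracket br) (-2) := by
  intro l hl
  have h1 := halfSquare_totalForm_hasDegree br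
  have h2 : HasDegree letterDeg (fun l => (halfSquare letterDeg br
    (totalForm : List (Letter 𝕜 A B) → A × B) l).1) (-2) := fun l hl => by
      simp only [h1 l hl, Prod.fst_zero]
  rw [univBracket, curvature, h1 l hl, Prod.snd_zero, zero_sub, neg_eq_zero]
  exact HasDegree.insertForm (deg := letterDeg) (j := Sum.inl) (fun _ => rfl) (fun l => (univForm_isLinearMap l).map_zero) h2
    univForm_hasDegree (by norm_num) l hl

/-- The first-order part of the curvature in the direction `w`. -/
def bracketPart (w : List (Letter 𝕜 A B) → B) (l : List (Letter 𝕜 A B)) : B :=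
  (wedge letterDeg br (fun l => ((0 : A), w l)) totalForm l).2 -
    insertForm letterDeg .inl (fun l => (wedge letterDeg br (fun l => ((0 : A), w l)) totalForm l).1)
      univForm l

/-- The insertion of `½ pr_A [ℓ, ℓ]`. -/
def insertPart (w : List (Letter 𝕜 A B) → B) (l : List (Letter 𝕜 A B)) : B :=
  insertForm letterDeg .inl (fun l => (halfSquare letterDeg br totalForm l).1) w l

/-- Contraction with a letter is a graded derivation of `[ℓ, ℓ]`. Its two terms agree by
skew-symmetry, which absorbs the factor `½`. -/
theorem halfSquare_inr [CharZero 𝕜] (hself : ∀ x, br x x = 0) (y : FormLetter 𝕜 A B)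
    (l : List (Letter 𝕜 A B)) :
    halfSquare letterDeg br totalForm (.inr y :: l) =
      wedge letterDeg br (fun l => ((0 : A), formHat y.2 l)) totalForm l := by
  have hw : HasDegree letterDeg (fun l : List (Letter 𝕜 A B) => ((0 : A), formHat y.2 l))
      (-y.1) := fun l hl => Prod.ext rfl (formHat_of_degSum y.2 l hl)
  have e : wedge letterDeg br totalForm totalForm (.inr y :: l) =
      wedge letterDeg br (fun l => ((0 : A), formHat y.2 l)) totalForm l +
      ((y.1 : ℤ) - 1).negOnePow •
        wedge letterDeg br totalForm (fun l => ((0 : A), formHat y.2 l)) l := by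
    rw [wedge, shuffleSum_cons, wedge, wedge, ← shuffleSum_units_smul]
    simp only [totalForm_inr]
    congr 1
    refine shuffleSum_congr fun l₁ l₂ _ => ?_
    rw [koszulFactor_prod, letterDeg_inr]
    by_cases h : degSum letterDeg l₁ = -1
    · rw [h, mul_neg_one, Int.negOnePow_neg]
    · rw [totalForm_hasDegree _ h]; simp
  rw [halfSquare, e, wedge_comm br totalForm_hasDegree hw, flip_eq_neg hself]
  have h2 : wedge letterDeg (-br) (fun l => ((0 : A), formHat y.2 l)) totalForm l =
      - wedge letterDeg br (fun l => ((0 : A), formHat y.2 l)) totalForm l := by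
    simp [wedge, shuffleSum_neg]
  have h3 : ((y.1 : ℤ) - 1).negOnePow * (-1 * -(y.1 : ℤ)).negOnePow = -1 := by
    rw [neg_one_mul, neg_neg, ← Int.negOnePow_add]
    exact Int.negOnePow_odd _ ⟨y.1 - 1, by ring⟩
  rw [h2, smul_smul, h3, Units.neg_smul, one_smul, neg_neg, ← two_smul 𝕜, smul_smul]
  simp

/-- Filling in a form letter differentiates the curvature in the direction of that form. The form
replaces either one factor `ℓ` of `½[ℓ, ℓ]` or the form that receives the insertion; in the second
case the exchange of the inserted letter with the form letter contributes to the sign. -/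
theorem univBracket_inr [CharZero 𝕜] (hself : ∀ x, br x x = 0) (y : FormLetter 𝕜 A B)
    (l : List (Letter 𝕜 A B)) :
    univBracket br (.inr y :: l) =
      bracketPart br (formHat y.2) l + (y.1 : ℤ).negOnePow • insertPart br (formHat y.2) l := by
  have hu := halfSquare_totalForm_hasDegree (𝕜 := 𝕜) (A := A) (B := B) br
  rw [univBracket, curvature, bracketPart, halfSquare_inr br hself, sub_add]
  congr 1
  rw [insertForm, shuffleSum_cons, insertForm, sub_eq_add_neg]
  congr 1
  · simp only [halfSquare_inr br hself]
    rfl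
  · rw [insertPart, insertForm, ← shuffleSum_units_smul, ← shuffleSum_neg]
    refine shuffleSum_congr fun l₁ l₂ _ => ?_
    change _ • univForm _ = _
    have := univForm_isSymmForm.swap [] l₂ (.inl (halfSquare letterDeg br totalForm l₁).1) (.inr y)
    rw [List.nil_append, List.nil_append] at this
    rw [this, univForm_inr, koszulFactor_prod, smul_smul, koszulFactor, letterDeg_inl,
      letterDeg_inr]
    by_cases h : degSum letterDeg l₁ = -2
    · rw [h, ← Units.neg_smul]
      congr 1
      have : ∀ k : ℤ, ((k - 1) * -2).negOnePow * (-1 * (k - 1)).negOnePow = -k.negOnePow := by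
        intro k
        rw [← Int.negOnePow_add, ← Int.negOnePow_succ, Int.negOnePow_eq_iff]
        exact ⟨-2 * k + 1, by ring⟩
      exact this _
    · rw [hu _ h, Prod.fst_zero]
      have h0 : formHat y.2 (.inl 0 :: l₂) = 0 :=
        (formHat_append_inl_isLinearMap y.2 [] l₂).map_zero
      rw [h0, smul_zero, smul_zero, neg_zero]

/-- The restriction of a form to the lists of elements of `A`. -/
def restrictInl {C : Type*} [Zero C] (f : List (Letter 𝕜 A B) → C) (m : List (Letter 𝕜 A B)) : C :=
  if m.all Sum.isLeft then f m else 0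

/-- The letters of `l` that enter the inner form are chosen first. By `h₀` none of the remaining
ones may join them, so the choice left concerns only `m` and may be written as a splitting of all of
`l₂ ++ m`. -/
theorem shuffleSum_append_split {S M : Type*} [AddCommGroup M] {c : S → S → ℤˣ}
    {F : List S → List S → M} {G : List S → List S → List S → M} {l m : List S}
    (h : ∀ l₁ l₂ m₁ m₂, (l₁ ++ l₂).Perm l → (m₁ ++ m₂).Perm m →
      F (l₁ ++ m₁) (l₂ ++ m₂) = G l₁ m₁ (l₂ ++ m₂))
    (h₀ : ∀ l₁ l₂ k₁ k₂ m₁ m', (l₁ ++ l₂).Perm l → (k₁ ++ k₂).Perm l₂ → k₁ ≠ [] →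
      G l₁ (k₁ ++ m₁) m' = 0) :
    shuffleSum c F (l ++ m) = shuffleSum c (fun l₁ l₂ => shuffleSum c (G l₁) (l₂ ++ m)) l := by
  rw [shuffleSum_append]
  refine shuffleSum_congr fun l₁ l₂ hl => ?_
  rw [shuffleSum_append]
  have : shuffleSum c (fun k₁ k₂ => if k₁ = [] then shuffleSum c (fun m₁ m₂ =>
      (k₂.map fun s => (m₁.map (c s)).prod).prod • G l₁ m₁ (k₂ ++ m₂)) m else 0) l₂ =
      shuffleSum c (fun k₁ k₂ => shuffleSum c (fun m₁ m₂ =>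
      (k₂.map fun s => (m₁.map (c s)).prod).prod • G l₁ (k₁ ++ m₁) (k₂ ++ m₂)) m) l₂ := by
    refine shuffleSum_congr fun k₁ k₂ hk => ?_
    split_ifs with h1
    · subst h1; rfl
    · refine (shuffleSum_eq_zero fun m₁ m₂ _ => ?_).symm
      rw [h₀ l₁ l₂ k₁ k₂ _ _ hl hk h1, smul_zero]
  rw [← this]
  refine Eq.trans ?_ (shuffleSum_of_left_nil ?_).symm
  · rw [if_pos rfl]
    refine shuffleSum_congr fun m₁ m₂ hm => ?_
    rw [h l₁ l₂ m₁ m₂ hl hm]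
  · intro k₁ k₂ h1
    rw [if_neg h1]

variable {br}

/-- Associativity of the shuffle product brings the arguments of `w` into the outermost splitting,
the shape that `shuffleSum_append_split` requires. -/
theorem bracketPart_eq (w : List (Letter 𝕜 A B) → B) (l : List (Letter 𝕜 A B)) :
    bracketPart br w l = shuffleSum (koszulFactor letterDeg) (fun l₁ l' =>
      (br (0, w l₁) (totalForm l')).2 - shuffleSum (koszulFactor letterDeg) (fun l₂ l₃ =>
        univForm (.inl (br (0, w l₁) (totalForm l₂)).1 :: l₃)) l') l := by
  rw [bracketPart, shuffleSum_sub]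
  congr 1
  · change LinearMap.snd 𝕜 A B _ = _
    rw [wedge, map_shuffleSum]
    rfl
  · rw [shuffleSum_assoc, insertForm]
    refine shuffleSum_congr fun l' l₃ _ => ?_
    have : (wedge letterDeg br (fun l => ((0 : A), w l)) totalForm l').1 =
        shuffleSum (koszulFactor letterDeg) (fun l₁ l₂ => (br (0, w l₁) (totalForm l₂)).1) l' := by
      change LinearMap.fst 𝕜 A B _ = _
      rw [wedge, map_shuffleSum]
      rfl
    change univForm (.inl _ :: l₃) = _
    rw [this]
    exact map_shuffleSum ((univForm_isLinearMap l₃).mk' _) _ _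

/-- `½[ℓ, ℓ]` is even, so the two lists can be exchanged without a sign. -/
theorem insertPart_eq {w : List (Letter 𝕜 A B) → B} (hw : ∀ l, w (.inl 0 :: l) = 0)
    (l : List (Letter 𝕜 A B)) :
    insertPart br w l = shuffleSum (koszulFactor letterDeg) (fun l₁ l₂ =>
      w (.inl (halfSquare letterDeg br totalForm l₂).1 :: l₁)) l := by
  rw [insertPart, insertForm, shuffleSum_comm koszulFactor_comm]
  refine shuffleSum_congr fun l₁ l₂ _ => ?_
  rw [koszulFactor_prod_prod]
  by_cases h : degSum letterDeg l₂ = -2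
  · rw [h, mul_neg, Int.negOnePow_neg, mul_two, Int.negOnePow_add, Int.units_mul_self, one_smul]
  · rw [halfSquare_totalForm_hasDegree br l₂ h]
    simp [hw]

theorem not_all_isLeft_append {x : List (FormLetter 𝕜 A B)} {l₁ l₂ k₁ k₂ m₁ : List (Letter 𝕜 A B)}
    (h₁ : (l₁ ++ l₂).Perm (x.map .inr)) (h₂ : (k₁ ++ k₂).Perm l₂) (h : k₁ ≠ []) :
    ¬ (k₁ ++ m₁).all Sum.isLeft := by
  cases k₁ with
  | nil => exact absurd rfl h
  | cons s k₁ =>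
    have h3 : s ∈ x.map (Sum.inr : FormLetter 𝕜 A B → Letter 𝕜 A B) := by
      rw [← h₁.mem_iff, List.mem_append, ← h₂.mem_iff]
      simp
    obtain ⟨y, _, rfl⟩ := List.mem_map.1 h3
    simp

/-- The generalized Jacobi identity for the generating function. -/
theorem shuffleSum_univBracket [CharZero 𝕜] (hself : ∀ x, br x x = 0)
    (hjac : ∀ x y z, br x (br y z) = br (br x y) z + br y (br x z))
    (y : List (Letter 𝕜 A B) → FormLetter 𝕜 A B)
    (hy : ∀ l, formHat (y l).2 = restrictInl fun m => univBracket br (l ++ m))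
    (hy' : ∀ l, ((y l).1 : ℤ).negOnePow = (degSum letterDeg l).negOnePow ∨ (y l).2 = 0)
    (x : List (FormLetter 𝕜 A B)) (a : List A) :
    shuffleSum (koszulFactor letterDeg) (fun l₁ l₂ =>
      univBracket br (.inr (y l₁) :: (l₂ ++ a.map .inl))) (x.map .inr) = 0 := by
  set w := univBracket br with hw
  have hws : IsSymmForm w := univBracket_isSymmForm br
  have key := curvatureDeriv_curvature (deg := letterDeg) (j := Sum.inl) (ℓ := totalForm) hself hjac
    (fun _ => rfl) totalForm_hasDegree (fun l => totalForm_isSymmForm.linear_inl [] l)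
    (fun a b l => by
      have := totalForm_isSymmForm.swap [] l (.inl a) (.inl b)
      rw [List.nil_append, List.nil_append] at this
      rw [this]
      simp [koszulFactor])
    (fun a => rfl) (fun a l h => by
      match l, h with
      | t :: l, _ => exact tautForm_cons_cons (𝕜 := 𝕜) (B := B) (.inl a) t l) (x.map .inr ++ a.map .inl)
  have hmem : ∀ m₁ m₂ : List (Letter 𝕜 A B), (m₁ ++ m₂).Perm (a.map .inl) →
      m₁.all Sum.isLeft := by
    intro m₁ m₂ h
    have := all_isLeft_perm h (by simp)
    rw [List.all_append, Bool.and_eq_true] at this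
    exact this.1
  -- The arguments of the inner `w` are some of the forms, collected in `l₁`, and some elements of
  -- `A`. As a form in the latter, `w` is `y l₁`.
  have e1 : bracketPart br w (x.map .inr ++ a.map .inl) = shuffleSum (koszulFactor letterDeg)
      (fun l₁ l₂ => bracketPart br (formHat (y l₁).2) (l₂ ++ a.map .inl)) (x.map .inr) := by
    simp only [bracketPart_eq]
    refine shuffleSum_append_split (fun l₁ l₂ m₁ m₂ h₁ h₂ => ?_) fun l₁ l₂ k₁ k₂ m₁ m' h₁ h₂ h => ?_
    · rw [hy, restrictInl, if_pos (hmem _ _ h₂)]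
    · rw [formHat_of_not_all _ (not_all_isLeft_append h₁ h₂ h)]
      simp only [← Prod.zero_eq_mk, map_zero, LinearMap.zero_apply, Prod.snd_zero, Prod.fst_zero,
        (univForm_isLinearMap _).map_zero, zero_sub, neg_eq_zero]
      exact shuffleSum_eq_zero fun _ _ _ => rfl
  have e2 : insertPart br w (x.map .inr ++ a.map .inl) = shuffleSum (koszulFactor letterDeg)
      (fun l₁ l₂ => ((y l₁).1 : ℤ).negOnePow •
        insertPart br (formHat (y l₁).2) (l₂ ++ a.map .inl)) (x.map .inr) := by
    rw [insertPart_eq (w := w) (fun l => (hws.linear_inl [] l).map_zero)]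
    have h0 : ∀ (k : List (Letter 𝕜 A B)) l, formHat (y k).2 (.inl 0 :: l) = 0 := fun k l =>
      (formHat_append_inl_isLinearMap (y k).2 [] l).map_zero
    simp only [insertPart_eq (h0 _), ← shuffleSum_units_smul]
    refine shuffleSum_append_split (fun l₁ l₂ m₁ m₂ h₁ h₂ => ?_) fun l₁ l₂ k₁ k₂ m₁ m' h₁ h₂ h => ?_
    -- The inserted letter is odd and has to pass `l₁`; `hy'` identifies the resulting sign with the
    -- one in `univBracket_inr`.
    · have h3 := apply_move (k := []) (fun l m s t => hws.swap l m s t) l₁ m₁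
        (.inl (halfSquare letterDeg br totalForm (l₂ ++ m₂)).1)
      rw [List.nil_append, List.nil_append, koszulFactor_prod, letterDeg_inl] at h3
      rw [h3, neg_one_mul, Int.negOnePow_neg]
      have h4 : w (l₁ ++ .inl (halfSquare letterDeg br totalForm (l₂ ++ m₂)).1 :: m₁) =
          formHat (y l₁).2 (.inl (halfSquare letterDeg br totalForm (l₂ ++ m₂)).1 :: m₁) := by
        rw [hy, restrictInl, if_pos]
        rw [List.all_cons, hmem _ _ h₂]
        rfl
      rw [h4]
      rcases hy' l₁ with h5 | h5
      · rw [h5]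
      · rw [h5, (formHat_isLinearMap _).map_zero, smul_zero, smul_zero]
    · rw [formHat_of_not_all, smul_zero]
      rw [List.all_cons, Bool.and_eq_true]
      exact fun h' => not_all_isLeft_append h₁ h₂ h h'.2
  have e3 : curvatureDeriv letterDeg br Sum.inl totalForm w (x.map .inr ++ a.map .inl) =
      bracketPart br w (x.map .inr ++ a.map .inl) + insertPart br w (x.map .inr ++ a.map .inl) :=
    rfl
  change curvatureDeriv letterDeg br Sum.inl totalForm w (x.map .inr ++ a.map .inl) = 0 at key
  rw [e3, e1, e2, ← shuffleSum_add] at key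
  rw [← key]
  refine shuffleSum_congr fun l₁ l₂ _ => ?_
  exact univBracket_inr br hself (y l₁) _

end UniversalForm

/-! ### The brackets on the sum of the spaces of alternating maps -/

noncomputable section AlternatingBrackets

variable {𝕜 A B : Type*} [Field 𝕜] [AddCommGroup A] [Module 𝕜 A] [AddCommGroup B] [Module 𝕜 B]

theorem ofFn_update {α : Type*} {n : ℕ} (x : Fin n → α) (i : Fin n) (v : α) :
    List.ofFn (Function.update x i v) =
      (List.ofFn x).take i ++ v :: (List.ofFn x).drop (i + 1) := by
  have h := List.set_eq_take_append_cons_drop (l := List.ofFn x) (i := i) (a := v)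
  rw [if_pos (by simp)] at h
  rw [← h]
  refine List.ext_getElem (by simp) fun j h₁ h₂ => ?_
  simp only [List.length_ofFn] at h₁
  rw [List.getElem_set, List.getElem_ofFn, List.getElem_ofFn, Function.update_apply]
  simp only [Fin.ext_iff, eq_comm]

namespace IsSymmForm

variable {f : List (Letter 𝕜 A B) → B}

/-- The alternating map obtained by filling in the first letters of a form. -/
def toAlternating [CharZero 𝕜] (hf : IsSymmForm f) (l : List (Letter 𝕜 A B)) (n : ℕ) :
    A [⋀^Fin n]→ₗ[𝕜] B where
  toFun a := f (l ++ List.ofFn fun i => .inl (a i))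
  map_update_add' {dec} a i v w := by
    have e : dec = instDecidableEqFin _ := Subsingleton.elim _ _
    subst e
    have : ∀ v, (fun j => (.inl (Function.update a i v j) : Letter 𝕜 A B)) =
        Function.update (fun j => .inl (a j)) i (.inl v) := fun v => by
      ext j : 1
      by_cases h : j = i
      · subst h; simp
      · simp [h]
    simp only [this, ofFn_update, ← List.append_assoc]
    exact (hf.linear_inl _ _).map_add v w
  map_update_smul' {dec} a i c v := by
    have e : dec = instDecidableEqFin _ := Subsingleton.elim _ _
    subst e
    have : ∀ v, (fun j => (.inl (Function.update a i v j) : Letter 𝕜 A B)) =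
        Function.update (fun j => .inl (a j)) i (.inl v) := fun v => by
      ext j : 1
      by_cases h : j = i
      · subst h; simp
      · simp [h]
    simp only [this, ofFn_update, ← List.append_assoc]
    exact (hf.linear_inl _ _).map_smul c v
  map_eq_zero_of_eq' a i j h hij := by
    refine eq_zero_of_eq_neg 𝕜 ?_
    have := apply_perm (fun l m s t => hf.swap l m s t)
      (fun i => (.inl (a i) : Letter 𝕜 A B)) (Equiv.swap i j) l []
    rw [List.append_nil, List.append_nil] at this
    have h1 : (fun i => (.inl (a i) : Letter 𝕜 A B)) ∘ Equiv.swap i j = fun i => .inl (a i) := by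
      ext k : 1
      simp only [Function.comp]
      by_cases hi : k = i
      · subst hi; simp [h]
      · by_cases hj : k = j
        · subst hj; simp [h]
        · rw [Equiv.swap_apply_of_ne_of_ne hi hj]
    have h2 : invSign (koszulFactor letterDeg) (fun i => (.inl (a i) : Letter 𝕜 A B))
        (Equiv.swap i j) = -1 := by
      rw [← Equiv.Perm.sign_swap hij, ← invSign_neg_one _ a]
      simp [invSign, koszulFactor]
    rw [h1, h2, Units.neg_smul, one_smul] at this
    exact this

variable [CharZero 𝕜]

theorem toAlternating_apply (hf : IsSymmForm f) (l : List (Letter 𝕜 A B)) (n : ℕ) (a : Fin n → A) :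
    hf.toAlternating l n a = f (l ++ List.ofFn fun i => .inl (a i)) := rfl

theorem toAlternating_eq_zero (hf : IsSymmForm f) {g : ℤ} (hg : HasDegree letterDeg f g)
    (l : List (Letter 𝕜 A B)) (n : ℕ) (h : degSum letterDeg l - n ≠ g) :
    hf.toAlternating l n = 0 := by
  ext a
  refine hg _ fun h' => h ?_
  rw [← h']
  simp [degSum, List.map_ofFn, Function.comp_def, sub_eq_add_neg]

/-- The degree forces the number of remaining arguments. If that number is negative, `toNat` makes
it `0` and both sides vanish. -/
theorem formHat_toAlternating (hf : IsSymmForm f) {g : ℤ} (hg : HasDegree letterDeg f g)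
    (l : List (Letter 𝕜 A B)) :
    formHat (hf.toAlternating l (degSum letterDeg l - g).toNat) =
      restrictInl fun m => f (l ++ m) := by
  ext m
  rw [restrictInl]
  split_ifs with h
  · obtain ⟨a, rfl⟩ := exists_eq_map_inl h
    by_cases hd : degSum letterDeg l - g = a.length
    · rw [hd, Int.toNat_natCast]
      have := formHat_ofFn (hf.toAlternating l a.length) a.get
      rw [toAlternating_apply] at this
      have e : List.ofFn (fun i => (Sum.inl (a.get i) : Letter 𝕜 A B)) = a.map .inl := by
        rw [← List.ofFn_get (a.map (Sum.inl : A → Letter 𝕜 A B))]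
        simp
      rw [e] at this
      exact this
    · have e : degSum letterDeg (a.map (Sum.inl : A → Letter 𝕜 A B)) = -a.length := by
        clear h hd
        induction a with
        | nil => rfl
        | cons b a ih => simp [ih]
      rw [hg (l ++ _) (by rw [degSum_append, e]; omega)]
      by_cases h0 : (degSum letterDeg l - g).toNat = a.length
      · rw [hf.toAlternating_eq_zero hg _ _ (by omega)]
        exact (formHat_isLinearMap _).map_zero
      · exact formHat_of_degSum _ _ (by rw [e]; omega)
  · exact formHat_of_not_all _ h

end IsSymmForm

/-- A form of fixed degree as an element of the sum of the spaces of alternating maps. -/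
def ofLetter (s : FormLetter 𝕜 A B) : ⨁ k : ℕ, A [⋀^Fin k]→ₗ[𝕜] B :=
  DirectSum.lof 𝕜 ℕ (fun k => A [⋀^Fin k]→ₗ[𝕜] B) s.1 s.2

/-- The degree of a form. -/
def formDegree (s : FormLetter 𝕜 A B) : ℤ := s.1

/-- The correction `∏_{i<j} (-1)^{dᵢ(dⱼ-1)}` between skew-symmetric and symmetric brackets. -/
def twistSign : List (FormLetter 𝕜 A B) → ℤˣ
  | [] => 1
  | s :: l => (l.map fun t => (formDegree s * (formDegree t - 1)).negOnePow).prod * twistSign l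

theorem twistSign_cons (s : FormLetter 𝕜 A B) (l : List (FormLetter 𝕜 A B)) :
    twistSign (s :: l) =
      (l.map fun t => (formDegree s * (formDegree t - 1)).negOnePow).prod * twistSign l := rfl

/-- The sign in the definition of the brackets. -/
def bracketSign (l : List (FormLetter 𝕜 A B)) : ℤˣ :=
  (l.length * (degSum formDegree l + 1)).negOnePow * twistSign l

theorem degSum_map_inr (l : List (FormLetter 𝕜 A B)) :
    degSum letterDeg (l.map Sum.inr : List (Letter 𝕜 A B)) = degSum formDegree l - l.length := by
  induction l with
  | nil => rfl
  | cons s l ih => simp [ih, formDegree]; ring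

/-- The sign sees only the degrees of the forms, so it is constant while one form varies in its
space; multilinearity of the brackets depends on this. -/
theorem bracketSign_eq_of_map {l m : List (FormLetter 𝕜 A B)}
    (h : l.map (fun s => s.1) = m.map (fun s => s.1)) : bracketSign l = bracketSign m := by
  have h1 : ∀ l : List (FormLetter 𝕜 A B), degSum formDegree l =
      ((l.map (fun s => s.1)).map (fun k : ℕ => (k : ℤ))).sum := fun l => by
    rw [List.map_map]; rfl
  have h2 : twistSign l = twistSign m := by
    induction l generalizing m with
    | nil => simp only [List.map_nil, List.nil_eq, List.map_eq_nil_iff] at h; subst h; rfl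
    | cons s l ih =>
      cases m with
      | nil => simp at h
      | cons t m =>
        rw [List.map_cons, List.map_cons, List.cons.injEq] at h
        have h3 : ∀ l : List (FormLetter 𝕜 A B),
            (l.map fun t => (formDegree s * (formDegree t - 1)).negOnePow) =
            (l.map (fun s => s.1)).map fun k : ℕ => ((s.1 : ℤ) * ((k : ℤ) - 1)).negOnePow :=
          fun l => by rw [List.map_map]; rfl
        rw [twistSign_cons, twistSign_cons, ih h.2, h3, h.2, h.1, List.map_map]
        rfl
  rw [bracketSign, bracketSign, h2, h1, h1, h]
  have := congrArg List.length h
  rw [List.length_map, List.length_map] at this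
  rw [this]

variable [CharZero 𝕜] (br : (A × B) →ₗ[𝕜] (A × B) →ₗ[𝕜] (A × B))

/-- The form with values `V(x₁, …, xₖ, a₁, …, aₙ)`, where `V` is the generating function. -/
def univBracketLetter (l : List (Letter 𝕜 A B)) : FormLetter 𝕜 A B :=
  ⟨(degSum letterDeg l + 2).toNat, (univBracket_isSymmForm br).toAlternating l _⟩

theorem formHat_univBracketLetter (l : List (Letter 𝕜 A B)) :
    formHat (univBracketLetter br l).2 = restrictInl fun m => univBracket br (l ++ m) :=
  (univBracket_isSymmForm br).formHat_toAlternating (univBracket_hasDegree br) l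

/-- The expected degree may be negative, and `toNat` then falsifies it; the form is zero in that
case, so the sign rules are not affected. -/
theorem univBracketLetter_fst (l : List (Letter 𝕜 A B)) :
    ((univBracketLetter br l).1 : ℤ) = degSum letterDeg l + 2 ∨ (univBracketLetter br l).2 = 0 := by
  by_cases h : 0 ≤ degSum letterDeg l + 2
  · exact .inl (Int.toNat_of_nonneg h)
  · refine .inr ((univBracket_isSymmForm br).toAlternating_eq_zero (univBracket_hasDegree br) _ _ ?_)
    omega

/-- The bracket of homogeneous forms. -/
def bracketLetter (l : List (FormLetter 𝕜 A B)) : FormLetter 𝕜 A B :=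
  ⟨(univBracketLetter br (l.map .inr)).1, bracketSign l • (univBracketLetter br (l.map .inr)).2⟩

theorem ofLetter_bracketLetter_apply (l : List (FormLetter 𝕜 A B)) (n : ℕ) (a : Fin n → A) :
    ofLetter (bracketLetter br l) n a =
      bracketSign l • univBracket br (l.map .inr ++ List.ofFn fun i => .inl (a i)) := by
  rw [ofLetter]
  by_cases h : (bracketLetter br l).1 = n
  · subst h
    rw [DirectSum.lof_apply]
    rfl
  · rw [DirectSum.lof_eq_of, DirectSum.of_eq_of_ne _ _ _ (Ne.symm h), AlternatingMap.zero_apply]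
    rw [← IsSymmForm.toAlternating_apply (univBracket_isSymmForm br),
      IsSymmForm.toAlternating_eq_zero _ (univBracket_hasDegree br), AlternatingMap.zero_apply,
      smul_zero]
    intro h'
    refine h ?_
    change (degSum letterDeg _ + 2).toNat = n
    omega

/-- The restriction of the bracket to forms of fixed degrees. -/
def bracketAt {k : ℕ} (p : Fin k → ℕ) :
    MultilinearMap 𝕜 (fun i => A [⋀^Fin (p i)]→ₗ[𝕜] B) (⨁ k : ℕ, A [⋀^Fin k]→ₗ[𝕜] B) :=
  have hup : ∀ [DecidableEq (Fin k)] (x : ∀ i, A [⋀^Fin (p i)]→ₗ[𝕜] B) (i : Fin k) v,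
      (fun j => (⟨p j, Function.update x i v j⟩ : FormLetter 𝕜 A B)) =
        Function.update (fun j => ⟨p j, x j⟩) i ⟨p i, v⟩ := fun x i v => by
    ext j : 1
    by_cases h : j = i
    · subst h; simp
    · simp [h]
  have hsign : ∀ (x : ∀ i, A [⋀^Fin (p i)]→ₗ[𝕜] B) (i : Fin k) v w,
      bracketSign ((List.ofFn fun j => (⟨p j, x j⟩ : FormLetter 𝕜 A B)).take i ++
        ⟨p i, v⟩ :: (List.ofFn fun j => (⟨p j, x j⟩ : FormLetter 𝕜 A B)).drop (i + 1)) =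
      bracketSign ((List.ofFn fun j => (⟨p j, x j⟩ : FormLetter 𝕜 A B)).take i ++
        ⟨p i, w⟩ :: (List.ofFn fun j => (⟨p j, x j⟩ : FormLetter 𝕜 A B)).drop (i + 1)) :=
    fun x i v w => bracketSign_eq_of_map (by simp)
  { toFun := fun x => ofLetter (bracketLetter br (List.ofFn fun i => ⟨p i, x i⟩))
    map_update_add' := fun {dec} x i v w => by
      have e : dec = instDecidableEqFin _ := Subsingleton.elim _ _
      subst e
      refine DFinsupp.ext fun n => AlternatingMap.ext fun a => ?_
      simp only [hup, ofFn_update]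
      rw [DirectSum.add_apply, AlternatingMap.add_apply, ofLetter_bracketLetter_apply, ofLetter_bracketLetter_apply,
        ofLetter_bracketLetter_apply, hsign x i (v + w) 0, hsign x i v 0, hsign x i w 0, ← smul_add]
      simp only [List.map_append, List.map_cons, List.append_assoc, List.cons_append]
      rw [((univBracket_isSymmForm br).linear_inr (p i) _ _).map_add v w]
    map_update_smul' := fun {dec} x i c v => by
      have e : dec = instDecidableEqFin _ := Subsingleton.elim _ _
      subst e
      refine DFinsupp.ext fun n => AlternatingMap.ext fun a => ?_
      simp only [hup, ofFn_update]
      rw [DirectSum.smul_apply, AlternatingMap.smul_apply, ofLetter_bracketLetter_apply, ofLetter_bracketLetter_apply,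
        hsign x i (c • v) 0, hsign x i v 0, smul_comm c]
      simp only [List.map_append, List.map_cons, List.append_assoc, List.cons_append]
      rw [((univBracket_isSymmForm br).linear_inr (p i) _ _).map_smul c v] }

/-- The bracket of `k` forms. -/
def altBracket (k : ℕ) : MultilinearMap 𝕜 (fun _ : Fin k => ⨁ k : ℕ, A [⋀^Fin k]→ₗ[𝕜] B)
    (⨁ k : ℕ, A [⋀^Fin k]→ₗ[𝕜] B) :=
  MultilinearMap.fromDirectSumEquiv fun p => bracketAt br p

theorem altBracket_ofLetter {k : ℕ} (s : Fin k → FormLetter 𝕜 A B) :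
    altBracket br k (fun i => ofLetter (s i)) = ofLetter (bracketLetter br (List.ofFn s)) := by
  have := MultilinearMap.fromDirectSumEquiv_lof (R := 𝕜)
    (M := fun (_ : Fin k) (n : ℕ) => A [⋀^Fin n]→ₗ[𝕜] B) (M' := ⨁ k : ℕ, A [⋀^Fin k]→ₗ[𝕜] B)
    (fun p => bracketAt br p) (fun i => (s i).1) fun i => (s i).2
  exact this

end AlternatingBrackets

/-! ### The higher Jacobi identities -/

theorem DirectSum.isInternal_of_disjoint {𝕜 W ι : Type*} [DecidableEq ι] [Field 𝕜]
    [AddCommGroup W] [Module 𝕜 W] {𝒱 : ι → Submodule 𝕜 W} (N : ι → Submodule 𝕜 W)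
    (h : ∀ i, Disjoint (𝒱 i) (N i)) (hle : ∀ i j, j ≠ i → 𝒱 j ≤ N i) (htop : ⨆ i, 𝒱 i = ⊤) :
    DirectSum.IsInternal 𝒱 := by
  rw [DirectSum.isInternal_submodule_iff_iSupIndep_and_iSup_eq_top]
  exact ⟨fun i => (h i).mono_right (iSup₂_le fun j hj => hle i j hj), htop⟩

/-! ### The `ℤ`-grading of a direct sum over the natural numbers -/

section NatGrading

variable {𝕜 : Type*} [Field 𝕜] {E : ℕ → Type*} [∀ k, AddCommGroup (E k)] [∀ k, Module 𝕜 (E k)]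

variable (𝕜 E) in
/-- The `ℤ`-grading of a direct sum indexed by the natural numbers. -/
def natDeg (i : ℤ) : Submodule 𝕜 (⨁ k, E k) where
  carrier := {X | ∀ k : ℕ, (k : ℤ) ≠ i → X k = 0}
  add_mem' hX hY k hk := by simp [hX k hk, hY k hk]
  zero_mem' k _ := rfl
  smul_mem' c X hX k hk := by simp [DirectSum.smul_apply, hX k hk]

variable (𝕜 E) in
/-- The elements whose component of degree `i` is zero. -/
def natDegCompl (i : ℤ) : Submodule 𝕜 (⨁ k, E k) where
  carrier := {X | ∀ k : ℕ, (k : ℤ) = i → X k = 0}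
  add_mem' hX hY k hk := by simp [hX k hk, hY k hk]
  zero_mem' k _ := rfl
  smul_mem' c X hX k hk := by simp [DirectSum.smul_apply, hX k hk]

theorem disjoint_natDeg (i : ℤ) : Disjoint (natDeg 𝕜 E i) (natDegCompl 𝕜 E i) := by
  rw [Submodule.disjoint_def]
  intro X h₁ h₂
  refine DFinsupp.ext fun k => ?_
  by_cases h : (k : ℤ) = i
  · exact h₂ k h
  · exact h₁ k h

theorem natDeg_le_natDegCompl (i j : ℤ) (h : j ≠ i) : natDeg 𝕜 E j ≤ natDegCompl 𝕜 E i :=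
  fun _ hX k hk => hX k fun h' => h (h'.symm.trans hk)

theorem lof_mem_natDeg (k : ℕ) (x : E k) : DirectSum.lof 𝕜 ℕ E k x ∈ natDeg 𝕜 E k := by
  intro j hj
  rw [DirectSum.lof_eq_of, DirectSum.of_eq_of_ne]
  exact fun h => hj (by rw [h])

theorem iSup_natDeg : ⨆ i, natDeg 𝕜 E i = ⊤ := by
  refine eq_top_iff.2 fun X _ => ?_
  induction X using DirectSum.induction_on with
  | zero => exact zero_mem _
  | of k x => exact Submodule.mem_iSup_of_mem (k : ℤ) (lof_mem_natDeg k x)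
  | add x y hx hy => exact add_mem (hx trivial) (hy trivial)

theorem exists_of_mem_natDeg {i : ℤ} {X : ⨁ k, E k} (h : X ∈ natDeg 𝕜 E i) :
    X = 0 ∨ ∃ (k : ℕ) (x : E k), i = k ∧ X = DirectSum.lof 𝕜 ℕ E k x := by
  by_cases hi : 0 ≤ i
  · lift i to ℕ using hi
    refine .inr ⟨i, X i, rfl, DFinsupp.ext fun k => ?_⟩
    by_cases hk : k = i
    · subst hk
      exact (DirectSum.lof_apply 𝕜 k _).symm
    · rw [h k (by exact_mod_cast hk), DirectSum.lof_eq_of]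
      exact (DirectSum.of_eq_of_ne _ _ _ hk).symm
  · exact .inl (DFinsupp.ext fun k => h k (by omega))

end NatGrading

/-! ### From the generating function to degrees, skew-symmetry and Jacobi rules -/

section Jacobi

variable {𝕜 A B : Type*} [Field 𝕜] [AddCommGroup A] [Module 𝕜 A] [AddCommGroup B] [Module 𝕜 B]

theorem shuffleSum_map {S T M : Type*} [AddCommGroup M] (c : T → T → ℤˣ) (g : S → T)
    (F : List T → List T → M) (l : List S) :
    shuffleSum c F (l.map g) =
      shuffleSum (fun s t => c (g s) (g t)) (fun l₁ l₂ => F (l₁.map g) (l₂.map g)) l := by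
  induction l generalizing F with
  | nil => rfl
  | cons s l ih =>
    rw [List.map_cons, shuffleSum_cons, shuffleSum_cons, ih, ih]
    simp only [List.map_cons, List.map_map]
    rfl

theorem exists_ofLetter {k : ℕ} {d : Fin k → ℤ} {x : Fin k → ⨁ n : ℕ, A [⋀^Fin n]→ₗ[𝕜] B}
    (h : ∀ i, x i ∈ natDeg 𝕜 (fun n => A [⋀^Fin n]→ₗ[𝕜] B) (d i)) :
    (∃ i, x i = 0) ∨ ∃ s : Fin k → FormLetter 𝕜 A B,
      x = (fun i => ofLetter (s i)) ∧ d = fun i => formDegree (s i) := by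
  by_cases h0 : ∃ i, x i = 0
  · exact .inl h0
  · push Not at h0
    choose p y hp hy using fun i => (exists_of_mem_natDeg (h i)).resolve_left (h0 i)
    exact .inr ⟨fun i => ⟨p i, y i⟩, funext hy, funext hp⟩

variable [CharZero 𝕜] {br : (A × B) →ₗ[𝕜] (A × B) →ₗ[𝕜] (A × B)}

/-- Here the subalgebra condition enters: on elements of `A` alone `ℓ` is the tautological form, and
`[a, a']` has no part in `B`. So the curvature has no constant term and there is no nullary bracket.
-/
theorem univBracket_of_all_isLeft (hsub : ∀ a a', (br (a, 0) (a', 0)).2 = 0)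
    {l : List (Letter 𝕜 A B)} (hl : l.all Sum.isLeft) : univBracket br l = 0 := by
  have h2 : (halfSquare letterDeg br totalForm l).2 = 0 := by
    change LinearMap.snd 𝕜 A B ((2⁻¹ : 𝕜) • wedge letterDeg br totalForm totalForm l) = 0
    rw [map_smul, wedge, map_shuffleSum, shuffleSum_eq_zero, smul_zero]
    intro l₁ l₂ h
    have := all_isLeft_perm h hl
    rw [List.all_append, Bool.and_eq_true] at this
    rw [totalForm, totalForm, univForm_of_all_isLeft this.1, univForm_of_all_isLeft this.2]
    exact hsub _ _
  rw [univBracket, curvature, h2, zero_sub, neg_eq_zero]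
  refine shuffleSum_eq_zero fun l₁ l₂ h => univForm_of_all_isLeft ?_
  have := all_isLeft_perm h hl
  rw [List.all_append, Bool.and_eq_true] at this
  rw [List.all_cons, this.2]
  rfl

variable (br)

theorem altBracket_zero (hsub : ∀ a a', (br (a, 0) (a', 0)).2 = 0) : altBracket br 0 = 0 := by
  refine MultilinearMap.ext fun x => ?_
  have : x = fun i => ofLetter ((![] : Fin 0 → FormLetter 𝕜 A B) i) := Subsingleton.elim _ _
  rw [this, altBracket_ofLetter]
  refine DFinsupp.ext fun n => AlternatingMap.ext fun a => ?_
  rw [ofLetter_bracketLetter_apply, univBracket_of_all_isLeft hsub (by simp), smul_zero]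
  rfl

theorem altBracket_mem (k : ℕ) (d : Fin k → ℤ) (x : Fin k → ⨁ n : ℕ, A [⋀^Fin n]→ₗ[𝕜] B)
    (h : ∀ i, x i ∈ natDeg 𝕜 (fun n => A [⋀^Fin n]→ₗ[𝕜] B) (d i)) :
    altBracket br k x ∈ natDeg 𝕜 (fun n => A [⋀^Fin n]→ₗ[𝕜] B) (∑ i, d i + 2 - k) := by
  rcases exists_ofLetter h with ⟨i, hi⟩ | ⟨s, rfl, rfl⟩
  · rw [MultilinearMap.map_coord_zero _ i hi]
    exact zero_mem _
  · rw [altBracket_ofLetter]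
    intro n hn
    refine AlternatingMap.ext fun a => ?_
    rw [ofLetter_bracketLetter_apply, univBracket_hasDegree, smul_zero]
    · rfl
    · rw [degSum_append, degSum_map_inr]
      simp only [degSum, List.map_ofFn, Function.comp_def, letterDeg_inl, List.sum_ofFn,
        List.length_ofFn, Finset.sum_const, Finset.card_univ, Fintype.card_fin]
      simp only [smul_neg, nsmul_one, formDegree] at hn ⊢
      omega

/-- For neighbouring forms of degrees `d` and `e` the factors `(-1)^{d(e-1)}` and `(-1)^{e(d-1)}`
differ by `(-1)^{d+e}`. This is the discrepancy between skew-symmetry for the degrees and symmetry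
for the degrees lowered by one. -/
theorem twistSign_perm {k : ℕ} (s : Fin k → FormLetter 𝕜 A B) (σ : Equiv.Perm (Fin k)) :
    twistSign (List.ofFn s) = invSign (fun s t => (formDegree s + formDegree t).negOnePow) s σ *
      twistSign (List.ofFn (s ∘ σ)) := by
  have := apply_perm (c := fun s t : FormLetter 𝕜 A B => (formDegree s + formDegree t).negOnePow)
    (f := fun l => ((twistSign l : ℤˣ) : ℤ)) (fun k l s t => ?_) s σ [] []
  · simp only [List.append_nil, List.nil_append] at this
    exact Units.ext (by rw [this, Units.val_mul, Units.smul_def, smul_eq_mul])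
  · rw [Units.smul_def, smul_eq_mul, ← Units.val_mul]
    congr 1
    induction k with
    | nil =>
      simp only [List.nil_append, twistSign_cons, List.map_cons, List.prod_cons]
      have : (formDegree s * (formDegree t - 1)).negOnePow =
          (formDegree s + formDegree t).negOnePow *
          (formDegree t * (formDegree s - 1)).negOnePow := by
        rw [← Int.negOnePow_add, Int.negOnePow_eq_iff]
        exact ⟨-formDegree s, by ring⟩
      rw [this]
      generalize (l.map fun r => (formDegree s * (formDegree r - 1)).negOnePow).prod = a
      generalize (l.map fun r => (formDegree t * (formDegree r - 1)).negOnePow).prod = b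
      ac_rfl
    | cons r k ih =>
      rw [List.cons_append, List.cons_append, twistSign_cons, twistSign_cons, ih,
        (((List.Perm.swap t s l).append_left k).map fun t =>
          (formDegree r * (formDegree t - 1)).negOnePow).prod_eq]
      ac_rfl

theorem invSign_mul {S : Type*} (c c' : S → S → ℤˣ) {n : ℕ} (x : Fin n → S)
    (σ : Equiv.Perm (Fin n)) :
    invSign (fun s t => c s t * c' s t) x σ = invSign c x σ * invSign c' x σ := by
  simp only [invSign, ← Finset.prod_mul_distrib]
  refine Finset.prod_congr rfl fun i _ => Finset.prod_congr rfl fun j _ => ?_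
  split_ifs <;> simp

/-- `univBracket` is symmetric for the shifted degrees; the factor `twistSign` turns this into
skew-symmetry for the original ones. -/
theorem altBracket_perm (k : ℕ) (d : Fin k → ℤ) (x : Fin k → ⨁ n : ℕ, A [⋀^Fin n]→ₗ[𝕜] B)
    (h : ∀ i, x i ∈ natDeg 𝕜 (fun n => A [⋀^Fin n]→ₗ[𝕜] B) (d i)) (σ : Equiv.Perm (Fin k)) :
    altBracket br k x = koszulChi σ d • altBracket br k (x ∘ σ) := by
  rcases exists_ofLetter h with ⟨i, hi⟩ | ⟨s, rfl, rfl⟩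
  · rw [MultilinearMap.map_coord_zero _ i hi, MultilinearMap.map_coord_zero _ (σ.symm i) (by simpa),
      smul_zero]
  · have e : (fun i => ofLetter (s i)) ∘ σ = fun i => ofLetter ((s ∘ σ) i) := rfl
    rw [e, altBracket_ofLetter, altBracket_ofLetter]
    refine DFinsupp.ext fun n => AlternatingMap.ext fun a => ?_
    rw [Units.smul_def, DirectSum.smul_apply, AlternatingMap.smul_apply, ← Units.smul_def,
      ofLetter_bracketLetter_apply, ofLetter_bracketLetter_apply, List.map_ofFn, List.map_ofFn,
      (univBracket_isSymmForm br).perm _ σ, smul_smul, smul_smul, koszulChi_eq_invSign,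
      bracketSign, bracketSign, twistSign_perm s σ]
    have e1 : degSum formDegree (List.ofFn (s ∘ σ)) = degSum formDegree (List.ofFn s) :=
      degSum_perm (Equiv.Perm.ofFn_comp_perm σ s)
    rw [e1, List.length_ofFn, List.length_ofFn]
    have e2 : invSign (koszulFactor letterDeg) (Sum.inr ∘ s : Fin k → Letter 𝕜 A B) σ =
        invSign (fun i j : ℤ => -(i * j).negOnePow) (fun i => formDegree (s i)) σ *
        invSign (fun s t => (formDegree s + formDegree t).negOnePow) s σ := by
      change invSign (fun s t => koszulFactor letterDeg (Sum.inr s : Letter 𝕜 A B) (.inr t)) s σ =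
        invSign (fun s t => -(formDegree s * formDegree t).negOnePow) s σ * _
      rw [← invSign_mul]
      congr 1
      ext s t : 2
      rw [koszulFactor, neg_mul, ← Int.negOnePow_add, ← Int.negOnePow_succ, Int.negOnePow_eq_iff]
      simp only [letterDeg_inr, formDegree]
      exact ⟨-s.1 - t.1, by ring⟩
    rw [e2]
    congr 1
    have := Int.units_mul_self
      (invSign (fun s t : FormLetter 𝕜 A B => (formDegree s + formDegree t).negOnePow) s σ)
    generalize invSign (fun s t : FormLetter 𝕜 A B => (formDegree s + formDegree t).negOnePow) s σ
      = u at this ⊢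
    generalize invSign (fun i j : ℤ => -(i * j).negOnePow) (fun i => formDegree (s i)) σ = v
    calc _ = v * ((k * (degSum formDegree (List.ofFn s) + 1)).negOnePow *
          twistSign (List.ofFn (s ∘ σ))) * (u * u) := by ac_rfl
      _ = _ := by rw [this, mul_one]

theorem prod_negOnePow (d : ℤ) (l : List (FormLetter 𝕜 A B)) :
    (l.map fun t => (d * (formDegree t - 1)).negOnePow).prod =
      (d * (degSum formDegree l - l.length)).negOnePow := by
  induction l with
  | nil => simp
  | cons t l ih =>
    rw [List.map_cons, List.prod_cons, ih, ← Int.negOnePow_add, degSum_cons, List.length_cons]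
    congr 1
    push_cast
    ring

theorem twistSign_append (l m : List (FormLetter 𝕜 A B)) :
    twistSign (l ++ m) = twistSign l * twistSign m *
      (degSum formDegree l * (degSum formDegree m - m.length)).negOnePow := by
  induction l with
  | nil => simp [twistSign]
  | cons t l ih =>
    rw [List.cons_append, twistSign_cons, twistSign_cons, ih, List.map_append, List.prod_append,
      prod_negOnePow _ m, degSum_cons, add_mul, Int.negOnePow_add]
    ac_rfl

/-- Together with the sign `(-1)^i` of the Jacobi rule, the signs of an inner and an outer bracket
combine to a quantity that depends on `l ++ m` only. Apart from `twistSign` it is the same for all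
splittings. -/
theorem bracketSign_bracketSign (s : FormLetter 𝕜 A B) (l m : List (FormLetter 𝕜 A B))
    (h : (s.1 : ℤ) = degSum formDegree l - l.length + 2) :
    (-1) ^ l.length * (bracketSign (s :: m) * bracketSign l) =
      (((l ++ m).length + 1) * (degSum formDegree (l ++ m) + 1)).negOnePow *
        twistSign (l ++ m) := by
  rw [bracketSign, bracketSign, twistSign_cons, prod_negOnePow, twistSign_append, degSum_append,
    List.length_append, List.length_cons, degSum_cons, formDegree, h,
    show ((-1 : ℤˣ) ^ l.length) = (l.length : ℤ).negOnePow from rfl]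
  generalize degSum formDegree l = d
  generalize degSum formDegree m = e
  have : ((l.length : ℤ)).negOnePow * ((((m.length + 1 : ℕ) : ℤ) * (d - l.length + 2 + e + 1)).negOnePow *
      ((d - l.length + 2) * (e - m.length)).negOnePow * (l.length * (d + 1)).negOnePow) =
      ((((l.length + m.length : ℕ) : ℤ) + 1) * (d + e + 1)).negOnePow *
        (d * (e - m.length)).negOnePow := by
    simp only [← Int.negOnePow_add]
    rw [Int.negOnePow_eq_iff]
    push_cast
    exact ⟨m.length - l.length * e + 1 + e - m.length, by ring⟩
  rw [mul_comm (twistSign l * twistSign m), ← mul_assoc _ _ (twistSign l * twistSign m), ← this]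
  ac_rfl

theorem _root_.IsLinearMap.map_units_smul {M N : Type*} [AddCommGroup M] [Module 𝕜 M]
    [AddCommGroup N] [Module 𝕜 N] {f : M → N} (hf : IsLinearMap 𝕜 f) (r : ℤˣ) (x : M) :
    f (r • x) = r • f x := by
  rw [Units.smul_def, Units.smul_def]
  exact map_zsmul (hf.mk' f) r.val x

variable {br}

/-- For nonzero homogeneous entries the double sum over `i` and shuffles is a single `shuffleSum`.
With `shuffleSum_twist` its commutation factor is changed to that of the shifted degrees, and then
`shuffleSum_univBracket` applies. -/
theorem altBracket_jacobi (hself : ∀ x, br x x = 0)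
    (hjac : ∀ x y z, br x (br y z) = br (br x y) z + br y (br x z))
    (hsub : ∀ a a', (br (a, 0) (a', 0)).2 = 0) (n : ℕ) (d : Fin n → ℤ)
    (x : Fin n → ⨁ n : ℕ, A [⋀^Fin n]→ₗ[𝕜] B)
    (h : ∀ i, x i ∈ natDeg 𝕜 (fun n => A [⋀^Fin n]→ₗ[𝕜] B) (d i)) :
    ∑ i : Fin n, ∑ σ ∈ shuffles n (i.val + 1),
      ((-1 : ℤˣ) ^ (i.val + 1) * koszulChi σ d) •
        altBracket br (n - (i.val + 1) + 1)
          (Fin.cons (altBracket br (i.val + 1) (block x σ 0 (i.val + 1) (by omega)))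
            (block x σ (i.val + 1) (n - (i.val + 1)) (by omega))) = 0 := by
  rcases exists_ofLetter h with ⟨j, hj⟩ | ⟨s, rfl, rfl⟩
  · refine Finset.sum_eq_zero fun i _ => Finset.sum_eq_zero fun σ _ => ?_
    rw [smul_eq_zero_of_right]
    by_cases hij : (σ.symm j).val < i.val + 1
    · refine MultilinearMap.map_coord_zero _ 0 ?_
      rw [Fin.cons_zero]
      refine MultilinearMap.map_coord_zero _ ⟨(σ.symm j).val, hij⟩ ?_
      simp [block, hj]
    · refine MultilinearMap.map_coord_zero _ (Fin.succ ⟨(σ.symm j).val - (i.val + 1), by omega⟩) ?_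
      rw [Fin.cons_succ]
      have e : (⟨i.val + 1 + ((σ.symm j).val - (i.val + 1)), by omega⟩ : Fin n) = σ.symm j :=
        Fin.ext (by simp; omega)
      simp [block, e, hj]
  · refine DFinsupp.ext fun N => AlternatingMap.ext fun a => ?_
    let ev : (⨁ n : ℕ, A [⋀^Fin n]→ₗ[𝕜] B) →+ B :=
      { toFun := fun X => X N a, map_zero' := rfl, map_add' := fun _ _ => rfl }
    let F : List (FormLetter 𝕜 A B) → List (FormLetter 𝕜 A B) → B := fun l₁ l₂ =>
      (-1 : ℤˣ) ^ l₁.length • ev (ofLetter (bracketLetter br (bracketLetter br l₁ :: l₂)))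
    -- The inner and outer signs combine so that, over the splittings of one list, only `twistSign
    -- (l₁ ++ l₂)` varies.
    have hF : ∀ l₁ l₂, F l₁ l₂ = (((l₁ ++ l₂).length + 1) *
        (degSum formDegree (l₁ ++ l₂) + 1)).negOnePow • twistSign (l₁ ++ l₂) •
        univBracket br (.inr (univBracketLetter br (l₁.map .inr)) :: (l₂.map .inr ++
          (List.ofFn a).map .inl)) := by
      intro l₁ l₂
      have e1 : ev (ofLetter (bracketLetter br (bracketLetter br l₁ :: l₂))) = _ :=
        ofLetter_bracketLetter_apply br _ N a
      have e2 := (univBracket_isSymmForm br).linear_inr (univBracketLetter br (l₁.map .inr)).1 []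
        (l₂.map .inr ++ List.ofFn fun i => .inl (a i))
      have e3 : univBracket br (.inr (bracketLetter br l₁) ::
            (l₂.map .inr ++ List.ofFn fun i => .inl (a i))) = bracketSign l₁ •
          univBracket br (.inr (univBracketLetter br (l₁.map .inr)) ::
            (l₂.map .inr ++ List.ofFn fun i => .inl (a i))) :=
        e2.map_units_smul (bracketSign l₁) (univBracketLetter br (l₁.map .inr)).2
      simp only [F, e1]
      rw [List.map_cons, List.cons_append, e3, List.map_ofFn]
      change _ = _ • _ • univBracket br (_ :: (_ ++ List.ofFn fun i => .inl (a i)))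
      rcases univBracketLetter_fst br (l₁.map .inr) with h' | h'
      · rw [degSum_map_inr] at h'
        rw [← smul_assoc _ (twistSign (l₁ ++ l₂)), smul_eq_mul,
          ← bracketSign_bracketSign (bracketLetter br l₁) l₁ l₂ h', mul_smul, mul_smul]
      · have e4 := e2.map_zero
        rw [← h'] at e4
        rw [show univBracket br (.inr (univBracketLetter br (l₁.map .inr)) ::
            (l₂.map .inr ++ List.ofFn fun i => .inl (a i))) = 0 from e4]
        simp only [smul_zero]
    change ev _ = 0
    rw [map_sum]
    have hterm : ∀ i : Fin n, ev (∑ σ ∈ shuffles n (i.val + 1),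
        ((-1 : ℤˣ) ^ (i.val + 1) * koszulChi σ fun i => formDegree (s i)) •
        altBracket br (n - (i.val + 1) + 1)
          (Fin.cons (altBracket br (i.val + 1)
            (block (fun i => ofLetter (s i)) σ 0 (i.val + 1) (by omega)))
            (block (fun i => ofLetter (s i)) σ (i.val + 1) (n - (i.val + 1)) (by omega)))) =
        shuffleSum (fun s t => -(formDegree s * formDegree t).negOnePow)
          (fun l₁ l₂ => if l₁.length = i.val + 1 then F l₁ l₂ else 0) (List.ofFn s) := by
      intro i
      rw [← sum_shuffles _ (by omega : i.val + 1 + (n - (i.val + 1)) = n), map_sum]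
      refine Finset.sum_congr rfl fun σ _ => ?_
      have e : Fin.cons (ofLetter (bracketLetter br (List.ofFn (block s σ 0 (i.val + 1) (by omega)))))
          (fun j => ofLetter (block s σ (i.val + 1) (n - (i.val + 1)) (by omega) j)) =
          fun j => ofLetter ((Fin.cons (bracketLetter br (List.ofFn (block s σ 0 (i.val + 1) (by omega))))
            (block s σ (i.val + 1) (n - (i.val + 1)) (by omega)) :
              Fin (n - (i.val + 1) + 1) → FormLetter 𝕜 A B) j) := by
        funext j
        refine Fin.cases rfl (fun j => rfl) j
      have e' := altBracket_ofLetter br (block s σ 0 (i.val + 1) (by omega))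
      have e'' := altBracket_ofLetter br
        (Fin.cons (bracketLetter br (List.ofFn (block s σ 0 (i.val + 1) (by omega))))
            (block s σ (i.val + 1) (n - (i.val + 1)) (by omega)))
      rw [← e, List.ofFn_cons, ← e'] at e''
      simp only [F, List.length_ofFn]
      rw [← e'', koszulChi_eq_invSign, smul_smul, mul_comm, Units.smul_def, Units.smul_def,
        map_zsmul]
      rfl
    rw [Finset.sum_congr rfl fun i _ => hterm i, ← shuffleSum_finset_sum,
      shuffleSum_congr (G := F)]
    rotate_left
    · intro l₁ l₂ hl
      have hlen := hl.length_eq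
      rw [List.length_append, List.length_ofFn] at hlen
      -- The Jacobi rule starts at `i = 1`. The splitting with empty `l₁` can be added, since its
      -- inner bracket is nullary and vanishes.
      rcases Nat.eq_zero_or_pos l₁.length with h0 | h0
      · rw [List.length_eq_zero_iff] at h0
        subst h0
        have : (univBracketLetter br ([] : List (Letter 𝕜 A B))).2 = 0 := by
          ext a
          exact univBracket_of_all_isLeft hsub (by simp)
        rw [hF, List.map_nil]
        have e := ((univBracket_isSymmForm br).linear_inr
          (univBracketLetter br ([] : List (Letter 𝕜 A B))).1 []
          (l₂.map .inr ++ (List.ofFn a).map .inl)).map_zero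
        rw [← this] at e
        rw [List.nil_append] at e
        rw [e]
        simp
      · rw [Finset.sum_eq_single ⟨l₁.length - 1, by omega⟩]
        · rw [if_pos]; simp; omega
        · intro i _ hi
          rw [if_neg]
          intro h'
          exact hi (Fin.ext (by simp; omega))
        · simp
    -- Modulo `2`, `(d - 1)(e - 1)` is `de + 1 + d(e - 1) + e(d - 1)`: the two commutation factors
    -- differ by the coboundary that belongs to `twistSign`.
    have hc : ∀ s t : FormLetter 𝕜 A B, koszulFactor letterDeg (.inr s : Letter 𝕜 A B) (.inr t) =
        -(formDegree s * formDegree t).negOnePow * (formDegree s * (formDegree t - 1)).negOnePow *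
          (formDegree t * (formDegree s - 1)).negOnePow := by
      intro s t
      rw [koszulFactor, neg_mul, neg_mul, ← Int.negOnePow_add, ← Int.negOnePow_add,
        ← Int.negOnePow_succ, Int.negOnePow_eq_iff]
      simp only [letterDeg_inr, formDegree]
      exact ⟨-s.1 * t.1, by ring⟩
    have e4 := shuffleSum_twist hc twistSign twistSign_cons (fun l₁ l₂ =>
        univBracket br (.inr (univBracketLetter br (l₁.map .inr)) :: (l₂.map .inr ++
          (List.ofFn a).map .inl))) (List.ofFn s)
    have e5 := shuffleSum_univBracket hself hjac (univBracketLetter br)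
      (formHat_univBracketLetter br) (fun l => (univBracketLetter_fst br l).imp_left fun h' => by
        rw [h', Int.negOnePow_add, Int.negOnePow_even 2 (by decide), mul_one])
      (List.ofFn s) (List.ofFn a)
    rw [shuffleSum_map] at e5
    rw [e5, smul_zero] at e4
    rw [shuffleSum_congr (G := fun l₁ l₂ => (((List.ofFn s).length + 1) *
        (degSum formDegree (List.ofFn s) + 1)).negOnePow • twistSign (l₁ ++ l₂) •
        univBracket br (.inr (univBracketLetter br (l₁.map .inr)) :: (l₂.map .inr ++
          (List.ofFn a).map .inl))), shuffleSum_units_smul, e4, smul_zero]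
    intro l₁ l₂ hl
    rw [hF, hl.length_eq, degSum_perm hl]

end Jacobi

/-! ### Linearity of the brackets over a ring of functions -/

section Contraction

variable {𝕜 A B : Type*} [Field 𝕜] [AddCommGroup A] [Module 𝕜 A] [AddCommGroup B] [Module 𝕜 B]
  {br : (A × B) →ₗ[𝕜] (A × B) →ₗ[𝕜] (A × B)}

theorem halfSquare_inl [CharZero 𝕜] (hself : ∀ x, br x x = 0) (a : A) (l : List (Letter 𝕜 A B)) :
    halfSquare letterDeg br totalForm (.inl a :: l) =
      wedge letterDeg br (fun l => totalForm (.inl a :: l)) totalForm l := by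
  have hw : HasDegree letterDeg (fun l : List (Letter 𝕜 A B) => totalForm (.inl a :: l)) 0 :=
    fun l hl => totalForm_hasDegree _ (by rw [degSum_cons, letterDeg_inl]; omega)
  have e : wedge letterDeg br totalForm totalForm (.inl a :: l) =
      wedge letterDeg br (fun l => totalForm (.inl a :: l)) totalForm l -
        wedge letterDeg br totalForm (fun l => totalForm (.inl a :: l)) l := by
    rw [wedge, shuffleSum_cons, sub_eq_add_neg, wedge, wedge, ← shuffleSum_neg]
    congr 1
    refine shuffleSum_congr fun l₁ l₂ _ => ?_
    rw [koszulFactor_prod, letterDeg_inl]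
    by_cases h : degSum letterDeg l₁ = -1
    · rw [h, Int.negOnePow_odd _ (by decide), Units.neg_smul, one_smul]
    · rw [totalForm_hasDegree _ h]; simp
  rw [halfSquare, e, wedge_comm br totalForm_hasDegree hw, flip_eq_neg hself]
  have h2 : wedge letterDeg (-br) (fun l => totalForm (.inl a :: l)) totalForm l =
      - wedge letterDeg br (fun l => totalForm (.inl a :: l)) totalForm l := by
    simp [wedge, shuffleSum_neg]
  rw [h2, mul_zero, Int.negOnePow_zero, one_smul, sub_neg_eq_add, ← two_smul 𝕜, smul_smul]
  simp

/-- The element `a` is contracted either with a factor of `½[ℓ, ℓ]`, in the `B`-part and in the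
inserted form, or with the form that receives the insertion. This isolates the dependence on `a`, so
that linearity over `R` can be tested. -/
theorem univBracket_inl [CharZero 𝕜] (hself : ∀ x, br x x = 0) (a : A)
    (l : List (Letter 𝕜 A B)) :
    univBracket br (.inl a :: l) =
      (wedge letterDeg br (fun l => totalForm (.inl a :: l)) totalForm l).2 -
        insertForm letterDeg .inl (fun l =>
          (wedge letterDeg br (fun l => totalForm (.inl a :: l)) totalForm l).1) univForm l +
        insertForm letterDeg .inl (fun l => (halfSquare letterDeg br totalForm l).1)
          (fun l => univForm (.inl a :: l)) l := by
  have hu := halfSquare_totalForm_hasDegree (𝕜 := 𝕜) (A := A) (B := B) br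
  rw [univBracket, curvature, halfSquare_inl hself, sub_add]
  congr 1
  rw [insertForm, shuffleSum_cons, insertForm, insertForm, sub_eq_add_neg, ← shuffleSum_neg]
  congr 1
  · simp only [halfSquare_inl hself]
    rfl
  · refine shuffleSum_congr fun l₁ l₂ _ => ?_
    change _ • univForm _ = _
    have := univForm_isSymmForm.swap [] l₂ (.inl (halfSquare letterDeg br totalForm l₁).1) (.inl a)
    rw [List.nil_append, List.nil_append] at this
    rw [this, koszulFactor_prod, smul_smul, koszulFactor, letterDeg_inl, letterDeg_inl]
    by_cases h : degSum letterDeg l₁ = -2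
    · rw [h, Int.negOnePow_even (-1 * -2) (by decide), Int.negOnePow_odd (-1 * -1) (by decide)]
      simp
    · rw [hu _ h, Prod.fst_zero]
      have h0 : univForm (.inl a :: (.inl 0 : Letter 𝕜 A B) :: l₂) = 0 :=
        (univForm_isSymmForm.linear_inl [.inl a] l₂).map_zero
      rw [h0, smul_zero, neg_zero]

end Contraction

/-! ### Forms that are linear over `R`, and constants from a quotient `D` -/

section Admissible

variable {𝕜 R A D B : Type*} [Field 𝕜] [CommRing R] [AddCommGroup A] [Module 𝕜 A] [Module R A]
  [AddCommGroup D] [Module 𝕜 D] [AddCommGroup B] [Module 𝕜 B] [Module R B]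

variable (R) in
/-- The form `s` is a constant or an `R`-linear form with values in the second factor. -/
def IsAdmissible (s : FormLetter 𝕜 A (D × B)) : Prop :=
  ∀ (a : A) (m : List (Letter 𝕜 A (D × B))), (formHat s.2 (.inl a :: m)).1 = 0 ∧
    ∀ f : R, (formHat s.2 (.inl (f • a) :: m)).2 = f • (formHat s.2 (.inl a :: m)).2

variable (R) in
/-- All the forms in the list `l` are admissible. -/
def AllAdmissible (l : List (Letter 𝕜 A (D × B))) : Prop := ∀ s, .inr s ∈ l → IsAdmissible R s

theorem AllAdmissible.left {l l₁ l₂ : List (Letter 𝕜 A (D × B))} (h : AllAdmissible R l)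
    (hl : (l₁ ++ l₂).Perm l) : AllAdmissible R l₁ :=
  fun s hs => h s (hl.mem_iff.1 (List.mem_append_left _ hs))

theorem AllAdmissible.right {l l₁ l₂ : List (Letter 𝕜 A (D × B))} (h : AllAdmissible R l)
    (hl : (l₁ ++ l₂).Perm l) : AllAdmissible R l₂ :=
  fun s hs => h s (hl.mem_iff.1 (List.mem_append_right _ hs))

theorem AllAdmissible.cons {l : List (Letter 𝕜 A (D × B))} (h : AllAdmissible R l) (a : A) :
    AllAdmissible R (.inl a :: l) := fun s hs => h s (by simpa using hs)

theorem univForm_inl (a : A) (l : List (Letter 𝕜 A B)) :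
    univForm (.inl a :: l) = shuffleSum (koszulFactor letterDeg) (fun l₁ l₂ =>
      (l₁.map (koszulFactor letterDeg (.inl a : Letter 𝕜 A B))).prod •
        univCore l₁ (.inl a :: l₂)) l := by
  rw [univForm, shuffleSum_cons, shuffleSum_eq_zero (F := fun l₁ l₂ => univCore (_ :: l₁) l₂),
    zero_add]
  rintro (_ | ⟨s, l₁⟩) l₂ - <;> rfl

theorem univForm_inl_fst {l : List (Letter 𝕜 A (D × B))} (hl : AllAdmissible R l) (a : A) :
    (univForm (.inl a :: l)).1 = 0 := by
  rw [univForm_inl]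
  change LinearMap.fst 𝕜 D B _ = 0
  rw [map_shuffleSum]
  refine shuffleSum_eq_zero fun l₁ l₂ h => ?_
  match l₁ with
  | [.inr y] => simp [univCore, (hl y (h.mem_iff.1 (by simp)) a l₂).1, Units.smul_def]
  | [] => simp [univCore]
  | [.inl a] => simp [univCore]
  | s :: t :: k => rw [univCore_of_two_le (by simp), smul_zero, map_zero]

theorem univForm_inl_smul {l : List (Letter 𝕜 A (D × B))} (hl : AllAdmissible R l) (f : R) (a : A) :
    (univForm (.inl (f • a) :: l)).2 = f • (univForm (.inl a :: l)).2 := by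
  rw [univForm_inl, univForm_inl]
  change LinearMap.snd 𝕜 D B _ = f • LinearMap.snd 𝕜 D B _
  rw [map_shuffleSum, map_shuffleSum, ← shuffleSum_smul]
  refine shuffleSum_congr fun l₁ l₂ h => ?_
  match l₁ with
  | [.inr y] =>
    simp [univCore, (hl y (h.mem_iff.1 (by simp)) a l₂).2 f, Units.smul_def, koszulFactor,
      smul_comm f]
  | [] => simp [univCore]
  | [.inl a] => simp [univCore]
  | s :: t :: k =>
    rw [univCore_of_two_le (by simp), univCore_of_two_le (by simp)]
    simp only [smul_zero, map_zero]

/-- An admissible form has a `D`-component only as a constant, hence only on the list that consists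
of the form alone. -/
theorem univForm_fst {l : List (Letter 𝕜 A (D × B))} (hl : AllAdmissible R l)
    (h : l.length ≠ 1) : (univForm l).1 = 0 := by
  match l with
  | [] => rfl
  | .inl a :: l => exact univForm_inl_fst (hl.right (l₁ := [.inl a]) (List.Perm.refl _)) a
  | [.inr y] => simp at h
  | .inr y :: .inl a :: m =>
    rw [univForm_inr]
    exact (hl y (by simp) a m).1
  | .inr y :: .inr z :: m =>
    rw [univForm_inr, formHat_inr]
    rfl

variable [CharZero 𝕜] {br : (A × D × B) →ₗ[𝕜] (A × D × B) →ₗ[𝕜] (A × D × B)}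

/-- By `hD` the elements without `D`-component form an ideal. Neither the contraction of `ℓ` with
`a` nor a value of an admissible form with an argument in `A` leaves it. -/
theorem univBracket_inl_fst (hself : ∀ x, br x x = 0)
    (hD : ∀ t t', t.2.1 = 0 → (br t t').2.1 = 0) {l : List (Letter 𝕜 A (D × B))}
    (hl : AllAdmissible R l) (a : A) : (univBracket br (.inl a :: l)).1 = 0 := by
  rw [univBracket_inl hself]
  have h1 : (wedge letterDeg br (fun l => totalForm (.inl a :: l)) totalForm l).2.1 = 0 := by
    change (LinearMap.fst 𝕜 D B).comp (LinearMap.snd 𝕜 A (D × B)) _ = 0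
    rw [wedge, map_shuffleSum]
    exact shuffleSum_eq_zero fun l₁ l₂ h => hD _ _ (univForm_inl_fst (hl.left h) a)
  have h2 : ∀ u : List (Letter 𝕜 A (D × B)) → A,
      (insertForm letterDeg .inl u univForm l).1 = 0 := fun u => by
    change LinearMap.fst 𝕜 D B _ = 0
    rw [insertForm, map_shuffleSum]
    exact shuffleSum_eq_zero fun l₁ l₂ h => univForm_inl_fst (hl.right h) _
  have h3 : ∀ u : List (Letter 𝕜 A (D × B)) → A,
      (insertForm letterDeg .inl u (fun l => univForm (.inl a :: l)) l).1 = 0 := fun u => by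
    change LinearMap.fst 𝕜 D B _ = 0
    rw [insertForm, map_shuffleSum]
    exact shuffleSum_eq_zero fun l₁ l₂ h => univForm_inl_fst ((hl.right h).cons _) _
  rw [Prod.fst_add, Prod.fst_sub, h1, h2, h3, sub_zero, add_zero]

/-- In the quotient `D` a bracket is visible only if both factors `ℓ` have a `D`-component, and each
has one on single letters only. Inserted terms have arguments in `A` and contribute nothing. -/
theorem univBracket_fst (hself : ∀ x, br x x = 0)
    (hD : ∀ t t', t.2.1 = 0 → (br t t').2.1 = 0) {l : List (Letter 𝕜 A (D × B))}
    (hl : AllAdmissible R l) (h : l.length ≠ 2) : (univBracket br l).1 = 0 := by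
  have hD' : ∀ t t', t'.2.1 = 0 → (br t t').2.1 = 0 := fun t t' ht => by
    rw [bracket_skew hself, Prod.snd_neg, Prod.fst_neg, hD _ _ ht, neg_zero]
  rw [univBracket, curvature]
  have h1 : (halfSquare letterDeg br totalForm l).2.1 = 0 := by
    change (LinearMap.fst 𝕜 D B).comp (LinearMap.snd 𝕜 A (D × B))
      ((2⁻¹ : 𝕜) • wedge letterDeg br totalForm totalForm l) = 0
    rw [map_smul, wedge, map_shuffleSum, shuffleSum_eq_zero, smul_zero]
    intro l₁ l₂ hp
    have := hp.length_eq
    rw [List.length_append] at this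
    by_cases h' : l₁.length = 1
    · exact hD' _ _ (univForm_fst (hl.right hp) (by omega))
    · exact hD _ _ (univForm_fst (hl.left hp) h')
  have h2 : ∀ u : List (Letter 𝕜 A (D × B)) → A,
      (insertForm letterDeg .inl u (fun l => (totalForm l).2) l).1 = 0 := fun u => by
    change LinearMap.fst 𝕜 D B _ = 0
    rw [insertForm, map_shuffleSum]
    exact shuffleSum_eq_zero fun l₁ l₂ h => univForm_inl_fst (hl.right h) _
  rw [Prod.fst_sub, h1, h2, sub_zero]

/-- Replacing `a` by `f • a` creates correction terms with the scalars `r(ℓ)`. In the `B`-part the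
correction is the product of `r(ℓ)` with `ι_a X`; in the `A`-part it is `r(ℓ) a`, whose insertion
into `X` gives that same product. The two cancel in the difference that defines the curvature, so
the curvature is linear over `R` although neither summand is. -/
theorem univBracket_inl_smul (hself : ∀ x, br x x = 0)
    (hR : ∀ (f : R) t, ∃ r : R, ∀ a b, (br (f • a, 0, f • b) t).1 = f • (br (a, 0, b) t).1 - r • a ∧
      (br (f • a, 0, f • b) t).2.2 = f • (br (a, 0, b) t).2.2 - r • b)
    {l : List (Letter 𝕜 A (D × B))} (hl : AllAdmissible R l) (f : R) (a : A) :
    (univBracket br (.inl (f • a) :: l)).2 = f • (univBracket br (.inl a :: l)).2 := by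
  choose r hr using hR f
  have htaut : ∀ l : List (Letter 𝕜 A (D × B)),
      tautForm (.inl (f • a) :: l) = f • tautForm (.inl a :: l) := fun l => by
    cases l <;> simp
  have htotal : ∀ (b : A) {l : List (Letter 𝕜 A (D × B))}, AllAdmissible R l →
      totalForm (.inl b :: l) = (tautForm (.inl b :: l), 0, (univForm (.inl b :: l)).2) :=
    fun b l hl => by rw [totalForm, ← univForm_inl_fst hl b]
  have h1 : ∀ {l : List (Letter 𝕜 A (D × B))}, AllAdmissible R l →
      (wedge letterDeg br (fun l => totalForm (.inl (f • a) :: l)) totalForm l).1 =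
        f • (wedge letterDeg br (fun l => totalForm (.inl a :: l)) totalForm l).1 -
          r (totalForm l) • a := by
    intro l hl
    have e : r (totalForm l) • a = shuffleSum (koszulFactor letterDeg) (fun l₁ l₂ =>
        r (totalForm l₂) • tautForm (.inl a :: l₁)) l := by
      rw [shuffleSum_of_left_nil, tautForm_singleton]
      intro l₁ l₂ h
      cases l₁ with
      | nil => exact absurd rfl h
      | cons s l₁ => rw [tautForm_cons_cons, smul_zero]
    change LinearMap.fst 𝕜 A (D × B) _ = f • LinearMap.fst 𝕜 A (D × B) _ - _
    rw [e, wedge, wedge, map_shuffleSum, map_shuffleSum, ← shuffleSum_smul, ← shuffleSum_sub]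
    refine shuffleSum_congr fun l₁ l₂ h => ?_
    rw [htotal _ (hl.left h), htotal _ (hl.left h), htaut, univForm_inl_smul (hl.left h)]
    exact (hr _ _ _).1
  have h2 : (wedge letterDeg br (fun l => totalForm (.inl (f • a) :: l)) totalForm l).2.2 =
        f • (wedge letterDeg br (fun l => totalForm (.inl a :: l)) totalForm l).2.2 -
          shuffleSum (koszulFactor letterDeg) (fun l₁ l₂ =>
            r (totalForm l₂) • (univForm (.inl a :: l₁)).2) l := by
    change (LinearMap.snd 𝕜 D B).comp (LinearMap.snd 𝕜 A (D × B)) _ =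
      f • (LinearMap.snd 𝕜 D B).comp (LinearMap.snd 𝕜 A (D × B)) _ - _
    rw [wedge, wedge, map_shuffleSum, map_shuffleSum, ← shuffleSum_smul, ← shuffleSum_sub]
    refine shuffleSum_congr fun l₁ l₂ h => ?_
    rw [htotal _ (hl.left h), htotal _ (hl.left h), htaut, univForm_inl_smul (hl.left h)]
    exact (hr _ _ _).2
  have h3 : (insertForm letterDeg .inl (fun l =>
        (wedge letterDeg br (fun l => totalForm (.inl (f • a) :: l)) totalForm l).1) univForm l).2 =
      f • (insertForm letterDeg .inl (fun l =>
        (wedge letterDeg br (fun l => totalForm (.inl a :: l)) totalForm l).1) univForm l).2 -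
      shuffleSum (koszulFactor letterDeg) (fun l₁ l₂ =>
            r (totalForm l₁) • (univForm (.inl a :: l₂)).2) l := by
    change LinearMap.snd 𝕜 D B _ = f • LinearMap.snd 𝕜 D B _ - _
    rw [insertForm, insertForm, map_shuffleSum, map_shuffleSum, ← shuffleSum_smul, ← shuffleSum_sub]
    refine shuffleSum_congr fun l₁ l₂ h => ?_
    rw [h1 (hl.left h), (univForm_isLinearMap l₂).map_sub, map_sub]
    exact congrArg₂ (· - ·) (univForm_inl_smul (hl.right h) _ _)
      (univForm_inl_smul (hl.right h) _ _)
  have h4 : (insertForm letterDeg .inl (fun l => (halfSquare letterDeg br totalForm l).1)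
          (fun l => univForm (.inl (f • a) :: l)) l).2 =
      f • (insertForm letterDeg .inl (fun l => (halfSquare letterDeg br totalForm l).1)
          (fun l => univForm (.inl a :: l)) l).2 := by
    change LinearMap.snd 𝕜 D B _ = f • LinearMap.snd 𝕜 D B _
    rw [insertForm, insertForm, map_shuffleSum, map_shuffleSum, ← shuffleSum_smul]
    exact shuffleSum_congr fun l₁ l₂ h => univForm_inl_smul ((hl.right h).cons _) _ _
  -- `ι_a X` has degree zero, so exchanging the two factors costs no sign.
  have h5 : shuffleSum (koszulFactor letterDeg) (fun l₁ l₂ =>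
            r (totalForm l₂) • (univForm (.inl a :: l₁)).2) l =
      shuffleSum (koszulFactor letterDeg) (fun l₁ l₂ =>
            r (totalForm l₁) • (univForm (.inl a :: l₂)).2) l := by
    rw [shuffleSum_comm koszulFactor_comm]
    refine shuffleSum_congr fun l₁ l₂ _ => ?_
    rw [koszulFactor_prod_prod]
    by_cases h : degSum letterDeg l₂ = 0
    · rw [h, mul_zero, Int.negOnePow_zero, one_smul]
    · rw [univForm_hasDegree (.inl a :: l₂) (by rw [degSum_cons, letterDeg_inl]; omega),
        Prod.snd_zero, smul_zero, smul_zero]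
  rw [univBracket_inl hself, univBracket_inl hself, Prod.snd_add, Prod.snd_add, Prod.snd_sub,
    Prod.snd_sub, h2, h3, h4, h5, smul_add, smul_sub]
  abel

/-- The bracket of admissible forms is admissible. -/
theorem isAdmissible_bracketLetter (hself : ∀ x, br x x = 0)
    (hD : ∀ t t', t.2.1 = 0 → (br t t').2.1 = 0)
    (hR : ∀ (f : R) t, ∃ r : R, ∀ a b, (br (f • a, 0, f • b) t).1 = f • (br (a, 0, b) t).1 - r • a ∧
      (br (f • a, 0, f • b) t).2.2 = f • (br (a, 0, b) t).2.2 - r • b)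
    {l : List (FormLetter 𝕜 A (D × B))} (hl : ∀ s ∈ l, IsAdmissible R s) :
    IsAdmissible R (bracketLetter br l) := by
  intro a m
  have key : ∀ a : A, formHat (bracketLetter br l).2 (.inl a :: m) = bracketSign l •
      ((l.map .inr).map (koszulFactor letterDeg (.inl 0 : Letter 𝕜 A (D × B)))).prod •
        if m.all Sum.isLeft then univBracket br (.inl a :: (l.map .inr ++ m)) else 0 := by
    intro a
    have e1 : formHat (bracketLetter br l).2 (.inl a :: m) =
        bracketSign l • formHat (univBracketLetter br (l.map .inr)).2 (.inl a :: m) :=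
      (formHat_isLinearMap _).map_units_smul _ _
    rw [e1, formHat_univBracketLetter, restrictInl]
    congr 1
    simp only [List.all_cons, Sum.isLeft_inl, Bool.true_and]
    split_ifs with h
    · have := apply_move (k := []) (fun l m s t => (univBracket_isSymmForm br).swap l m s t)
        (l.map .inr) m (.inl a)
      rw [List.nil_append, List.nil_append] at this
      rw [this, smul_smul]
      have e : ((l.map .inr).map (koszulFactor letterDeg (.inl a : Letter 𝕜 A (D × B)))).prod =
        ((l.map .inr).map (koszulFactor letterDeg (.inl 0 : Letter 𝕜 A (D × B)))).prod := rfl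
      rw [e, Int.units_mul_self, one_smul]
    · rw [smul_zero]
  have hadm : m.all Sum.isLeft → AllAdmissible R (l.map .inr ++ m) := by
    intro h s hs
    rcases List.mem_append.1 hs with hs | hs
    · obtain ⟨t, ht, e⟩ := List.mem_map.1 hs
      cases e
      exact hl _ ht
    · have := List.all_eq_true.1 h _ hs
      simp at this
  by_cases h : m.all Sum.isLeft
  · have h' := hadm h
    simp only [key, if_pos h]
    refine ⟨?_, fun f => ?_⟩
    · simp [Units.smul_def, univBracket_inl_fst hself hD h' a]
    · simp [Units.smul_def, univBracket_inl_smul hself hR h' f a, smul_comm f]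
  · simp only [key, if_neg h]
    simp

end Admissible

/-! ### The brackets of at most three forms -/

section ExplicitBrackets

variable {𝕜 A B : Type*} [Field 𝕜] [AddCommGroup A] [Module 𝕜 A] [AddCommGroup B] [Module 𝕜 B]

theorem formHat_of_length {k : ℕ} (x : A [⋀^Fin k]→ₗ[𝕜] B) {l : List (Letter 𝕜 A B)}
    (h : l.length ≠ k) : formHat x l = 0 := by
  by_cases hl : l.all Sum.isLeft
  · obtain ⟨a, rfl⟩ := exists_eq_map_inl hl
    refine formHat_of_degSum _ _ fun h' => h ?_
    have e : degSum letterDeg (a.map (Sum.inl : A → Letter 𝕜 A B)) = -a.length := by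
      clear h hl h'
      induction a with
      | nil => rfl
      | cons b a ih => simp [ih]
    rw [e] at h'
    rw [List.length_map]
    omega
  · exact formHat_of_not_all x hl

theorem formHat_inl_zero {k : ℕ} (x : A [⋀^Fin k]→ₗ[𝕜] B) (l : List (Letter 𝕜 A B)) :
    formHat x (.inl 0 :: l) = 0 :=
  (formHat_append_inl_isLinearMap x [] l).map_zero

theorem formHat_inl_inr {k : ℕ} (x : A [⋀^Fin k]→ₗ[𝕜] B) (a : A) (y : FormLetter 𝕜 A B)
    (l : List (Letter 𝕜 A B)) : formHat x (.inl a :: .inr y :: l) = 0 :=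
  formHat_append_inr x y [.inl a] l

theorem univForm_inl_inr (a : A) (y : FormLetter 𝕜 A B) (l : List (Letter 𝕜 A B)) :
    univForm (.inl a :: .inr y :: l) =
      ((y.1 : ℤ) - 1).negOnePow • formHat y.2 (.inl a :: l) := by
  have := univForm_isSymmForm.swap [] l (.inl a) (.inr y)
  rw [List.nil_append, List.nil_append, univForm_inr, koszulFactor, letterDeg_inl, letterDeg_inr,
    neg_one_mul, Int.negOnePow_neg] at this
  exact this

theorem univForm_inl_inr_inr (a : A) (y z : FormLetter 𝕜 A B) (l : List (Letter 𝕜 A B)) :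
    univForm (.inl a :: .inr y :: .inr z :: l) = 0 := by
  rw [univForm_inl_inr, formHat_inl_inr, smul_zero]

theorem totalForm_inr_inr (y z : FormLetter 𝕜 A B) (l : List (Letter 𝕜 A B)) :
    totalForm (.inr y :: .inr z :: l) = 0 := by
  rw [totalForm_inr, formHat_inr]
  rfl

theorem all_left {L l₁ l₂ : List (Letter 𝕜 A B)} (hL : L.all Sum.isLeft) (h : (l₁ ++ l₂).Perm L) :
    l₁.all Sum.isLeft := by
  have := all_isLeft_perm h hL
  rw [List.all_append, Bool.and_eq_true] at this
  exact this.1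

theorem all_right {L l₁ l₂ : List (Letter 𝕜 A B)} (hL : L.all Sum.isLeft)
    (h : (l₁ ++ l₂).Perm L) : l₂.all Sum.isLeft := by
  have := all_isLeft_perm h hL
  rw [List.all_append, Bool.and_eq_true] at this
  exact this.2

theorem totalForm_of_all_isLeft {l : List (Letter 𝕜 A B)} (hl : l.all Sum.isLeft) :
    totalForm l = (tautForm l, 0) := by
  rw [totalForm, univForm_of_all_isLeft hl]

theorem univForm_inl_of_all_isLeft {l : List (Letter 𝕜 A B)} (hl : l.all Sum.isLeft) (a : A) :
    univForm (.inl a :: l) = 0 :=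
  univForm_of_all_isLeft (by rw [List.all_cons, hl]; rfl)

theorem tautForm_hasDegree : HasDegree letterDeg (tautForm : List (Letter 𝕜 A B) → A) (-1) :=
  fun l hl => congrArg Prod.fst (totalForm_hasDegree l hl)

variable (br : (A × B) →ₗ[𝕜] (A × B) →ₗ[𝕜] (A × B))

/-- The sum of the values of `x` with one argument `a` replaced by `pr_A [b, a]`. -/
def formDeriv {k : ℕ} (x : A [⋀^Fin k]→ₗ[𝕜] B) (b : B) (l : List (Letter 𝕜 A B)) : B :=
  shuffleSum (koszulFactor letterDeg)
    (fun l₁ l₂ => formHat x (.inl (br (0, b) (tautForm l₁, 0)).1 :: l₂)) l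

variable {br}

theorem formDeriv_zero {k : ℕ} (x : A [⋀^Fin k]→ₗ[𝕜] B) (l : List (Letter 𝕜 A B)) :
    formDeriv br x 0 l = 0 := by
  refine shuffleSum_eq_zero fun l₁ l₂ _ => ?_
  rw [← Prod.zero_eq_mk, map_zero, LinearMap.zero_apply, Prod.fst_zero, formHat_inl_zero]

/-- The letter selected by `tautForm` is odd; taking it to the front and putting its replacement
back costs the same sign twice. -/
theorem formDeriv_ofFn {k n : ℕ} (x : A [⋀^Fin k]→ₗ[𝕜] B) (b : B) (a : Fin n → A) :
    formDeriv br x b (List.ofFn fun i => .inl (a i)) =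
      ∑ i, formHat x (List.ofFn fun j => .inl (Function.update a i (br (0, b) (a i, 0)).1 j)) := by
  induction n generalizing k with
  | zero =>
    simp only [formDeriv, List.ofFn_zero, shuffleSum_nil, tautForm_nil, Finset.univ_eq_empty,
      Finset.sum_empty]
    rw [← Prod.zero_eq_mk, map_zero, Prod.fst_zero, formHat_inl_zero]
  | succ n ih =>
    rw [formDeriv, List.ofFn_succ, shuffleSum_cons, shuffleSum_of_left_nil, Fin.sum_univ_succ]
    · congr 1
      · simp
      · cases k with
        | zero =>
          rw [shuffleSum_eq_zero, Finset.sum_eq_zero]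
          · intro i _
            rw [List.ofFn_succ, formHat_zero_cons]
          · intro l₁ l₂ _
            rw [formHat_zero_cons, smul_zero]
        | succ k =>
          have e : ∀ i : Fin n, (formHat x (List.ofFn fun j =>
              .inl (Function.update a i.succ (br (0, b) (a i.succ, 0)).1 j))) =
              formHat (x.curryLeft (a 0)) (List.ofFn fun j => .inl
                (Function.update (fun i => a i.succ) i (br (0, b) (a i.succ, 0)).1 j)) := by
            intro i
            rw [List.ofFn_succ, formHat_succ_inl, Function.update_of_ne (Fin.succ_ne_zero i).symm]
            congr 2
            funext j
            by_cases h : j = i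
            · subst h; simp
            · simp [h]
          rw [Finset.sum_congr rfl fun i _ => e i, ← ih, formDeriv]
          refine shuffleSum_congr fun l₁ l₂ _ => ?_
          have := formHat_swap x [] l₂ (.inl (br (0, b) (tautForm l₁, 0)).1) (.inl (a 0))
          rw [List.nil_append, List.nil_append] at this
          rw [this, koszulFactor_prod, koszulFactor, letterDeg_inl, letterDeg_inl, smul_smul,
            formHat_succ_inl]
          by_cases h : degSum letterDeg l₁ = -1
          · rw [h, Int.units_mul_self, one_smul]
          · rw [tautForm_hasDegree _ h, ← Prod.zero_eq_mk, map_zero, Prod.fst_zero,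
              formHat_inl_zero, smul_zero]
    · intro l₁ l₂ h
      cases l₁ with
      | nil => exact absurd rfl h
      | cons s l₁ => rw [tautForm_cons_cons, ← Prod.zero_eq_mk, map_zero, Prod.fst_zero,
          formHat_inl_zero]

variable [CharZero 𝕜]

/-- Order one of the curvature. On elements of `A` the form `ℓ` is tautological, so the bracket part
becomes a covariant derivative, and the insertion part inserts the bracket of two arguments. -/
theorem bracketSign_smul_univBracket_one (hself : ∀ x, br x x = 0) (x : FormLetter 𝕜 A B)
    {L : List (Letter 𝕜 A B)} (hL : L.all Sum.isLeft) :
    bracketSign [x] • univBracket br (.inr x :: L) =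
      shuffleSum (koszulFactor letterDeg) (fun l₁ l₂ =>
        (br (tautForm l₁, 0) (0, formHat x.2 l₂)).2) L -
      shuffleSum (koszulFactor letterDeg) (fun l₁ l₂ =>
        formHat x.2 (.inl (halfSquare letterDeg br totalForm l₁).1 :: l₂)) L := by
  have h1 : bracketPart br (formHat x.2) L = -((x.1 : ℤ).negOnePow •
      shuffleSum (koszulFactor letterDeg) (fun l₁ l₂ =>
        (br (tautForm l₁, 0) (0, formHat x.2 l₂)).2) L) := by
    rw [bracketPart_eq, shuffleSum_comm koszulFactor_comm, ← shuffleSum_units_smul,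
      ← shuffleSum_neg]
    refine shuffleSum_congr fun l₁ l₂ h => ?_
    rw [shuffleSum_eq_zero, sub_zero, totalForm_of_all_isLeft (all_left hL h),
      koszulFactor_prod_prod, bracket_skew hself, Prod.snd_neg, smul_neg]
    · congr 1
      by_cases h1 : degSum letterDeg l₁ = -1
      · by_cases h2 : degSum letterDeg l₂ = -x.1
        · rw [h1, h2, neg_one_mul, neg_neg]
        · rw [formHat_of_degSum _ _ h2, ← Prod.zero_eq_mk, map_zero, Prod.snd_zero, smul_zero,
            smul_zero]
      · rw [tautForm_hasDegree _ h1, ← Prod.zero_eq_mk, map_zero, LinearMap.zero_apply,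
          Prod.snd_zero, smul_zero, smul_zero]
    · intro k₁ k₂ hk
      exact univForm_inl_of_all_isLeft (all_right (all_left hL h) hk) _
  have h2 : bracketSign [x] = -(x.1 : ℤ).negOnePow := by
    rw [bracketSign, ← Int.negOnePow_succ]
    simp [twistSign, formDegree]
  rw [univBracket_inr br hself, h1, h2, smul_add, smul_neg, Units.neg_smul, Units.neg_smul, neg_neg,
    smul_smul, smul_smul, Int.units_mul_self, one_smul, one_smul, sub_eq_add_neg]
  rfl

/-- Order two, with `x` filled in first. Then `y` is either bracketed with `x`, or receives the
`A`-part of the bracket of `x` with an argument, both in `bracketPart`; or `y` is bracketed with an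
argument and the result is inserted into `x`, in `insertPart`. -/
theorem bracketSign_smul_univBracket_two (hself : ∀ x, br x x = 0) (x y : FormLetter 𝕜 A B)
    {L : List (Letter 𝕜 A B)} (hL : L.all Sum.isLeft) :
    bracketSign [x, y] • univBracket br (.inr x :: .inr y :: L) =
      shuffleSum (koszulFactor letterDeg) (fun l₁ l₂ => formDeriv br x.2 (formHat y.2 l₂) l₁) L -
      shuffleSum (koszulFactor letterDeg) (fun l₁ l₂ => formDeriv br y.2 (formHat x.2 l₁) l₂) L +
      shuffleSum (koszulFactor letterDeg) (fun l₁ l₂ =>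
        (br (0, formHat x.2 l₁) (0, formHat y.2 l₂)).2) L := by
  have hx0 : ∀ t : A × B, br (0, 0) t = 0 := fun t => by
    rw [← Prod.zero_eq_mk, map_zero, LinearMap.zero_apply]
  have h1 : bracketPart br (formHat x.2) (.inr y :: L) = bracketSign [x, y] •
      (shuffleSum (koszulFactor letterDeg) (fun l₁ l₂ =>
        (br (0, formHat x.2 l₁) (0, formHat y.2 l₂)).2) L -
      shuffleSum (koszulFactor letterDeg) (fun l₁ l₂ =>
        formDeriv br y.2 (formHat x.2 l₁) l₂) L) := by
    rw [bracketPart_eq, shuffleSum_cons, shuffleSum_eq_zero, zero_add, ← shuffleSum_sub,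
      ← shuffleSum_units_smul]
    · refine shuffleSum_congr fun l₁ l₂ h => ?_
      have e : shuffleSum (koszulFactor letterDeg) (fun k₁ k₂ => univForm
          (.inl (br (0, formHat x.2 l₁) (totalForm k₁)).1 :: k₂)) (.inr y :: l₂) =
          formDeriv br y.2 (formHat x.2 l₁) l₂ := by
        rw [shuffleSum_cons, shuffleSum_eq_zero, zero_add, formDeriv]
        · refine shuffleSum_congr fun k₁ k₂ hk => ?_
          rw [univForm_inl_inr, totalForm_of_all_isLeft (all_left (all_right hL h) hk),
            koszulFactor_prod, letterDeg_inr, smul_smul]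
          by_cases h1 : degSum letterDeg k₁ = -1
          · rw [h1, mul_neg_one, Int.negOnePow_neg, Int.units_mul_self, one_smul]
          · rw [tautForm_hasDegree _ h1, ← Prod.zero_eq_mk, map_zero, Prod.fst_zero,
              formHat_inl_zero, smul_zero]
        · intro k₁ k₂ hk
          exact univForm_inl_of_all_isLeft (all_right (all_right hL h) hk) _
      rw [e, totalForm_inr, koszulFactor_prod, letterDeg_inr]
      by_cases h2 : degSum letterDeg l₁ = -x.1
      · rw [h2]
        congr 1
        simp only [bracketSign, twistSign, List.map_cons, List.map_nil, List.prod_cons,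
          List.prod_nil, mul_one, List.length_cons, List.length_nil, formDegree]
        rw [← Int.negOnePow_add, Int.negOnePow_eq_iff]
        push_cast
        exact ⟨-(y.1 - 1) * x.1 - (degSum formDegree [x, y] + 1), by ring⟩
      · rw [formHat_of_degSum _ _ h2, hx0, formDeriv_zero]
        simp
    · intro l₁ l₂ _
      rw [formHat_inr]
      simp only [hx0, Prod.snd_zero, Prod.fst_zero, zero_sub, neg_eq_zero]
      exact shuffleSum_eq_zero fun k₁ k₂ _ => (univForm_isLinearMap _).map_zero
  have h2 : (x.1 : ℤ).negOnePow • insertPart br (formHat x.2) (.inr y :: L) =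
      bracketSign [x, y] •
      shuffleSum (koszulFactor letterDeg) (fun l₁ l₂ => formDeriv br x.2 (formHat y.2 l₂) l₁) L := by
    rw [insertPart, insertForm, shuffleSum_cons,
      shuffleSum_eq_zero (F := fun l₁ l₂ => _ • formHat x.2 (_ :: .inr y :: l₂)), add_zero]
    · have e : ∀ l₁ l₂ : List (Letter 𝕜 A B), (l₁ ++ l₂).Perm L →
          formHat x.2 (.inl (halfSquare letterDeg br totalForm (.inr y :: l₁)).1 :: l₂) =
          shuffleSum (koszulFactor letterDeg) (fun k₁ k₂ =>
            formHat x.2 (.inl (br (0, formHat y.2 k₁) (tautForm k₂, 0)).1 :: l₂)) l₁ := by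
        intro l₁ l₂ h
        rw [halfSquare_inr br hself, wedge]
        refine (map_shuffleSum (((formHat_append_inl_isLinearMap x.2 [] l₂).mk' _).comp
          (LinearMap.fst 𝕜 A B)) _ _).trans ?_
        refine shuffleSum_congr fun k₁ k₂ hk => ?_
        rw [totalForm_of_all_isLeft (all_right (all_left hL h) hk)]
        rfl
      rw [shuffleSum_congr e, ← shuffleSum_assoc, shuffleSum_comm koszulFactor_comm,
        ← shuffleSum_units_smul, ← shuffleSum_units_smul]
      refine shuffleSum_congr fun l₁ l₂ h => ?_
      rw [koszulFactor_prod_prod]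
      change _ • _ • formDeriv br x.2 (formHat y.2 l₂) l₁ = _
      by_cases h2 : degSum letterDeg l₂ = -y.1
      -- The sign comparison needs the parity of `l₁`; a term in which `l₁` does not have as many
      -- letters as `x` has arguments is zero.
      · by_cases h1 : l₁.length = x.1
        · obtain ⟨a, rfl⟩ := exists_eq_map_inl (all_left hL h)
          have e : degSum letterDeg (a.map (Sum.inl : A → Letter 𝕜 A B)) = -a.length := by
            clear h1 h
            induction a with
            | nil => rfl
            | cons b a ih => simp [ih]
          rw [List.length_map] at h1
          rw [e, h1, h2, smul_smul]
          congr 1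
          simp only [bracketSign, twistSign, List.map_cons, List.map_nil, List.prod_cons,
            List.prod_nil, mul_one, List.length_cons, List.length_nil, formDegree]
          rw [← Int.negOnePow_add, ← Int.negOnePow_add, Int.negOnePow_eq_iff]
          push_cast
          exact ⟨x.1 - (degSum formDegree [x, y] + 1), by ring⟩
        · have : formDeriv br x.2 (formHat y.2 l₂) l₁ = 0 := by
            refine shuffleSum_eq_zero fun k₁ k₂ hk => ?_
            have := hk.length_eq
            rw [List.length_append] at this
            by_cases h3 : k₁.length = 1
            · exact formHat_of_length _ (by rw [List.length_cons]; omega)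
            · rw [show tautForm k₁ = 0 from ?_, ← Prod.zero_eq_mk, map_zero, Prod.fst_zero,
                formHat_inl_zero]
              match k₁ with
              | [] => rfl
              | [s] => simp at h3
              | s :: t :: k => exact tautForm_cons_cons s t k
          simp only [this, smul_zero]
      · rw [formHat_of_degSum _ _ h2, formDeriv_zero]
        simp only [smul_zero]
    · intro l₁ l₂ _
      rw [formHat_inl_inr, smul_zero]
  rw [univBracket_inr br hself, h1, h2, smul_add, smul_smul, smul_smul, Int.units_mul_self,
    one_smul, one_smul]
  abel

end ExplicitBrackets

/-! ### The ternary bracket, and the vanishing of the higher ones -/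

section TernaryBracket

variable {𝕜 A B : Type*} [Field 𝕜] [AddCommGroup A] [Module 𝕜 A] [AddCommGroup B] [Module 𝕜 B]
  {br : (A × B) →ₗ[𝕜] (A × B) →ₗ[𝕜] (A × B)}

theorem br_zero_left (t : A × B) : br (0, 0) t = 0 := by
  rw [← Prod.zero_eq_mk, map_zero, LinearMap.zero_apply]

theorem br_zero_right (t : A × B) : br t (0, 0) = 0 := by
  rw [← Prod.zero_eq_mk, map_zero]

/-- Neither `ℓ` nor the form that receives the insertion takes a second form letter, so exactly one
of `y` and `z` lies in each list. -/
theorem shuffleSum_univForm_inr_inr (b : B) (y z : FormLetter 𝕜 A B) (L : List (Letter 𝕜 A B)) :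
    shuffleSum (koszulFactor letterDeg) (fun l₁ l₂ => univForm
        (.inl (br (0, b) (totalForm l₁)).1 :: l₂)) (.inr y :: .inr z :: L) =
      (((z.1 : ℤ) - 1) * (y.1 + 1)).negOnePow • shuffleSum (koszulFactor letterDeg) (fun l₁ l₂ =>
        formHat z.2 (.inl (br (0, b) (0, formHat y.2 l₁)).1 :: l₂)) L +
      ((z.1 : ℤ) * (y.1 - 1)).negOnePow • shuffleSum (koszulFactor letterDeg) (fun l₁ l₂ =>
        formHat y.2 (.inl (br (0, b) (0, formHat z.2 l₂)).1 :: l₁)) L := by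
  rw [shuffleSum_cons, shuffleSum_cons, shuffleSum_cons, shuffleSum_eq_zero, zero_add,
    shuffleSum_eq_zero (F := fun l₁ l₂ => _ • _ • univForm (_ :: .inr y :: .inr z :: l₂)), add_zero]
  · congr 1
    · rw [← shuffleSum_units_smul]
      refine shuffleSum_congr fun l₁ l₂ _ => ?_
      rw [totalForm_inr, univForm_inl_inr, koszulFactor_prod, letterDeg_inr]
      by_cases h : degSum letterDeg l₁ = -y.1
      · rw [h, smul_smul, ← Int.negOnePow_add]
        congr 1
        rw [Int.negOnePow_eq_iff]
        exact ⟨-(z.1 - 1) * y.1, by ring⟩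
      · rw [formHat_of_degSum _ _ h, br_zero_right, Prod.fst_zero, formHat_inl_zero]
        simp only [smul_zero]
    · rw [shuffleSum_comm koszulFactor_comm, ← shuffleSum_units_smul]
      refine shuffleSum_congr fun l₁ l₂ _ => ?_
      rw [totalForm_inr, univForm_inl_inr, List.map_cons, List.prod_cons, koszulFactor_prod,
        koszulFactor_prod_prod, koszulFactor, letterDeg_inr, letterDeg_inr]
      by_cases h : degSum letterDeg l₂ = -z.1
      · by_cases h' : degSum letterDeg l₁ = -(y.1 - 1)
        · rw [h, h', smul_smul, smul_smul, ← Int.negOnePow_add, ← Int.negOnePow_add,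
            ← Int.negOnePow_add]
          congr 1
          rw [Int.negOnePow_eq_iff]
          exact ⟨0, by ring⟩
        · rw [formHat_of_degSum]
          · simp only [smul_zero]
          · rw [degSum_cons, letterDeg_inl]; omega
      · rw [formHat_of_degSum z.2 _ h, br_zero_right, Prod.fst_zero, formHat_inl_zero]
        simp only [smul_zero]
  · intro l₁ l₂ _
    rw [univForm_inl_inr_inr, smul_zero, smul_zero]
  · intro l₁ l₂ _
    rw [totalForm_inr_inr, map_zero, Prod.fst_zero]
    exact (univForm_isLinearMap _).map_zero

variable [CharZero 𝕜]

theorem bracketSign_three (x y z : FormLetter 𝕜 A B) :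
    bracketSign [x, y, z] = ((x.1 : ℤ) + z.1 + 1 + x.1 * y.1 + x.1 * z.1 + y.1 * z.1).negOnePow := by
  simp only [bracketSign, twistSign, List.map_cons, List.map_nil, List.prod_cons, List.prod_nil,
    mul_one, List.length_cons, List.length_nil, formDegree, degSum_cons, degSum_nil]
  simp only [← Int.negOnePow_add]
  rw [Int.negOnePow_eq_iff]
  push_cast
  exact ⟨y.1 + z.1 + 1, by ring⟩

/-- Order three. Two of the forms are bracketed and the `A`-part of the result is inserted into the
third; the three choices give the three sums. The `B`-part of `½[ℓ, ℓ]` does not contribute, being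
at most quadratic in the forms. -/
theorem bracketSign_smul_univBracket_three (hself : ∀ x, br x x = 0) (x y z : FormLetter 𝕜 A B)
    (L : List (Letter 𝕜 A B)) :
    bracketSign [x, y, z] • univBracket br (.inr x :: .inr y :: .inr z :: L) =
      ((x.1 : ℤ) + y.1 + 1).negOnePow • shuffleSum (koszulFactor letterDeg) (fun l₁ l' =>
        shuffleSum (koszulFactor letterDeg) (fun l₂ l₃ =>
          formHat z.2 (.inl (br (0, formHat x.2 l₁) (0, formHat y.2 l₂)).1 :: l₃)) l') L +
      (x.1 : ℤ).negOnePow • shuffleSum (koszulFactor letterDeg) (fun l₁ l' =>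
        shuffleSum (koszulFactor letterDeg) (fun l₂ l₃ =>
          formHat y.2 (.inl (br (0, formHat x.2 l₁) (0, formHat z.2 l₃)).1 :: l₂)) l') L -
      shuffleSum (koszulFactor letterDeg) (fun l₁ l' =>
        shuffleSum (koszulFactor letterDeg) (fun l₂ l₃ =>
          formHat x.2 (.inl (br (0, formHat y.2 l₂) (0, formHat z.2 l₃)).1 :: l₁)) l') L := by
  set s := bracketSign [x, y, z] with hs
  rw [bracketSign_three] at hs
  have h1 : bracketPart br (formHat x.2) (.inr y :: .inr z :: L) = s •
      (((x.1 : ℤ) + y.1 + 1).negOnePow • shuffleSum (koszulFactor letterDeg) (fun l₁ l' =>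
        shuffleSum (koszulFactor letterDeg) (fun l₂ l₃ =>
          formHat z.2 (.inl (br (0, formHat x.2 l₁) (0, formHat y.2 l₂)).1 :: l₃)) l') L +
      (x.1 : ℤ).negOnePow • shuffleSum (koszulFactor letterDeg) (fun l₁ l' =>
        shuffleSum (koszulFactor letterDeg) (fun l₂ l₃ =>
          formHat y.2 (.inl (br (0, formHat x.2 l₁) (0, formHat z.2 l₃)).1 :: l₂)) l') L) := by
    rw [bracketPart_eq, shuffleSum_cons, shuffleSum_eq_zero, zero_add, shuffleSum_cons,
      shuffleSum_eq_zero, zero_add, ← shuffleSum_units_smul, ← shuffleSum_units_smul,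
      ← shuffleSum_add, ← shuffleSum_units_smul]
    · refine shuffleSum_congr fun l₁ l₂ h => ?_
      rw [shuffleSum_univForm_inr_inr _ y z, totalForm_inr, formHat_inr,
        br_zero_right, Prod.snd_zero, zero_sub, koszulFactor_prod, koszulFactor_prod,
        letterDeg_inr, letterDeg_inr]
      by_cases h1 : degSum letterDeg l₁ = -x.1
      · rw [h1, smul_smul, smul_neg, smul_add, smul_add, smul_smul, smul_smul, smul_smul, smul_smul,
          neg_add, ← Units.neg_smul, ← Units.neg_smul, hs]
        simp only [← Int.negOnePow_add, ← Int.negOnePow_succ]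
        congr 2
        · rw [Int.negOnePow_eq_iff]
          exact ⟨-x.1 * z.1 - x.1 * y.1 - y.1 - 1, by ring⟩
        · rw [Int.negOnePow_eq_iff]
          exact ⟨-x.1 * z.1 - x.1 * y.1 - z.1, by ring⟩
      · rw [formHat_of_degSum x.2 _ h1]
        simp only [br_zero_left, shuffleSum_eq_zero fun _ _ _ => rfl, Prod.fst_zero, formHat_inl_zero]
        simp only [smul_zero, add_zero, neg_zero]
    · intro l₁ l₂ _
      rw [formHat_inr]
      simp only [br_zero_left, Prod.snd_zero, Prod.fst_zero, zero_sub, smul_neg, neg_eq_zero]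
      rw [shuffleSum_eq_zero fun _ _ _ => (univForm_isLinearMap _).map_zero, smul_zero]
    · intro l₁ l₂ _
      rw [formHat_inr]
      simp only [br_zero_left, Prod.snd_zero, Prod.fst_zero, zero_sub, neg_eq_zero]
      exact shuffleSum_eq_zero fun k₁ k₂ _ => (univForm_isLinearMap _).map_zero
  have h2 : (x.1 : ℤ).negOnePow • insertPart br (formHat x.2) (.inr y :: .inr z :: L) = - (s •
      shuffleSum (koszulFactor letterDeg) (fun l₁ l' =>
        shuffleSum (koszulFactor letterDeg) (fun l₂ l₃ =>
          formHat x.2 (.inl (br (0, formHat y.2 l₂) (0, formHat z.2 l₃)).1 :: l₁)) l') L) := by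
    rw [insertPart, insertForm, shuffleSum_cons,
      shuffleSum_eq_zero (F := fun l₁ l₂ => _ • formHat x.2 (_ :: .inr y :: l₂)), add_zero,
      shuffleSum_cons,
      shuffleSum_eq_zero (F := fun l₁ l₂ => _ • formHat x.2 (_ :: .inr z :: l₂)), add_zero]
    · have e : ∀ l₁ l₂ : List (Letter 𝕜 A B), (l₁ ++ l₂).Perm L →
          formHat x.2 (.inl (halfSquare letterDeg br totalForm (.inr y :: .inr z :: l₁)).1 :: l₂) =
          (((z.1 : ℤ) - 1) * y.1).negOnePow • shuffleSum (koszulFactor letterDeg) (fun k₁ k₂ =>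
            formHat x.2 (.inl (br (0, formHat y.2 k₁) (0, formHat z.2 k₂)).1 :: l₂)) l₁ := by
        intro l₁ l₂ h
        rw [halfSquare_inr br hself, wedge, shuffleSum_cons, shuffleSum_eq_zero, zero_add,
          ← shuffleSum_units_smul]
        · refine (map_shuffleSum (((formHat_append_inl_isLinearMap x.2 [] l₂).mk' _).comp
            (LinearMap.fst 𝕜 A B)) _ _).trans ?_
          refine shuffleSum_congr fun k₁ k₂ hk => ?_
          rw [totalForm_inr, koszulFactor_prod, letterDeg_inr]
          have e1 := (((formHat_append_inl_isLinearMap x.2 [] l₂).mk' _).comp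
            (LinearMap.fst 𝕜 A B)).isLinear.map_units_smul
          by_cases h1 : degSum letterDeg k₁ = -y.1
          · rw [e1, h1, mul_neg, Int.negOnePow_neg]
            rfl
          · rw [formHat_of_degSum _ _ h1, br_zero_left, smul_zero, map_zero, Prod.fst_zero,
              formHat_inl_zero, smul_zero]
        · intro k₁ k₂ _
          rw [formHat_inr, br_zero_left]
      rw [shuffleSum_congr e, shuffleSum_units_smul, shuffleSum_comm koszulFactor_comm,
        ← shuffleSum_units_smul, ← shuffleSum_units_smul, ← shuffleSum_units_smul, ← shuffleSum_neg]
      refine shuffleSum_congr fun l₁ l₂ h => ?_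
      rw [koszulFactor_prod_prod]
      simp only [← shuffleSum_units_smul, ← shuffleSum_neg]
      refine shuffleSum_congr fun k₁ k₂ hk => ?_
      by_cases h1 : degSum letterDeg l₁ = -(x.1 - 1)
      · by_cases h2 : degSum letterDeg k₁ = -y.1
        · by_cases h3 : degSum letterDeg k₂ = -z.1
          · have h4 := degSum_perm (deg := letterDeg) hk
            rw [degSum_append, h2, h3] at h4
            rw [h1, ← h4, smul_smul, smul_smul, ← Units.neg_smul, hs]
            simp only [← Int.negOnePow_add, ← Int.negOnePow_succ]
            congr 1
            rw [Int.negOnePow_eq_iff]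
            exact ⟨-y.1 - z.1 - 1, by ring⟩
          · rw [formHat_of_degSum z.2 _ h3, br_zero_right, Prod.fst_zero, formHat_inl_zero]
            simp only [smul_zero, neg_zero]
        · rw [formHat_of_degSum y.2 _ h2, br_zero_left, Prod.fst_zero, formHat_inl_zero]
          simp only [smul_zero, neg_zero]
      · rw [formHat_of_degSum x.2]
        · simp only [smul_zero, neg_zero]
        · rw [degSum_cons, letterDeg_inl]; omega
    · intro l₁ l₂ _
      rw [formHat_inl_inr, smul_zero]
    · intro l₁ l₂ _
      rw [formHat_inl_inr, smul_zero]
  rw [univBracket_inr br hself, h1, h2, smul_add, smul_neg, smul_smul, smul_smul, Int.units_mul_self,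
    one_smul, one_smul]
  abel

theorem univForm_of_two_le_countP {l : List (Letter 𝕜 A B)} (h : 2 ≤ l.countP Sum.isRight) :
    univForm l = 0 := by
  refine shuffleSum_eq_zero fun l₁ l₂ hp => ?_
  have := hp.countP_eq Sum.isRight
  rw [List.countP_append] at this
  match l₁ with
  | [.inr y] =>
    refine formHat_of_not_all y.2 fun h' => ?_
    obtain ⟨a, rfl⟩ := exists_eq_map_inl h'
    simp [List.countP_map, Function.comp_def] at this
    omega
  | [] => rfl
  | [.inl a] => rfl
  | s :: t :: k => exact univCore_of_two_le (by simp) _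

theorem totalForm_of_two_le_countP {l : List (Letter 𝕜 A B)} (h : 2 ≤ l.countP Sum.isRight) :
    totalForm l = 0 := by
  refine Prod.ext (tautForm_of_two_le (h.trans List.countP_le_length)) ?_
  exact univForm_of_two_le_countP h

/-- The curvature is cubic: `ℓ` takes at most one form letter, `½[ℓ, ℓ]` at most two, and the form
that receives the insertion one more. -/
theorem univBracket_of_four_le_countP {l : List (Letter 𝕜 A B)} (h : 4 ≤ l.countP Sum.isRight) :
    univBracket br l = 0 := by
  have h1 : ∀ l : List (Letter 𝕜 A B), 3 ≤ l.countP Sum.isRight →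
      halfSquare letterDeg br totalForm l = 0 := by
    intro l hl
    rw [halfSquare, wedge, shuffleSum_eq_zero, smul_zero]
    intro l₁ l₂ hp
    have := hp.countP_eq Sum.isRight
    rw [List.countP_append] at this
    by_cases h' : 2 ≤ l₁.countP Sum.isRight
    · rw [totalForm_of_two_le_countP h', map_zero, LinearMap.zero_apply]
    · rw [totalForm_of_two_le_countP (l := l₂) (by omega), map_zero]
  rw [univBracket, curvature, h1 l (by omega), Prod.snd_zero, zero_sub, neg_eq_zero]
  refine shuffleSum_eq_zero fun l₁ l₂ hp => ?_
  have := hp.countP_eq Sum.isRight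
  rw [List.countP_append] at this
  by_cases h' : 3 ≤ l₁.countP Sum.isRight
  · change univForm (.inl (halfSquare letterDeg br totalForm l₁).1 :: l₂) = 0
    rw [h1 _ h', Prod.fst_zero]
    exact (univForm_isLinearMap _).map_zero
  · exact univForm_of_two_le_countP (by rw [List.countP_cons]; simp; omega)

end TernaryBracket

/-! ### Sums over splittings of lists of elements of `A` -/

section SplittingSums

variable {𝕜 A B M : Type*} [Field 𝕜] [AddCommGroup A] [Module 𝕜 A] [AddCommGroup B] [Module 𝕜 B]
  [AddCommGroup M]

/-- A list of elements of `A`, as letters. -/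
def inlList {n : ℕ} (a : Fin n → A) : List (Letter 𝕜 A B) := List.ofFn fun i => .inl (a i)

theorem inlList_all {n : ℕ} (a : Fin n → A) :
    (inlList a : List (Letter 𝕜 A B)).all Sum.isLeft := by
  simp [inlList]

theorem inlList_succ {n : ℕ} (a : Fin (n + 1) → A) :
    (inlList a : List (Letter 𝕜 A B)) = .inl (a 0) :: inlList (fun i => a i.succ) :=
  List.ofFn_succ

theorem inlList_cons {n : ℕ} (b : A) (a : Fin n → A) :
    (inlList (Fin.cons b a : Fin (n + 1) → A) : List (Letter 𝕜 A B)) = .inl b :: inlList a := by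
  simp [inlList_succ]

theorem formHat_inlList {k : ℕ} (x : A [⋀^Fin k]→ₗ[𝕜] B) (a : Fin k → A) :
    formHat x (inlList a) = x a := formHat_ofFn x a

theorem invSign_inl {n : ℕ} (a : Fin n → A) (σ : Equiv.Perm (Fin n)) :
    invSign (koszulFactor letterDeg) (fun i => (.inl (a i) : Letter 𝕜 A B)) σ =
      Equiv.Perm.sign σ := by
  rw [← invSign_neg_one _ a]
  simp [invSign, koszulFactor]

/-- Elements of `A` are odd, so the Koszul sign is the sign of the permutation; `hF` selects the one
list length that matches the degree of a form. -/
theorem shuffleSum_inlList {p q n : ℕ} (h : p + q = n) (a : Fin n → A)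
    {F : List (Letter 𝕜 A B) → List (Letter 𝕜 A B) → M}
    (hF : ∀ l₁ l₂, l₁.length ≠ p → F l₁ l₂ = 0) :
    shuffleSum (koszulFactor letterDeg) F (inlList a) = ∑ σ ∈ shuffles n p, Equiv.Perm.sign σ •
      F (inlList (block a σ 0 p (by omega))) (inlList (block a σ p q h.le)) := by
  rw [shuffleSum_congr (G := fun l₁ l₂ => if l₁.length = p then F l₁ l₂ else 0), inlList,
    ← sum_shuffles _ h]
  · exact Finset.sum_congr rfl fun σ _ => by rw [invSign_inl]; rfl
  · intro l₁ l₂ _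
    split_ifs with h1
    · rfl
    · exact hF l₁ l₂ h1

theorem shuffleSum_shuffleSum_inlList {p q r n : ℕ} (h : p + q + r = n) (a : Fin n → A)
    {F : List (Letter 𝕜 A B) → List (Letter 𝕜 A B) → List (Letter 𝕜 A B) → M}
    (hF : ∀ l₁ l₂ l₃, l₁.length ≠ p → F l₁ l₂ l₃ = 0)
    (hF' : ∀ l₁ l₂ l₃, l₂.length ≠ q → F l₁ l₂ l₃ = 0) :
    shuffleSum (koszulFactor letterDeg) (fun l₁ l' =>
      shuffleSum (koszulFactor letterDeg) (fun l₂ l₃ => F l₁ l₂ l₃) l') (inlList a) =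
      ∑ σ ∈ shuffles₃ n p q, Equiv.Perm.sign σ •
        F (inlList (block a σ 0 p (by omega))) (inlList (block a σ p q (by omega)))
          (inlList (block a σ (p + q) r (by omega))) := by
  rw [shuffleSum_congr (G := fun l₁ l' => if l₁.length = p then
    shuffleSum (koszulFactor letterDeg) (fun l₂ l₃ =>
      if l₂.length = q then F l₁ l₂ l₃ else 0) l' else 0), inlList, ← sum_shuffles₃ _ h]
  · exact Finset.sum_congr rfl fun σ _ => by rw [invSign_inl]; rfl
  · intro l₁ l' _
    split_ifs with h1
    · refine shuffleSum_congr fun l₂ l₃ _ => ?_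
      split_ifs with h2
      · rfl
      · exact hF' l₁ l₂ l₃ h2
    · exact shuffleSum_eq_zero fun l₂ l₃ _ => hF l₁ l₂ l₃ h1

/-- `tautForm` picks out one argument, which is odd and collects a factor `-1` for each argument it
passes. -/
theorem shuffleSum_tautForm {n : ℕ} (G : A → List (Letter 𝕜 A B) → M) (hG : ∀ l, G 0 l = 0)
    (a : Fin (n + 1) → A) :
    shuffleSum (koszulFactor letterDeg) (fun l₁ l₂ => G (tautForm l₁) l₂) (inlList a) =
      ∑ i, (-1 : ℤˣ) ^ i.val • G (a i) (inlList (i.removeNth a)) := by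
  have hcons : ∀ (s : Letter 𝕜 A B) (l₁ l₂ : List (Letter 𝕜 A B)), l₁ ≠ [] →
      G (tautForm (s :: l₁)) l₂ = 0 := by
    intro s l₁ l₂ h
    cases l₁ with
    | nil => exact absurd rfl h
    | cons t l₁ => rw [tautForm_cons_cons, hG]
  induction n generalizing G with
  | zero =>
    rw [inlList_succ, shuffleSum_cons, shuffleSum_of_left_nil fun l₁ l₂ h => hcons _ _ _ h,
      Fin.sum_univ_one]
    simp only [inlList, List.ofFn_zero, shuffleSum_nil, tautForm_nil, hG]
    simp
  | succ n ih =>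
    rw [inlList_succ, shuffleSum_cons, shuffleSum_of_left_nil fun l₁ l₂ h => hcons _ _ _ h,
      Fin.sum_univ_succ]
    congr 1
    · simp only [Fin.val_zero, pow_zero, one_smul, tautForm_singleton]
      congr 1
    · have := ih (fun v l => G v (.inl (a 0) :: l)) (fun l => hG _) (fun i => a i.succ) ?_
      · calc _ = - shuffleSum (koszulFactor letterDeg)
              (fun l₁ l₂ => G (tautForm l₁) (.inl (a 0) :: l₂)) (inlList fun i => a i.succ) := by
              rw [← shuffleSum_neg]
              refine shuffleSum_congr fun l₁ l₂ _ => ?_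
              by_cases h : degSum letterDeg l₁ = -1
              · rw [koszulFactor_prod, h, letterDeg_inl, Int.negOnePow_odd _ (by decide),
                  Units.neg_smul, one_smul]
              · rw [tautForm_hasDegree _ h, hG, smul_zero, neg_zero]
          _ = _ := by
              rw [this, ← Finset.sum_neg_distrib]
              refine Finset.sum_congr rfl fun i _ => ?_
              rw [Fin.val_succ, pow_succ, mul_neg_one, Units.neg_smul, ← inlList_cons]
              congr 4
              funext j
              refine Fin.cases ?_ (fun j => ?_) j
              · simp [Fin.removeNth]
              · simp [Fin.removeNth]
      · intro s l₁ l₂ h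
        cases l₁ with
        | nil => exact absurd rfl h
        | cons t l₁ => rw [tautForm_cons_cons, hG]

/-- `H` is nonzero only on pairs. Either the first argument belongs to the pair, and
`shuffleSum_tautForm` runs through its partners, or the pair passes the first argument without a
sign because it is even. -/
theorem shuffleSum_pairs {n : ℕ} (G : A → List (Letter 𝕜 A B) → M) (hG : ∀ l, G 0 l = 0)
    (H : List (Letter 𝕜 A B) → A) (μ : A → A → A) (hμ : ∀ b, μ b 0 = 0) (hH : H [] = 0)
    (hH_cons : ∀ b l, l.all Sum.isLeft → H (.inl b :: l) = μ b (tautForm l))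
    (a : Fin (n + 2) → A) :
    shuffleSum (koszulFactor letterDeg) (fun l₁ l₂ => G (H l₁) l₂) (inlList a) =
      - ∑ j : Fin (n + 2), ∑ i : Fin (n + 1), if i.castSucc < j then
        (-1 : ℤˣ) ^ (i.val + j.val) •
          G (μ (a i.castSucc) (a j)) (inlList (i.removeNth (j.removeNth a))) else 0 := by
  have hdeg : ∀ l : List (Letter 𝕜 A B), l.all Sum.isLeft → degSum letterDeg l ≠ -2 → H l = 0 := by
    intro l hl hd
    cases l with
    | nil => exact hH
    | cons s l =>
      rw [List.all_cons, Bool.and_eq_true] at hl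
      cases s with
      | inr y => simp at hl
      | inl b =>
        rw [hH_cons b l hl.2, tautForm_hasDegree, hμ]
        rw [degSum_cons, letterDeg_inl] at hd
        omega
  have key : ∀ {n : ℕ} (a : Fin (n + 2) → A) (G : A → List (Letter 𝕜 A B) → M)
      (hG : ∀ l, G 0 l = 0), shuffleSum (koszulFactor letterDeg) (fun l₁ l₂ => G (H l₁) l₂)
        (inlList a) = ∑ i : Fin (n + 1), (-1 : ℤˣ) ^ i.val •
          G (μ (a 0) (a i.succ)) (inlList (i.removeNth fun i => a i.succ)) +
        shuffleSum (koszulFactor letterDeg) (fun l₁ l₂ => G (H l₁) (.inl (a 0) :: l₂))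
          (inlList fun i => a i.succ) := by
    intro n a G hG
    rw [inlList_succ, shuffleSum_cons]
    congr 1
    · rw [← shuffleSum_tautForm (fun v l => G (μ (a 0) v) l)]
      · refine shuffleSum_congr fun l₁ l₂ h => ?_
        rw [hH_cons _ _ (all_left (inlList_all _) h)]
      · intro l
        rw [hμ, hG]
    · refine shuffleSum_congr fun l₁ l₂ h => ?_
      by_cases hd : degSum letterDeg l₁ = -2
      · rw [koszulFactor_prod, hd, letterDeg_inl, Int.negOnePow_even _ (by decide), one_smul]
      · rw [hdeg l₁ (all_left (inlList_all _) h) hd, hG, smul_zero]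
  have hrem : ∀ {n : ℕ} (a : Fin (n + 2) → A) (j : Fin (n + 1)),
      (0 : Fin (n + 1)).removeNth (j.succ.removeNth a) = j.removeNth fun i => a i.succ := by
    intro n a j
    funext k
    simp [Fin.removeNth]
  induction n generalizing G with
  | zero =>
    rw [key a G hG, inlList_succ, shuffleSum_cons]
    have h1 : (inlList (fun i : Fin 0 => a i.succ.succ) : List (Letter 𝕜 A B)) = [] := rfl
    have h2 : H [.inl (a 1)] = 0 := by rw [hH_cons _ _ rfl, tautForm_nil, hμ]
    have h3 : H [.inl (a (Fin.succ 0))] = 0 := h2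
    simp only [h1, shuffleSum_nil, h3, hG, hH, smul_zero, add_zero]
    rw [Fin.sum_univ_two, Fin.sum_univ_one, Fin.sum_univ_one, Fin.sum_univ_one]
    have := hrem a 0
    simp [← this]
  | succ n ih =>
    rw [key a G hG, ih (fun v l => G v (.inl (a 0) :: l)) (fun l => hG _), Fin.sum_univ_succ (n := n + 2),
      neg_add]
    rw [Finset.sum_eq_zero (f := fun i : Fin (n + 2) => if i.castSucc < 0 then _ else _), neg_zero,
      zero_add]
    · rw [Finset.sum_congr rfl fun (j : Fin (n + 2)) _ => Fin.sum_univ_succ (n := n + 1) _,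
        Finset.sum_add_distrib, neg_add]
      congr 1
      · rw [← Finset.sum_neg_distrib]
        refine Finset.sum_congr rfl fun j _ => ?_
        rw [if_pos (by simp [Fin.lt_def]), hrem]
        simp [pow_succ]
      · congr 1
        refine Finset.sum_congr rfl fun j _ => Finset.sum_congr rfl fun i _ => ?_
        have h1 : (i.succ.castSucc < j.succ) = (i.castSucc < j) := by
          rw [← Fin.succ_castSucc, Fin.succ_lt_succ_iff]
        simp only [h1]
        split_ifs with h
        · rw [← inlList_cons]
          have e1 : (-1 : ℤˣ) ^ (i.succ.val + j.succ.val) = (-1) ^ (i.val + j.val) := by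
            rw [Fin.val_succ, Fin.val_succ, show i.val + 1 + (j.val + 1) = i.val + j.val + 2 by ring,
              pow_add]
            simp
          have e2 : (Fin.cons (a 0) (i.removeNth (j.removeNth fun i => a i.succ)) :
              Fin (n + 1) → A) = i.succ.removeNth (j.succ.removeNth a) := by
            funext k
            refine Fin.cases ?_ (fun k => ?_) k <;> simp [Fin.removeNth]
          rw [e1, e2]
          rfl
        · rfl
    · intro i _
      rw [if_neg]
      simp

end SplittingSums

/-! ### Restriction of `L_∞` structures to graded subspaces -/

section Pullback

/-- The slots are relaxed from generators to their span one at a time. The generating set may depend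
on the slot, which allows some entries to be kept special. -/
theorem MultilinearMap.map_mem_of_mem_span {𝕜 ι W W' : Type*} [CommRing 𝕜] [Fintype ι]
    [DecidableEq ι] [AddCommGroup W] [Module 𝕜 W] [AddCommGroup W'] [Module 𝕜 W']
    (f : MultilinearMap 𝕜 (fun _ : ι => W) W') (S : ι → Set W) (N : Submodule 𝕜 W')
    (h : ∀ s : ι → W, (∀ i, s i ∈ S i) → f s ∈ N) {x : ι → W}
    (hx : ∀ i, x i ∈ Submodule.span 𝕜 (S i)) : f x ∈ N := by
  have key : ∀ (t : Finset ι) (x : ι → W), (∀ i ∈ t, x i ∈ Submodule.span 𝕜 (S i)) →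
      (∀ i ∉ t, x i ∈ S i) → f x ∈ N := by
    intro t
    induction t using Finset.induction_on with
    | empty => exact fun x _ hx => h x fun i => hx i (by simp)
    | insert j t hj ih =>
      intro x h₁ h₂
      have h3 : ∀ v ∈ Submodule.span 𝕜 (S j), f (Function.update x j v) ∈ N := by
        intro v hv
        induction hv using Submodule.span_induction with
        | mem v hv =>
          refine ih _ (fun i hi => ?_) fun i hi => ?_
          · have hij : i ≠ j := fun e => hj (e ▸ hi)
            rw [Function.update_of_ne hij]
            exact h₁ i (Finset.mem_insert_of_mem hi)
          · by_cases hij : i = j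
            · subst hij
              rwa [Function.update_self]
            · rw [Function.update_of_ne hij]
              exact h₂ i (by simp [hij, hi])
        | zero => rw [f.map_update_zero]; exact N.zero_mem
        | add v w _ _ hv hw => rw [f.map_update_add]; exact N.add_mem hv hw
        | smul c v _ hv => rw [f.map_update_smul]; exact N.smul_mem c hv
      have := h3 (x j) (h₁ j (Finset.mem_insert_self j t))
      rwa [Function.update_eq_self] at this
  exact key Finset.univ x (fun i _ => hx i) fun i hi => absurd (Finset.mem_univ i) hi

variable {𝕜 W W' : Type*} [Field 𝕜] [AddCommGroup W] [Module 𝕜 W] [AddCommGroup W'] [Module 𝕜 W']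
  {𝒱 : ℤ → Submodule 𝕜 W} {𝒱' : ℤ → Submodule 𝕜 W'}

/-- The bracket of a subspace which is closed under it. -/
noncomputable def pullbackBracket {k : ℕ} (f : MultilinearMap 𝕜 (fun _ : Fin k => W) W)
    (ι : W' →ₗ[𝕜] W) (hι : Function.Injective ι)
    (hcl : ∀ x : Fin k → W', f (fun i => ι (x i)) ∈ LinearMap.range ι) :
    MultilinearMap 𝕜 (fun _ : Fin k => W') W' :=
  (LinearEquiv.ofInjective ι hι).symm.toLinearMap.compMultilinearMap
    ((f.compLinearMap fun _ => ι).codRestrict (LinearMap.range ι) hcl)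

theorem pullbackBracket_apply {k : ℕ} (f : MultilinearMap 𝕜 (fun _ : Fin k => W) W)
    (ι : W' →ₗ[𝕜] W) (hι : Function.Injective ι)
    (hcl : ∀ x : Fin k → W', f (fun i => ι (x i)) ∈ LinearMap.range ι) (x : Fin k → W') :
    ι (pullbackBracket f ι hι hcl x) = f fun i => ι (x i) := by
  have := (LinearEquiv.ofInjective ι hι).apply_symm_apply
    ((f.compLinearMap fun _ => ι).codRestrict (LinearMap.range ι) hcl x)
  exact congrArg Subtype.val this

namespace LInfinityAlgebra

/-- An `L_∞` structure restricts to a graded subspace closed under all the brackets. -/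
theorem exists_pullback (𝔤 : LInfinityAlgebra 𝕜 W 𝒱) (ι : W' →ₗ[𝕜] W)
    (hι : Function.Injective ι)
    (hdeg : ∀ i x, ι x ∈ 𝒱 i ↔ x ∈ 𝒱' i) (hint : DirectSum.IsInternal 𝒱')
    (hcl : ∀ k (x : Fin k → W'), 𝔤.bracket k (fun i => ι (x i)) ∈ LinearMap.range ι) :
    ∃ 𝔥 : LInfinityAlgebra 𝕜 W' 𝒱', ∀ k x, ι (𝔥.bracket k x) = 𝔤.bracket k fun i => ι (x i) := by
  refine ⟨{
    isInternal := hint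
    bracket k := pullbackBracket (𝔤.bracket k) ι hι (hcl k)
    bracket_zero := by
      refine MultilinearMap.ext fun x => hι ?_
      rw [pullbackBracket_apply, 𝔤.bracket_zero]
      exact (map_zero ι).symm
    bracket_mem k d x hx := by
      rw [← hdeg, pullbackBracket_apply]
      exact 𝔤.bracket_mem k d _ fun i => (hdeg _ _).2 (hx i)
    bracket_perm k d x hx σ := by
      refine hι ?_
      rw [Units.smul_def, map_zsmul, pullbackBracket_apply, pullbackBracket_apply]
      exact 𝔤.bracket_perm k d _ (fun i => (hdeg _ _).2 (hx i)) σ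
    jacobi n d x hn hx := by
      refine hι ?_
      rw [map_zero, ← 𝔤.jacobi n d (fun i => ι (x i)) hn fun i => (hdeg _ _).2 (hx i), map_sum]
      refine Finset.sum_congr rfl fun i _ => ?_
      rw [map_sum]
      refine Finset.sum_congr rfl fun σ _ => ?_
      rw [Units.smul_def, map_zsmul, pullbackBracket_apply, Units.smul_def]
      congr 2
      funext j
      refine Fin.cases ?_ (fun j => rfl) j
      rw [Fin.cons_zero, Fin.cons_zero, pullbackBracket_apply]
      rfl }, fun k x => pullbackBracket_apply (𝔤.bracket k) ι hι (hcl k) x⟩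

end LInfinityAlgebra

end Pullback

/-- The `L_∞` structure on the sum of the spaces of alternating maps from `A` to `B` which is
defined by a Lie bracket on `A × B` for which `A` is a subalgebra. -/
noncomputable def altLInfinityAlgebra {𝕜 A B : Type*} [Field 𝕜] [CharZero 𝕜] [AddCommGroup A]
    [Module 𝕜 A] [AddCommGroup B] [Module 𝕜 B] (br : (A × B) →ₗ[𝕜] (A × B) →ₗ[𝕜] (A × B))
    (hself : ∀ x, br x x = 0)
    (hjac : ∀ x y z, br x (br y z) = br (br x y) z + br y (br x z))
    (hsub : ∀ a a', (br (a, 0) (a', 0)).2 = 0) :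
    LInfinityAlgebra 𝕜 (⨁ k : ℕ, A [⋀^Fin k]→ₗ[𝕜] B)
      (natDeg 𝕜 fun k => A [⋀^Fin k]→ₗ[𝕜] B) where
  isInternal := DirectSum.isInternal_of_disjoint (natDegCompl 𝕜 _) disjoint_natDeg
    natDeg_le_natDegCompl iSup_natDeg
  bracket k := altBracket br k
  bracket_zero := altBracket_zero br hsub
  bracket_mem k d x h := altBracket_mem br k d x h
  bracket_perm k d x h σ := altBracket_perm br k d x h σ
  jacobi n d x _ h := altBracket_jacobi hself hjac hsub n d x h

/-! ### The grading with an additional summand in degree zero -/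

section NatGrading

variable {𝕜 D : Type*} [Field 𝕜] [AddCommGroup D] [Module 𝕜 D] {E : ℕ → Type*}
  [∀ k, AddCommGroup (E k)] [∀ k, Module 𝕜 (E k)]

theorem natDeg_isInternal : DirectSum.IsInternal (natDeg 𝕜 E) :=
  DirectSum.isInternal_of_disjoint (natDegCompl 𝕜 E) disjoint_natDeg natDeg_le_natDegCompl
    iSup_natDeg

variable (𝕜 D E) in
/-- The grading of the sum of `natDeg 𝕜 E` and of `D` in degree zero. -/
def prodNatDeg (i : ℤ) : Submodule 𝕜 (D × ⨁ k, E k) :=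
  Submodule.prod (if i = 0 then ⊤ else ⊥) (natDeg 𝕜 E i)

theorem prodNatDeg_isInternal : DirectSum.IsInternal (prodNatDeg 𝕜 D E) := by
  refine DirectSum.isInternal_of_disjoint
    (fun i => Submodule.prod (if i = 0 then ⊥ else ⊤) (natDegCompl 𝕜 E i)) (fun i => ?_)
    (fun i j hij => ?_) ?_
  · rw [prodNatDeg, disjoint_iff, Submodule.prod_inf_prod, (disjoint_natDeg i).eq_bot]
    split_ifs <;> simp
  · refine Submodule.prod_mono ?_ (natDeg_le_natDegCompl i j hij)
    by_cases hj : j = 0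
    · rw [if_neg (c := i = 0) (fun h => hij (hj.trans h.symm))]
      exact le_top
    · rw [if_neg hj]
      exact bot_le
  · refine eq_top_iff.2 ?_
    have h1 : LinearMap.range (LinearMap.inl 𝕜 D (⨁ k, E k)) ≤ ⨆ i, prodNatDeg 𝕜 D E i := by
      rintro _ ⟨δ, rfl⟩
      refine Submodule.mem_iSup_of_mem 0 ?_
      rw [prodNatDeg, if_pos rfl]
      exact ⟨trivial, Submodule.zero_mem _⟩
    have h2 : LinearMap.range (LinearMap.inr 𝕜 D (⨁ k, E k)) ≤ ⨆ i, prodNatDeg 𝕜 D E i := by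
      rw [LinearMap.range_eq_map, ← iSup_natDeg, Submodule.map_iSup]
      refine iSup_mono fun i => ?_
      rintro _ ⟨Y, hY, rfl⟩
      exact ⟨Submodule.zero_mem _, hY⟩
    rw [← LinearMap.sup_range_inl_inr]
    exact sup_le h1 h2

end NatGrading

/-! ### The `L_∞` structure of a split Lie pair -/

noncomputable section SplitPair

attribute [local instance] LieRing.ofAssociativeRing

variable {𝕜 R 𝓛 : Type*} [Field 𝕜] [CommRing R] [Algebra 𝕜 R] [AddCommGroup 𝓛]
    [Module 𝕜 𝓛] [Module R 𝓛] [IsScalarTower 𝕜 R 𝓛]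

namespace SplitLiePair

variable {𝓔 : LieRinehart 𝕜 R 𝓛} (P : SplitLiePair 𝓔)

theorem bracket_neg (u v : 𝓛) : 𝓔.bracket u v = -𝓔.bracket v u := by
  have := 𝓔.bracket_self (u + v)
  simp only [map_add, LinearMap.add_apply, 𝓔.bracket_self, zero_add, add_zero] at this
  exact eq_neg_of_add_eq_zero_right this

theorem der_add_apply (δ δ' : 𝓔.der) (u : 𝓛) : (δ + δ').1 u = δ.1 u + δ'.1 u := rfl

theorem der_smul_apply (c : 𝕜) (δ : 𝓔.der) (u : 𝓛) : (c • δ).1 u = c • δ.1 u := rfl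

theorem prA_add_prB (u : 𝓛) : (P.prA u : 𝓛) + P.prB u = u :=
  Submodule.projection_add_projection_eq_self P.isCompl u

theorem prA_coe (a : P.A) : P.prA a = a := Submodule.projectionOnto_apply_left P.isCompl a

theorem prB_coe (b : P.B) : P.prB b = b := Submodule.projectionOnto_apply_left P.isCompl.symm b

theorem prA_coe_B (b : P.B) : P.prA b = 0 := Submodule.projectionOnto_apply_right P.isCompl b

theorem prB_coe_A (a : P.A) : P.prB a = 0 :=
  Submodule.projectionOnto_apply_right P.isCompl.symm a

/-- The underlying element of `𝓛`. -/
def total : (P.A × 𝓔.der × P.B) →ₗ[𝕜] 𝓛 where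
  toFun t := t.1 + t.2.2
  map_add' s t := by simp only [Prod.fst_add, Prod.snd_add, Submodule.coe_add]; abel
  map_smul' c t := by simp

/-- The bracket of the semidirect product of `Der(L)` with `L`, with values in `L`. -/
def semiBracket (t t' : P.A × 𝓔.der × P.B) : 𝓛 :=
  𝓔.bracket (P.total t) (P.total t') + t.2.1.1 (P.total t') - t'.2.1.1 (P.total t)

/-- The Lie algebra `Der(L) ⋉ L`, decomposed as `A ⊕ (Der(L) ⊕ B)`. -/
def semidirect :
    (P.A × 𝓔.der × P.B) →ₗ[𝕜] (P.A × 𝓔.der × P.B) →ₗ[𝕜] (P.A × 𝓔.der × P.B) :=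
  LinearMap.mk₂ 𝕜
    (fun t t' => (P.prA (P.semiBracket t t'), ⁅t.2.1, t'.2.1⁆, P.prB (P.semiBracket t t')))
    (fun s t u => by
      have : P.semiBracket (s + t) u = P.semiBracket s u + P.semiBracket t u := by
        simp only [semiBracket, map_add, Prod.snd_add, Prod.fst_add, LinearMap.add_apply,
          der_add_apply]
        abel
      simp [this])
    (fun c s t => by
      have : P.semiBracket (c • s) t = c • P.semiBracket s t := by
        simp only [semiBracket, map_smul, Prod.smul_snd, Prod.smul_fst, LinearMap.smul_apply,
          der_smul_apply, smul_add, smul_sub]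
      have h := (P.prA.restrictScalars 𝕜).map_smul c (P.semiBracket s t)
      have h' := (P.prB.restrictScalars 𝕜).map_smul c (P.semiBracket s t)
      simp only [LinearMap.coe_restrictScalars] at h h'
      simp [this, h, h'])
    (fun s t u => by
      have : P.semiBracket s (t + u) = P.semiBracket s t + P.semiBracket s u := by
        simp only [semiBracket, map_add, Prod.snd_add, Prod.fst_add, der_add_apply]
        abel
      simp [this])
    (fun c s t => by
      have : P.semiBracket s (c • t) = c • P.semiBracket s t := by
        simp only [semiBracket, map_smul, Prod.smul_snd, Prod.smul_fst, der_smul_apply, smul_add,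
           smul_sub]
      have h := (P.prA.restrictScalars 𝕜).map_smul c (P.semiBracket s t)
      have h' := (P.prB.restrictScalars 𝕜).map_smul c (P.semiBracket s t)
      simp only [LinearMap.coe_restrictScalars] at h h'
      simp [this, h, h'])

theorem semidirect_apply (t t' : P.A × 𝓔.der × P.B) :
    P.semidirect t t' =
      (P.prA (P.semiBracket t t'), ⁅t.2.1, t'.2.1⁆, P.prB (P.semiBracket t t')) := rfl

theorem total_semidirect (t t' : P.A × 𝓔.der × P.B) :
    P.total (P.semidirect t t') = P.semiBracket t t' := P.prA_add_prB _

theorem semidirect_self (t : P.A × 𝓔.der × P.B) : P.semidirect t t = 0 := by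
  have : P.semiBracket t t = 0 := by rw [semiBracket, 𝓔.bracket_self]; abel
  rw [semidirect_apply, this, lie_self, map_zero, map_zero]
  rfl

/-- The components in `A` and `B` come from one identity in `𝓛`. It combines the Jacobi identity of
`𝓔`, the derivation property of the operators and the commutator in `Der(L)`. -/
theorem semidirect_jacobi (x y z : P.A × 𝓔.der × P.B) :
    P.semidirect x (P.semidirect y z) =
      P.semidirect (P.semidirect x y) z + P.semidirect y (P.semidirect x z) := by
  have hder : ∀ (δ : 𝓔.der) u v,
      δ.1 (𝓔.bracket u v) = 𝓔.bracket (δ.1 u) v + 𝓔.bracket u (δ.1 v) := by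
    rintro ⟨δ, s, h⟩ u v
    exact h.map_bracket u v
  have hlie : ∀ (δ δ' : 𝓔.der) u, (⁅δ, δ'⁆ : 𝓔.der).1 u = δ.1 (δ'.1 u) - δ'.1 (δ.1 u) :=
    fun δ δ' u => rfl
  have key : P.semiBracket x (P.semidirect y z) =
      P.semiBracket (P.semidirect x y) z + P.semiBracket y (P.semidirect x z) := by
    rw [semiBracket, semiBracket, semiBracket, total_semidirect, total_semidirect, total_semidirect]
    simp only [semidirect_apply, semiBracket, hlie, map_add, map_sub, hder, LinearMap.add_apply,
      LinearMap.sub_apply]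
    rw [𝓔.jacobi (P.total x) (P.total y), bracket_neg (P.total y) (x.2.1.1 (P.total z)),
      bracket_neg (P.total y) (z.2.1.1 (P.total x)), bracket_neg (x.2.1.1 (P.total z)) (P.total y)]
    abel
  refine Prod.ext ?_ (Prod.ext ?_ ?_)
  · change P.prA _ = P.prA _ + P.prA _
    rw [key, map_add]
  · exact leibniz_lie x.2.1 y.2.1 z.2.1
  · change P.prB _ = P.prB _ + P.prB _
    rw [key, map_add]

theorem semidirect_inl (a a' : P.A) :
    P.semidirect (a, 0) (a', 0) = (P.bracketA a a', 0) := by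
  have : P.semiBracket (a, 0) (a', 0) = P.bracketA a a' := by
    simp [semiBracket, total, bracketA]
  rw [semidirect_apply, this, prA_coe, prB_coe_A]
  simp

theorem semidirect_fst_snd (t t' : P.A × 𝓔.der × P.B) (h : t.2.1 = 0) :
    (P.semidirect t t').2.1 = 0 := by
  rw [semidirect_apply, h, zero_lie]

/-- The bracket with `P.total t` and the operator in `t` both obey a Leibniz rule; `r` adds the
derivatives of `f` by the anchor and by the symbol. What matters is that the same `r` multiplies `a`
and `b` and depends on neither. -/
theorem semidirect_smul (f : R) (t : P.A × 𝓔.der × P.B) : ∃ r : R, ∀ a b,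
    (P.semidirect (f • a, 0, f • b) t).1 = f • (P.semidirect (a, 0, b) t).1 - r • a ∧
    (P.semidirect (f • a, 0, f • b) t).2.2 = f • (P.semidirect (a, 0, b) t).2.2 - r • b := by
  obtain ⟨s, hs⟩ := t.2.1.2
  refine ⟨𝓔.anchor (P.total t) f + s f, fun a b => ?_⟩
  have h1 : P.total (f • a, 0, f • b) = f • ((a : 𝓛) + b) := by simp [total, smul_add]
  have h2 : P.total (a, 0, b) = (a : 𝓛) + b := rfl
  have h3 : P.semiBracket (f • a, 0, f • b) t = f • P.semiBracket (a, 0, b) t -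
      (𝓔.anchor (P.total t) f + s f) • ((a : 𝓛) + b) := by
    rw [semiBracket, semiBracket, h1, h2, bracket_neg, bracket_neg ((a : 𝓛) + b), 𝓔.leibniz,
      hs.map_smul]
    simp only [ZeroMemClass.coe_zero, LinearMap.zero_apply, smul_zero, smul_sub, smul_add, add_smul, smul_neg]
    abel
  rw [semidirect_apply, semidirect_apply, h3]
  constructor
  · simp only [map_sub, map_smul, map_add, prA_coe, prA_coe_B, add_zero]
  · simp only [map_sub, map_smul, map_add, prB_coe, prB_coe_A, zero_add]

/-- Forms as alternating maps over `𝕜` with values in `Der(L) ⊕ B`. -/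
def formIncl (k : ℕ) : P.Form k →ₗ[𝕜] P.A [⋀^Fin k]→ₗ[𝕜] (𝓔.der × P.B) where
  toFun X :=
    { toFun := fun a => (0, X a)
      map_update_add' := fun a i v w => by rw [X.map_update_add]; simp
      map_update_smul' := fun a i c v => by
        rw [← algebraMap_smul R c v, X.map_update_smul, algebraMap_smul]; simp
      map_eq_zero_of_eq' := fun a i j h hij => by rw [X.map_eq_zero_of_eq a h hij]; rfl }
  map_add' X Y := by ext a <;> simp
  map_smul' c X := by ext a <;> simp

/-- The inclusion of `Der(L) ⊕ Ω_A^•(B)` into the sum of the spaces of alternating maps from `A`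
to `Der(L) ⊕ B`. -/
def incl : (𝓔.der × P.Forms) →ₗ[𝕜] ⨁ k : ℕ, P.A [⋀^Fin k]→ₗ[𝕜] (𝓔.der × P.B) :=
  LinearMap.coprod
    (DirectSum.lof 𝕜 ℕ (fun k => P.A [⋀^Fin k]→ₗ[𝕜] (𝓔.der × P.B)) 0 ∘ₗ
      { toFun := fun δ => AlternatingMap.constOfIsEmpty 𝕜 P.A (Fin 0) (δ, 0)
        map_add' := fun δ δ' => by ext <;> simp
        map_smul' := fun c δ => by ext <;> simp })
    (DirectSum.lmap P.formIncl)

/-- The constant with value `(δ, 0)`. -/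
def derLetter (δ : 𝓔.der) : FormLetter 𝕜 P.A (𝓔.der × P.B) :=
  ⟨0, AlternatingMap.constOfIsEmpty 𝕜 P.A (Fin 0) (δ, 0)⟩

/-- A form with values in `Der(L) ⊕ B`. -/
def formLetter {k : ℕ} (X : P.Form k) : FormLetter 𝕜 P.A (𝓔.der × P.B) := ⟨k, P.formIncl k X⟩

theorem incl_der (δ : 𝓔.der) : P.incl (δ, 0) = ofLetter (P.derLetter δ) := by
  rw [incl, LinearMap.coprod_apply, map_zero, add_zero]
  rfl

theorem incl_of {k : ℕ} (X : P.Form k) : P.incl (0, P.of X) = ofLetter (P.formLetter X) := by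
  rw [incl, LinearMap.coprod_apply, map_zero, zero_add]
  exact DirectSum.lmap_lof _ _ _

theorem incl_apply_succ (w : 𝓔.der × P.Forms) (k : ℕ) (a : Fin (k + 1) → P.A) :
    P.incl w (k + 1) a = (0, w.2 (k + 1) a) := by
  rw [incl, LinearMap.coprod_apply, DirectSum.add_apply, LinearMap.comp_apply, DirectSum.lof_eq_of,
    DirectSum.of_eq_of_ne _ _ _ (by simp), zero_add]
  rfl

theorem incl_apply_zero (w : 𝓔.der × P.Forms) (a : Fin 0 → P.A) :
    P.incl w 0 a = (w.1, w.2 0 a) := by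
  rw [incl, LinearMap.coprod_apply, DirectSum.add_apply, LinearMap.comp_apply, DirectSum.lof_eq_of,
    DirectSum.of_eq_same]
  change (w.1, 0) + (0, w.2 0 a) = _
  simp

theorem incl_apply_snd (w : 𝓔.der × P.Forms) (k : ℕ) (a : Fin k → P.A) :
    (P.incl w k a).2 = w.2 k a := by
  cases k with
  | zero => rw [incl_apply_zero]
  | succ k => rw [incl_apply_succ]

theorem incl_injective : Function.Injective P.incl := by
  intro w w' h
  refine Prod.ext ?_ (DFinsupp.ext fun k => AlternatingMap.ext fun a => ?_)
  · have := congrArg (fun X => (X 0 ![]).1) h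
    simpa only [incl_apply_zero] using this
  · rw [← incl_apply_snd, ← incl_apply_snd, h]

theorem incl_mem_natDeg (i : ℤ) (w : 𝓔.der × P.Forms) :
    P.incl w ∈ natDeg 𝕜 (fun k => P.A [⋀^Fin k]→ₗ[𝕜] (𝓔.der × P.B)) i ↔ w ∈ P.sumDeg i := by
  constructor
  · intro h
    refine Submodule.mem_prod.2 ⟨?_, fun k hk => AlternatingMap.ext fun a => ?_⟩
    · split_ifs with hi
      · exact trivial
      · have := congrArg (fun X => (X ![]).1) (h 0 fun h' => hi (by simpa using h'.symm))
        rw [incl_apply_zero] at this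
        exact (Submodule.mem_bot 𝕜).2 this
    · rw [← incl_apply_snd, h k hk]
      rfl
  · intro h k hk
    obtain ⟨h1, h2⟩ := Submodule.mem_prod.1 h
    refine AlternatingMap.ext fun a => ?_
    have h3 : w.2 k a = 0 := by rw [h2 k hk]; rfl
    cases k with
    | succ k => rw [incl_apply_succ, h3]; rfl
    | zero =>
      rw [if_neg (by simpa using hk.symm), Submodule.mem_bot] at h1
      rw [incl_apply_zero, h1, h3]
      rfl

theorem formsDeg_eq (i : ℤ) : P.formsDeg i = natDeg 𝕜 P.Form i :=
  Submodule.ext fun _ => Iff.rfl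

theorem formsDeg_isInternal : DirectSum.IsInternal P.formsDeg := by
  have h : P.formsDeg = natDeg 𝕜 P.Form := funext P.formsDeg_eq
  rw [h]
  exact natDeg_isInternal

theorem sumDeg_isInternal : DirectSum.IsInternal P.sumDeg := by
  have h : P.sumDeg = prodNatDeg 𝕜 𝓔.der P.Form :=
    funext fun i => by rw [sumDeg, formsDeg_eq, prodNatDeg]
  rw [h]
  exact prodNatDeg_isInternal

theorem isAdmissible_derLetter (δ : 𝓔.der) : IsAdmissible R (P.derLetter δ) := by
  intro a m
  simp [derLetter]

theorem formIncl_curryLeft {k : ℕ} (X : P.Form (k + 1)) (a : P.A) :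
    (P.formIncl (k + 1) X).curryLeft a = P.formIncl k (X.curryLeft a) := rfl

theorem formHat_formIncl_fst {k : ℕ} (X : P.Form k)
    (m : List (Letter 𝕜 P.A (𝓔.der × P.B))) : (formHat (P.formIncl k X) m).1 = 0 := by
  induction m generalizing k with
  | nil => cases k <;> rfl
  | cons s m ih =>
    cases k with
    | zero => rw [formHat_zero_cons]; rfl
    | succ k =>
      cases s with
      | inr y => rw [formHat_inr]; rfl
      | inl a => rw [formHat_succ_inl, formIncl_curryLeft, ih]

theorem formHat_formIncl_smul {k : ℕ} (f : R) (X : P.Form k)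
    (m : List (Letter 𝕜 P.A (𝓔.der × P.B))) :
    (formHat (P.formIncl k (f • X)) m).2 = f • (formHat (P.formIncl k X) m).2 := by
  induction m generalizing k with
  | nil =>
    cases k with
    | zero => rfl
    | succ k => rw [formHat_succ_nil, formHat_succ_nil, Prod.snd_zero, smul_zero]
  | cons s m ih =>
    cases k with
    | zero => rw [formHat_zero_cons, formHat_zero_cons, Prod.snd_zero, smul_zero]
    | succ k =>
      cases s with
      | inr y => rw [formHat_inr, formHat_inr, Prod.snd_zero, smul_zero]
      | inl a =>
        rw [formHat_succ_inl, formIncl_curryLeft, formHat_succ_inl, formIncl_curryLeft, ← ih]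
        rfl

theorem isAdmissible_formLetter {k : ℕ} (X : P.Form k) : IsAdmissible R (P.formLetter X) := by
  refine fun a m => ⟨P.formHat_formIncl_fst X _, fun f => ?_⟩
  cases k with
  | zero =>
    change (formHat (P.formIncl 0 X) _).2 = f • (formHat (P.formIncl 0 X) _).2
    rw [formHat_zero_cons, formHat_zero_cons, Prod.snd_zero, smul_zero]
  | succ k =>
    change (formHat (P.formIncl _ X) _).2 = f • (formHat (P.formIncl _ X) _).2
    rw [formHat_succ_inl, formIncl_curryLeft, formHat_succ_inl, formIncl_curryLeft, map_smul,
      formHat_formIncl_smul]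

/-- `IsAdmissible` tests the first argument only; alternation transports the property to slot `i` by
exchanging it with slot `0`. -/
theorem map_update_smul_of_isAdmissible {k : ℕ} {x : P.A [⋀^Fin k]→ₗ[𝕜] (𝓔.der × P.B)}
    (hx : IsAdmissible R ⟨k, x⟩) (a : Fin k → P.A) (i : Fin k) (f : R) (v : P.A) :
    (x (Function.update a i (f • v))).2 = f • (x (Function.update a i v)).2 := by
  cases k with
  | zero => exact i.elim0
  | succ k =>
    have key : ∀ b : Fin (k + 1) → P.A,
        (x (Function.update b 0 (f • v))).2 = f • (x (Function.update b 0 v)).2 := by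
      intro b
      have e : ∀ w, x (Function.update b 0 w) =
          formHat x (.inl w :: List.ofFn fun j => .inl (Fin.tail b j)) := by
        intro w
        rw [← formHat_ofFn, List.ofFn_succ]
        simp [Fin.tail, Function.update_of_ne]
      rw [e, e]
      exact (hx v _).2 f
    have e : ∀ w, x (Function.update a i w) =
        Equiv.Perm.sign (Equiv.swap 0 i) •
          x (Function.update (a ∘ Equiv.swap 0 i) 0 w) := by
      intro w
      have h := x.map_perm (Function.update a i w) (Equiv.swap 0 i)
      rw [Function.update_comp_equiv, Equiv.symm_swap, Equiv.swap_apply_right] at h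
      rw [h, smul_smul, Int.units_mul_self, one_smul]
    rw [e, e, Prod.smul_snd, Prod.smul_snd, key, smul_comm]

/-- The form determined by an admissible alternating map over `𝕜`. -/
def formOfAdmissible {k : ℕ} (x : P.A [⋀^Fin k]→ₗ[𝕜] (𝓔.der × P.B))
    (hx : IsAdmissible R ⟨k, x⟩) : P.Form k where
  toFun a := (x a).2
  map_update_add' a i v w := by
    have h : ∀ [DecidableEq (Fin k)], (x (Function.update a i (v + w))).2 =
        (x (Function.update a i v)).2 + (x (Function.update a i w)).2 := fun {_} => by
      rw [x.map_update_add]; rfl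
    exact h
  map_update_smul' a i f v := by
    convert P.map_update_smul_of_isAdmissible hx a i f v
  map_eq_zero_of_eq' a i j h hij := by rw [x.map_eq_zero_of_eq a h hij]; rfl

/-- In positive degree an admissible form is `R`-multilinear with values in `B`. In degree zero it
splits into an operator from `Der(L)` and an element of `B`. -/
theorem ofLetter_mem_range {s : FormLetter 𝕜 P.A (𝓔.der × P.B)} (hs : IsAdmissible R s) :
    ofLetter s ∈ LinearMap.range P.incl := by
  obtain ⟨k, x⟩ := s
  cases k with
  | zero =>
    refine ⟨((x ![]).1, P.of (P.formOfAdmissible x hs)), ?_⟩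
    have h : (((x ![]).1, P.of (P.formOfAdmissible x hs)) : 𝓔.der × P.Forms) =
        ((x ![]).1, 0) + (0, P.of (P.formOfAdmissible x hs)) := by simp
    rw [h, map_add, incl_der, incl_of]
    refine ((DirectSum.lof 𝕜 ℕ (fun k => P.A [⋀^Fin k]→ₗ[𝕜] (𝓔.der × P.B)) 0).map_add _ _).symm.trans
      (congrArg (DirectSum.lof 𝕜 ℕ _ 0) (AlternatingMap.ext fun a => ?_))
    rw [Subsingleton.elim a ![]]
    change ((x ![]).1, (0 : P.B)) + ((0 : 𝓔.der), (x ![]).2) = x ![]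
    simp
  | succ k =>
    refine ⟨(0, P.of (P.formOfAdmissible x hs)), ?_⟩
    rw [incl_of]
    refine congrArg (DirectSum.lof 𝕜 ℕ _ (k + 1)) (AlternatingMap.ext fun (a : Fin (k + 1) → P.A) => ?_)
    refine Prod.ext ?_ rfl
    change 0 = (x a).1
    rw [← formHat_ofFn, List.ofFn_succ, (hs _ _).1]

end SplitLiePair

end SplitPair

/-! ### Values of the brackets on spanning elements, and vanishing from four entries on -/

section AlternatingBrackets

variable {𝕜 A B : Type*} [Field 𝕜] [AddCommGroup A] [Module 𝕜 A] [AddCommGroup B] [Module 𝕜 B]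
  {br : (A × B) →ₗ[𝕜] (A × B) →ₗ[𝕜] (A × B)}

theorem altBracket_ofLetter_apply [CharZero 𝕜] {k : ℕ} (s : Fin k → FormLetter 𝕜 A B) (n : ℕ) (a : Fin n → A) :
    altBracket br k (fun i => ofLetter (s i)) n a =
      bracketSign (List.ofFn s) • univBracket br ((List.ofFn s).map .inr ++ inlList a) := by
  rw [altBracket_ofLetter, ofLetter_bracketLetter_apply]
  rfl

theorem mem_span_ofLetter (X : ⨁ k : ℕ, A [⋀^Fin k]→ₗ[𝕜] B) :
    X ∈ Submodule.span 𝕜 (Set.range (ofLetter : FormLetter 𝕜 A B → _)) := by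
  induction X using DirectSum.induction_on with
  | zero => exact zero_mem _
  | of k x => exact Submodule.subset_span ⟨⟨k, x⟩, rfl⟩
  | add x y hx hy => exact add_mem hx hy

theorem altBracket_eq_zero [CharZero 𝕜] {k : ℕ} (hk : 4 ≤ k) : altBracket br k = 0 := by
  refine MultilinearMap.ext fun x => (Submodule.mem_bot 𝕜).1 ?_
  refine MultilinearMap.map_mem_of_mem_span _ (fun _ => Set.range ofLetter) ⊥ (fun v hv => ?_)
    fun i => mem_span_ofLetter (x i)
  choose s hs using hv
  obtain rfl : (fun i => ofLetter (s i)) = v := funext hs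
  refine DFinsupp.ext fun n => AlternatingMap.ext fun a => ?_
  rw [altBracket_ofLetter_apply, univBracket_of_four_le_countP, smul_zero]
  · rfl
  · rw [List.countP_append, List.countP_map]
    have : List.countP (Sum.isRight ∘ (Sum.inr : FormLetter 𝕜 A B → Letter 𝕜 A B)) (List.ofFn s) =
        (List.ofFn s).length := List.countP_eq_length.2 fun _ _ => rfl
    rw [this, List.length_ofFn]
    omega

end AlternatingBrackets

/-! ### The two `L_∞` structures, by restriction to admissible forms -/

noncomputable section SplitPair

attribute [local instance] LieRing.ofAssociativeRing

variable {𝕜 R 𝓛 : Type*} [Field 𝕜] [CommRing R] [Algebra 𝕜 R] [AddCommGroup 𝓛]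
    [Module 𝕜 𝓛] [Module R 𝓛] [IsScalarTower 𝕜 R 𝓛]

namespace SplitLiePair

variable {𝓔 : LieRinehart 𝕜 R 𝓛} (P : SplitLiePair 𝓔)

theorem incl_mem_span (w : 𝓔.der × P.Forms) : P.incl w ∈ Submodule.span 𝕜
    {v | ∃ s : FormLetter 𝕜 P.A (𝓔.der × P.B), IsAdmissible R s ∧ ofLetter s = v} := by
  obtain ⟨δ, X⟩ := w
  have h : ((δ, X) : 𝓔.der × P.Forms) = (δ, 0) + (0, X) := by simp
  rw [h, map_add]
  refine add_mem (Submodule.subset_span ⟨_, P.isAdmissible_derLetter δ, (P.incl_der δ).symm⟩) ?_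
  induction X using DirectSum.induction_on with
  | zero => rw [← Prod.zero_eq_mk, map_zero]; exact zero_mem _
  | of k x =>
    exact Submodule.subset_span ⟨_, P.isAdmissible_formLetter x, (P.incl_of x).symm⟩
  | add x y hx hy =>
    have h : ((0, x + y) : 𝓔.der × P.Forms) = (0, x) + (0, y) := by simp
    rw [h, map_add]
    exact add_mem (hx (by simp)) (hy (by simp))

theorem semidirect_inl_snd (a a' : P.A) : (P.semidirect (a, 0) (a', 0)).2 = 0 := by
  rw [semidirect_inl]

theorem formHat_nil_fst (x : FormLetter 𝕜 P.A (𝓔.der × P.B)) :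
    (formHat x.2 []).1 = (ofLetter x 0 ![]).1 := by
  obtain ⟨k, x⟩ := x
  cases k with
  | zero => rw [formHat_zero_nil, ofLetter, DirectSum.lof_apply]
  | succ k =>
    rw [formHat_succ_nil, ofLetter, DirectSum.lof_eq_of, DirectSum.of_eq_of_ne _ _ _ (by simp)]
    rfl

theorem inr_mem_sumDeg (i : ℤ) (X : P.Forms) :
    LinearMap.inr 𝕜 𝓔.der P.Forms X ∈ P.sumDeg i ↔ X ∈ P.formsDeg i := by
  simp [sumDeg]

variable [CharZero 𝕜]

/-- Admissible forms span the image of `P.incl`, and by `isAdmissible_bracketLetter` their brackets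
are admissible, hence again in the image. -/
theorem altBracket_incl_mem_range (k : ℕ) (w : Fin k → 𝓔.der × P.Forms) :
    altBracket P.semidirect k (fun i => P.incl (w i)) ∈ LinearMap.range P.incl := by
  refine MultilinearMap.map_mem_of_mem_span _
    (fun _ => {v | ∃ s : FormLetter 𝕜 P.A (𝓔.der × P.B), IsAdmissible R s ∧ ofLetter s = v}) _
    (fun v hv => ?_) fun i => P.incl_mem_span (w i)
  choose s hs hv using hv
  obtain rfl : (fun i => ofLetter (s i)) = v := funext hv
  rw [altBracket_ofLetter]
  refine P.ofLetter_mem_range (isAdmissible_bracketLetter P.semidirect_self P.semidirect_fst_snd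
    P.semidirect_smul fun t ht => ?_)
  obtain ⟨i, rfl⟩ := List.mem_ofFn.1 ht
  exact hs i

theorem exists_extension : ∃ 𝔥 : LInfinityAlgebra 𝕜 (𝓔.der × P.Forms) P.sumDeg,
    ∀ k w, P.incl (𝔥.bracket k w) = altBracket P.semidirect k fun i => P.incl (w i) := by
  have h := @LInfinityAlgebra.exists_pullback 𝕜 (⨁ k : ℕ, P.A [⋀^Fin k]→ₗ[𝕜] (𝓔.der × P.B))
    (𝓔.der × P.Forms) _ _ _ _ _ (natDeg 𝕜 _) P.sumDeg
    (altLInfinityAlgebra P.semidirect P.semidirect_self P.semidirect_jacobi P.semidirect_inl_snd)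
    P.incl
  exact h P.incl_injective P.incl_mem_natDeg P.sumDeg_isInternal P.altBracket_incl_mem_range

/-- The `L_∞` structure on `Der(L) ⊕ Ω_A^•(B)`. -/
def extension : LInfinityAlgebra 𝕜 (𝓔.der × P.Forms) P.sumDeg := P.exists_extension.choose

theorem incl_extension (k : ℕ) (w : Fin k → 𝓔.der × P.Forms) :
    P.incl (P.extension.bracket k w) = altBracket P.semidirect k fun i => P.incl (w i) :=
  P.exists_extension.choose_spec k w

theorem extension_fst (k : ℕ) (w : Fin k → 𝓔.der × P.Forms) :
    (P.extension.bracket k w).1 =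
      (altBracket P.semidirect k (fun i => P.incl (w i)) 0 ![]).1 := by
  rw [← incl_extension, incl_apply_zero]

theorem extension_snd (k : ℕ) (w : Fin k → 𝓔.der × P.Forms) (n : ℕ) (a : Fin n → P.A) :
    (P.extension.bracket k w).2 n a =
      (altBracket P.semidirect k (fun i => P.incl (w i)) n a).2 := by
  rw [← incl_extension, incl_apply_snd]

theorem extension_isLThree : P.extension.IsLThree := by
  refine fun k hk => MultilinearMap.ext fun w => P.incl_injective ?_
  rw [incl_extension, altBracket_eq_zero hk]
  exact (map_zero P.incl).symm

/-- The value in `Der(L)` of the part of degree zero. -/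
def derPart : (⨁ k : ℕ, P.A [⋀^Fin k]→ₗ[𝕜] (𝓔.der × P.B)) →ₗ[𝕜] 𝓔.der where
  toFun X := (X 0 ![]).1
  map_add' _ _ := rfl
  map_smul' _ _ := rfl

/-- The component in `Der(L)` is read off without arguments, so `univBracket_fst` applies to a list
of exactly `k` letters. -/
theorem extension_fst_of_ne_two (k : ℕ) (w : Fin k → 𝓔.der × P.Forms) (hk : k ≠ 2) :
    (P.extension.bracket k w).1 = 0 := by
  rw [extension_fst]
  change altBracket P.semidirect k (fun i => P.incl (w i)) ∈ LinearMap.ker P.derPart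
  refine MultilinearMap.map_mem_of_mem_span _
    (fun _ => {v | ∃ s : FormLetter 𝕜 P.A (𝓔.der × P.B), IsAdmissible R s ∧ ofLetter s = v}) _
    (fun v hv => ?_) fun i => P.incl_mem_span (w i)
  choose s hs hv using hv
  obtain rfl : (fun i => ofLetter (s i)) = v := funext hv
  change (altBracket P.semidirect k (fun i => ofLetter (s i)) 0 ![]).1 = 0
  rw [altBracket_ofLetter_apply, Prod.smul_fst,
    univBracket_fst (R := R) P.semidirect_self P.semidirect_fst_snd, smul_zero]
  · intro t ht
    simp only [inlList, List.ofFn_zero, List.append_nil, List.mem_map, Sum.inr.injEq,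
      exists_eq_right] at ht
    obtain ⟨i, rfl⟩ := List.mem_ofFn.1 ht
    exact hs i
  · simpa [inlList] using hk

/-- Without arguments the two derivation sums of the binary bracket are empty, and only the bracket
of the values remains. -/
theorem altBracket_two_apply_zero (x y : FormLetter 𝕜 P.A (𝓔.der × P.B)) :
    altBracket P.semidirect 2 ![ofLetter x, ofLetter y] 0 ![] =
      (P.semidirect (0, formHat x.2 []) (0, formHat y.2 [])).2 := by
  have h : ![ofLetter x, ofLetter y] = fun i => ofLetter (![x, y] i) := by
    funext i; fin_cases i <;> rfl
  have hnil : (inlList ![] : List (Letter 𝕜 P.A (𝓔.der × P.B))) = [] := rfl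
  have hd : ∀ (z : FormLetter 𝕜 P.A (𝓔.der × P.B)) b, formDeriv P.semidirect z.2 b [] = 0 :=
    fun z b => by
      have := formDeriv_ofFn (br := P.semidirect) z.2 b ![]
      simpa using this
  rw [h, altBracket_ofLetter_apply, hnil]
  change bracketSign [x, y] • univBracket P.semidirect (.inr x :: .inr y :: []) = _
  rw [bracketSign_smul_univBracket_two P.semidirect_self x y rfl, shuffleSum_nil, shuffleSum_nil,
    shuffleSum_nil, hd, hd, sub_zero, zero_add]

theorem altBracket_two_derPart (X Y : ⨁ k : ℕ, P.A [⋀^Fin k]→ₗ[𝕜] (𝓔.der × P.B)) :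
    P.derPart (altBracket P.semidirect 2 ![X, Y]) = ⁅P.derPart X, P.derPart Y⁆ := by
  have hu : ∀ X Y Z : ⨁ k : ℕ, P.A [⋀^Fin k]→ₗ[𝕜] (𝓔.der × P.B),
      Function.update ![X, Y] 0 Z = ![Z, Y] := fun X Y Z => by funext i; fin_cases i <;> rfl
  have hu' : ∀ X Y Z : ⨁ k : ℕ, P.A [⋀^Fin k]→ₗ[𝕜] (𝓔.der × P.B),
      Function.update ![X, Y] 1 Z = ![X, Z] := fun X Y Z => by funext i; fin_cases i <;> rfl
  have hadd : ∀ X X' Y, altBracket P.semidirect 2 ![X + X', Y] =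
      altBracket P.semidirect 2 ![X, Y] + altBracket P.semidirect 2 ![X', Y] := fun X X' Y => by
    have := (altBracket P.semidirect 2).map_update_add ![X, Y] 0 X X'
    rwa [hu, hu, hu] at this
  have hadd' : ∀ X Y Y', altBracket P.semidirect 2 ![X, Y + Y'] =
      altBracket P.semidirect 2 ![X, Y] + altBracket P.semidirect 2 ![X, Y'] := fun X Y Y' => by
    have := (altBracket P.semidirect 2).map_update_add ![X, Y] 1 Y Y'
    rwa [hu', hu', hu'] at this
  have hzero : ∀ Y, altBracket P.semidirect 2 ![0, Y] = 0 := fun Y =>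
    (altBracket P.semidirect 2).map_coord_zero 0 rfl
  have hzero' : ∀ X, altBracket P.semidirect 2 ![X, 0] = 0 := fun X =>
    (altBracket P.semidirect 2).map_coord_zero 1 rfl
  induction X using DirectSum.induction_on with
  | zero => rw [hzero, map_zero, zero_lie]
  | add X X' hX hX' => rw [hadd, map_add, hX, hX', map_add, add_lie]
  | of p x =>
    induction Y using DirectSum.induction_on with
    | zero => rw [hzero', map_zero, lie_zero]
    | add Y Y' hY hY' => rw [hadd', map_add, hY, hY', map_add, lie_add]
    | of q y =>
      change (altBracket P.semidirect 2 ![ofLetter ⟨p, x⟩, ofLetter ⟨q, y⟩] 0 ![]).1 =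
        ⁅(ofLetter ⟨p, x⟩ 0 ![]).1, (ofLetter ⟨q, y⟩ 0 ![]).1⁆
      rw [altBracket_two_apply_zero, ← formHat_nil_fst, ← formHat_nil_fst]
      rfl

theorem extension_two_fst (w : Fin 2 → 𝓔.der × P.Forms) :
    (P.extension.bracket 2 w).1 = ⁅(w 0).1, (w 1).1⁆ := by
  have h : (fun i => P.incl (w i)) = ![P.incl (w 0), P.incl (w 1)] := by
    funext i; fin_cases i <;> rfl
  have h1 : ∀ w, P.derPart (P.incl w) = w.1 := fun w => by
    change (P.incl w 0 ![]).1 = _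
    rw [incl_apply_zero]
  rw [extension_fst, h, ← h1, ← h1]
  exact P.altBracket_two_derPart _ _

/-- The component in `Der(L)` is zero for `k ≠ 2`, and for `k = 2` it is a commutator of zeros. -/
theorem extension_inr_mem_range (k : ℕ) (X : Fin k → P.Forms) :
    P.extension.bracket k (fun i => LinearMap.inr 𝕜 𝓔.der P.Forms (X i)) ∈
      LinearMap.range (LinearMap.inr 𝕜 𝓔.der P.Forms) := by
  refine ⟨(P.extension.bracket k fun i => LinearMap.inr 𝕜 𝓔.der P.Forms (X i)).2,
    Prod.ext ?_ rfl⟩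
  by_cases hk : k = 2
  · subst hk
    rw [extension_two_fst]
    simp
  · rw [extension_fst_of_ne_two _ _ _ hk]
    rfl

theorem exists_formsAlgebra : ∃ 𝔤 : LInfinityAlgebra 𝕜 P.Forms P.formsDeg, ∀ k X,
    LinearMap.inr 𝕜 𝓔.der P.Forms (𝔤.bracket k X) =
      P.extension.bracket k fun i => LinearMap.inr 𝕜 𝓔.der P.Forms (X i) := by
  have h := @LInfinityAlgebra.exists_pullback 𝕜 (𝓔.der × P.Forms) P.Forms _ _ _ _ _ P.sumDeg
    P.formsDeg P.extension (LinearMap.inr 𝕜 𝓔.der P.Forms)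
  exact h LinearMap.inr_injective P.inr_mem_sumDeg P.formsDeg_isInternal
    P.extension_inr_mem_range

/-- The `L_∞` structure on `Ω_A^•(B)`. -/
def formsAlgebra : LInfinityAlgebra 𝕜 P.Forms P.formsDeg := P.exists_formsAlgebra.choose

theorem extension_inr (k : ℕ) (X : Fin k → P.Forms) :
    P.extension.bracket k (fun i => (0, X i)) = (0, P.formsAlgebra.bracket k X) :=
  (P.exists_formsAlgebra.choose_spec k X).symm

theorem formsAlgebra_isLThree : P.formsAlgebra.IsLThree := by
  refine fun k hk => MultilinearMap.ext fun X => ?_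
  have := P.extension_inr k X
  rw [P.extension_isLThree k hk] at this
  exact (congrArg Prod.snd this).symm

end SplitLiePair

end SplitPair

/-! ### Derivation sums and `½[ℓ, ℓ]` on elements of `A` -/

section AlternatingBrackets

variable {𝕜 A B : Type*} [Field 𝕜] [AddCommGroup A] [Module 𝕜 A] [AddCommGroup B] [Module 𝕜 B]
  {br : (A × B) →ₗ[𝕜] (A × B) →ₗ[𝕜] (A × B)}

theorem formDeriv_of_length {k : ℕ} (x : A [⋀^Fin k]→ₗ[𝕜] B) (b : B) {l : List (Letter 𝕜 A B)}
    (h : l.length ≠ k) : formDeriv br x b l = 0 := by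
  refine shuffleSum_eq_zero fun l₁ l₂ hp => ?_
  have hlen := hp.length_eq
  rw [List.length_append] at hlen
  have h0 : tautForm l₁ = 0 → formHat x (.inl (br (0, b) (tautForm l₁, 0)).1 :: l₂) = 0 := by
    intro h0
    rw [h0, br_zero_right, Prod.fst_zero, formHat_inl_zero]
  match l₁ with
  | [] => exact h0 rfl
  | _ :: _ :: _ => exact h0 (tautForm_of_two_le (by simp))
  | [_] =>
    refine formHat_of_length x fun h' => h ?_
    rw [← hlen, ← h']
    simp [add_comm]

theorem halfSquare_nil : halfSquare letterDeg br totalForm ([] : List (Letter 𝕜 A B)) = 0 := by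
  have : totalForm ([] : List (Letter 𝕜 A B)) = (0, 0) :=
    Prod.ext rfl (univForm_of_all_isLeft rfl)
  rw [halfSquare, wedge, shuffleSum_nil, this, br_zero_left, smul_zero]

theorem halfSquare_inl_of_all [CharZero 𝕜] (hself : ∀ x, br x x = 0) (b : A)
    {l : List (Letter 𝕜 A B)} (hl : l.all Sum.isLeft) :
    halfSquare letterDeg br totalForm (.inl b :: l) = br (b, 0) (tautForm l, 0) := by
  have htot : ∀ {l : List (Letter 𝕜 A B)}, l.all Sum.isLeft → totalForm l = (tautForm l, 0) :=
    fun h => Prod.ext rfl (univForm_of_all_isLeft h)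
  rw [halfSquare_inl hself, wedge, shuffleSum_congr
    (G := fun l₁ l₂ => br (tautForm (.inl b :: l₁), 0) (tautForm l₂, 0)), shuffleSum_of_left_nil]
  · rfl
  · intro l₁ l₂ h
    obtain ⟨s, l₁, rfl⟩ := List.exists_cons_of_ne_nil h
    rw [tautForm_cons_cons, br_zero_left]
  · intro l₁ l₂ hp
    have := all_isLeft_perm hp hl
    rw [List.all_append, Bool.and_eq_true] at this
    rw [htot this.2, htot]
    rw [List.all_cons, this.1]
    rfl

end AlternatingBrackets

/-! ### The individual sums in the brackets of forms -/

noncomputable section SplitPair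

attribute [local instance] LieRing.ofAssociativeRing

variable {𝕜 R 𝓛 : Type*} [Field 𝕜] [CommRing R] [Algebra 𝕜 R] [AddCommGroup 𝓛]
    [Module 𝕜 𝓛] [Module R 𝓛] [IsScalarTower 𝕜 R 𝓛]

namespace SplitLiePair

variable {𝓔 : LieRinehart 𝕜 R 𝓛} (P : SplitLiePair 𝓔)

theorem semiBracket_A_B (a : P.A) (b : P.B) :
    P.semiBracket (a, 0) (0, 0, b) = 𝓔.bracket a b := by
  simp [semiBracket, total]

theorem semiBracket_B_A (b : P.B) (a : P.A) :
    P.semiBracket (0, 0, b) (a, 0) = 𝓔.bracket b a := by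
  simp [semiBracket, total]

theorem semiBracket_B_B (b b' : P.B) :
    P.semiBracket (0, 0, b) (0, 0, b') = 𝓔.bracket b b' := by
  simp [semiBracket, total]

theorem semiBracket_A_der (a : P.A) (δ : 𝓔.der) :
    P.semiBracket (a, 0) (0, δ, 0) = -δ.1 a := by
  simp [semiBracket, total]

theorem semiBracket_der_A (δ : 𝓔.der) (a : P.A) :
    P.semiBracket (0, δ, 0) (a, 0) = δ.1 a := by
  simp [semiBracket, total]

theorem semiBracket_der_B (δ : 𝓔.der) (b : P.B) :
    P.semiBracket (0, δ, 0) (0, 0, b) = δ.1 b := by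
  simp [semiBracket, total]

theorem semiBracket_der_der (δ δ' : 𝓔.der) :
    P.semiBracket (0, δ, 0) (0, δ', 0) = 0 := by
  simp [semiBracket, total]

theorem formHat_formIncl {k : ℕ} (X : P.Form k) (c : Fin k → P.A) :
    formHat (P.formIncl k X) (inlList c) = (0, X c) := formHat_inlList _ _

theorem formHat_formIncl_cons {k : ℕ} (X : P.Form (k + 1)) (b : P.A) (c : Fin k → P.A) :
    formHat (P.formIncl (k + 1) X) (.inl b :: inlList c) = (0, X (Fin.cons b c)) := by
  rw [← inlList_cons, formHat_formIncl]

theorem shuffleSum_bott {k : ℕ} (X : P.Form k) (a : Fin (k + 1) → P.A) :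
    (shuffleSum (koszulFactor letterDeg) (fun l₁ l₂ =>
      (P.semidirect (tautForm l₁, 0) (0, formHat (P.formIncl k X) l₂)).2) (inlList a)).2 =
      ∑ i : Fin (k + 1), (-1 : ℤˣ) ^ i.val • P.bott (a i) (X (i.removeNth a)) := by
  rw [shuffleSum_tautForm (fun b l => (P.semidirect (b, 0) (0, formHat (P.formIncl k X) l)).2)
    (fun l => by rw [br_zero_left]; rfl), Prod.snd_sum]
  refine Finset.sum_congr rfl fun i _ => ?_
  rw [Prod.smul_snd, formHat_formIncl, semidirect_apply, semiBracket_A_B]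
  rfl

/-- An instance of `shuffleSum_pairs`: on elements of `A` the form `pr_A ½[ℓ, ℓ]` sees only pairs,
where it is the bracket of the subalgebra. -/
theorem shuffleSum_bottBracketTerm [CharZero 𝕜] {k : ℕ} (X : P.Form k) (a : Fin (k + 1) → P.A) :
    (shuffleSum (koszulFactor letterDeg) (fun l₁ l₂ => formHat (P.formIncl k X)
      (.inl (halfSquare letterDeg P.semidirect totalForm l₁).1 :: l₂)) (inlList a)).2 =
      -P.bottBracketTerm X a := by
  cases k with
  | zero =>
    rw [shuffleSum_eq_zero fun l₁ l₂ _ => formHat_zero_cons _ _ _, bottBracketTerm, neg_zero]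
    rfl
  | succ k =>
    rw [shuffleSum_pairs (fun b l => formHat (P.formIncl (k + 1) X) (.inl b :: l))
      (fun l => formHat_inl_zero _ _) (fun l => (halfSquare letterDeg P.semidirect totalForm l).1)
      (fun b b' => (P.semidirect (b, 0) (b', 0)).1) (fun b => by rw [br_zero_right]; rfl)
      (by rw [halfSquare_nil]; rfl)
      (fun b l hl => by rw [halfSquare_inl_of_all P.semidirect_self b hl]), Prod.snd_neg,
      Prod.snd_sum, bottBracketTerm]
    refine congrArg Neg.neg (Finset.sum_congr rfl fun j _ => ?_)
    rw [Prod.snd_sum]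
    refine Finset.sum_congr rfl fun i _ => ?_
    split_ifs
    · rw [Prod.smul_snd, formHat_formIncl_cons, semidirect_inl]
    · rfl

theorem shuffleSum_bracketB {p q : ℕ} (X : P.Form p) (Y : P.Form q) (a : Fin (p + q) → P.A) :
    (shuffleSum (koszulFactor letterDeg) (fun l₁ l₂ => (P.semidirect
      (0, formHat (P.formIncl p X) l₁) (0, formHat (P.formIncl q Y) l₂)).2) (inlList a)).2 =
      ∑ α ∈ shuffles (p + q) p, Equiv.Perm.sign α •
        P.bracketB (X (block a α 0 p (by omega))) (Y (block a α p q le_rfl)) := by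
  rw [shuffleSum_inlList (p := p) (q := q) rfl a, Prod.snd_sum]
  · refine Finset.sum_congr rfl fun σ _ => ?_
    rw [Prod.smul_snd, formHat_formIncl, formHat_formIncl, semidirect_apply, semiBracket_B_B]
    rfl
  · intro l₁ l₂ h
    rw [formHat_of_length _ h, br_zero_left]
    rfl

theorem formDeriv_formIncl {k : ℕ} (X : P.Form k) (b : P.B) (c : Fin k → P.A) :
    formDeriv P.semidirect (P.formIncl k X) (0, b) (inlList c) =
      (0, ∑ i, X (Function.update c i (P.eth b (c i)))) := by
  rw [inlList, formDeriv_ofFn]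
  refine Prod.ext ?_ ?_
  · rw [Prod.fst_sum]
    exact Finset.sum_eq_zero fun i _ => P.formHat_formIncl_fst X _
  · rw [Prod.snd_sum]
    refine Finset.sum_congr rfl fun i _ => ?_
    change (formHat (P.formIncl k X) (inlList _)).2 = _
    rw [formHat_formIncl, semidirect_apply, semiBracket_B_A]
    rfl

theorem shuffleSum_formDeriv_left {p q : ℕ} (X : P.Form p) (Y : P.Form q)
    (a : Fin (p + q) → P.A) :
    (shuffleSum (koszulFactor letterDeg) (fun l₁ l₂ =>
      formDeriv P.semidirect (P.formIncl p X) (formHat (P.formIncl q Y) l₂) l₁) (inlList a)).2 =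
      ∑ σ ∈ shuffles (p + q) p, ∑ i : Fin p, Equiv.Perm.sign σ •
        X (Function.update (block a σ 0 p (by omega)) i
          (P.eth (Y (block a σ p q le_rfl)) (block a σ 0 p (by omega) i))) := by
  rw [shuffleSum_inlList (p := p) (q := q) rfl a, Prod.snd_sum]
  · refine Finset.sum_congr rfl fun σ _ => ?_
    rw [Prod.smul_snd, formHat_formIncl, formDeriv_formIncl, Finset.smul_sum]
  · exact fun l₁ l₂ h => formDeriv_of_length _ _ h

theorem shuffleSum_formDeriv_right {p q : ℕ} (X : P.Form p) (Y : P.Form q)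
    (a : Fin (p + q) → P.A) :
    (shuffleSum (koszulFactor letterDeg) (fun l₁ l₂ =>
      formDeriv P.semidirect (P.formIncl q Y) (formHat (P.formIncl p X) l₁) l₂) (inlList a)).2 =
      ∑ τ ∈ shuffles (p + q) p, ∑ j : Fin q, Equiv.Perm.sign τ •
        Y (Function.update (block a τ p q le_rfl) j
          (P.eth (X (block a τ 0 p (by omega))) (block a τ p q le_rfl j))) := by
  rw [shuffleSum_inlList (p := p) (q := q) rfl a, Prod.snd_sum]
  · refine Finset.sum_congr rfl fun σ _ => ?_
    rw [Prod.smul_snd, formHat_formIncl, formDeriv_formIncl, Finset.smul_sum]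
  · intro l₁ l₂ h
    rw [formHat_of_length _ h]
    exact formDeriv_zero _ _

theorem fst_semidirect_B_B (b b' : P.B) :
    (P.semidirect (0, 0, b) (0, 0, b')).1 = P.beta b b' := by
  rw [semidirect_apply, semiBracket_B_B]
  rfl

theorem shuffleSum_beta_right {p q r n : ℕ} (X : P.Form p) (Y : P.Form q) (Z : P.Form r)
    (h : p + q + r = n + 1) (a : Fin n → P.A) :
    (shuffleSum (koszulFactor letterDeg) (fun l₁ l' =>
      shuffleSum (koszulFactor letterDeg) (fun l₂ l₃ => formHat (P.formIncl r Z)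
        (.inl (P.semidirect (0, formHat (P.formIncl p X) l₁)
          (0, formHat (P.formIncl q Y) l₂)).1 :: l₃)) l') (inlList a)).2 =
      P.bracket₃Z X Y Z h a := by
  cases r with
  | zero =>
    rw [shuffleSum_eq_zero]
    · rfl
    · exact fun l₁ l' _ => shuffleSum_eq_zero fun l₂ l₃ _ => formHat_zero_cons _ _ _
  | succ r =>
    rw [shuffleSum_shuffleSum_inlList (p := p) (q := q) (r := r) (by omega) a
      (F := fun l₁ l₂ l₃ => formHat (P.formIncl (r + 1) Z)
        (.inl (P.semidirect (0, formHat (P.formIncl p X) l₁)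
          (0, formHat (P.formIncl q Y) l₂)).1 :: l₃)), Prod.snd_sum, bracket₃Z]
    · refine Finset.sum_congr rfl fun σ _ => ?_
      rw [Prod.smul_snd, formHat_formIncl, formHat_formIncl, formHat_formIncl_cons,
        fst_semidirect_B_B]
    · intro l₁ l₂ l₃ h
      rw [formHat_of_length _ h, br_zero_left, Prod.fst_zero, formHat_inl_zero]
    · intro l₁ l₂ l₃ h
      rw [formHat_of_length (P.formIncl q Y) h, br_zero_right, Prod.fst_zero, formHat_inl_zero]

theorem shuffleSum_beta_middle {p q r n : ℕ} (X : P.Form p) (Y : P.Form q) (Z : P.Form r)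
    (h : p + q + r = n + 1) (a : Fin n → P.A) :
    (shuffleSum (koszulFactor letterDeg) (fun l₁ l' =>
      shuffleSum (koszulFactor letterDeg) (fun l₂ l₃ => formHat (P.formIncl q Y)
        (.inl (P.semidirect (0, formHat (P.formIncl p X) l₁)
          (0, formHat (P.formIncl r Z) l₃)).1 :: l₂)) l') (inlList a)).2 =
      P.bracket₃Y X Y Z h a := by
  cases q with
  | zero =>
    rw [shuffleSum_eq_zero]
    · rfl
    · exact fun l₁ l' _ => shuffleSum_eq_zero fun l₂ l₃ _ => formHat_zero_cons _ _ _
  | succ q =>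
    rw [shuffleSum_shuffleSum_inlList (p := p) (q := q) (r := r) (by omega) a
      (F := fun l₁ l₂ l₃ => formHat (P.formIncl (q + 1) Y)
        (.inl (P.semidirect (0, formHat (P.formIncl p X) l₁)
          (0, formHat (P.formIncl r Z) l₃)).1 :: l₂)), Prod.snd_sum, bracket₃Y]
    · refine Finset.sum_congr rfl fun σ _ => ?_
      rw [Prod.smul_snd, formHat_formIncl, formHat_formIncl, formHat_formIncl_cons,
        fst_semidirect_B_B]
    · intro l₁ l₂ l₃ h
      rw [formHat_of_length _ h, br_zero_left, Prod.fst_zero, formHat_inl_zero]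
    · exact fun l₁ l₂ l₃ h => formHat_of_length _ (by simpa using h)

theorem shuffleSum_beta_left {p q r n : ℕ} (X : P.Form p) (Y : P.Form q) (Z : P.Form r)
    (h : p + q + r = n + 1) (a : Fin n → P.A) :
    (shuffleSum (koszulFactor letterDeg) (fun l₁ l' =>
      shuffleSum (koszulFactor letterDeg) (fun l₂ l₃ => formHat (P.formIncl p X)
        (.inl (P.semidirect (0, formHat (P.formIncl q Y) l₂)
          (0, formHat (P.formIncl r Z) l₃)).1 :: l₁)) l') (inlList a)).2 =
      P.bracket₃X X Y Z h a := by
  cases p with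
  | zero =>
    rw [shuffleSum_eq_zero]
    · rfl
    · exact fun l₁ l' _ => shuffleSum_eq_zero fun l₂ l₃ _ => formHat_zero_cons _ _ _
  | succ p =>
    rw [shuffleSum_shuffleSum_inlList (p := p) (q := q) (r := r) (by omega) a
      (F := fun l₁ l₂ l₃ => formHat (P.formIncl (p + 1) X)
        (.inl (P.semidirect (0, formHat (P.formIncl q Y) l₂)
          (0, formHat (P.formIncl r Z) l₃)).1 :: l₁)), Prod.snd_sum, bracket₃X]
    · refine Finset.sum_congr rfl fun σ _ => ?_
      rw [Prod.smul_snd, formHat_formIncl, formHat_formIncl, formHat_formIncl_cons,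
        fst_semidirect_B_B]
    · exact fun l₁ l₂ l₃ h => formHat_of_length _ (by simpa using h)
    · intro l₁ l₂ l₃ h
      rw [formHat_of_length (P.formIncl q Y) h, br_zero_left, Prod.fst_zero, formHat_inl_zero]

end SplitLiePair

end SplitPair

/-! ### Sums with an operator from `Der(L)`, and the explicit brackets -/

noncomputable section SplitPair

attribute [local instance] LieRing.ofAssociativeRing

variable {𝕜 R 𝓛 : Type*} [Field 𝕜] [CommRing R] [Algebra 𝕜 R] [AddCommGroup 𝓛]
    [Module 𝕜 𝓛] [Module R 𝓛] [IsScalarTower 𝕜 R 𝓛]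

namespace SplitLiePair

variable {𝓔 : LieRinehart 𝕜 R 𝓛} (P : SplitLiePair 𝓔)

theorem formHat_derLetter_nil (δ : 𝓔.der) : formHat (P.derLetter δ).2 [] = (δ, 0) := rfl

theorem formHat_derLetter_cons (δ : 𝓔.der) (s : Letter 𝕜 P.A (𝓔.der × P.B))
    (l : List (Letter 𝕜 P.A (𝓔.der × P.B))) : formHat (P.derLetter δ).2 (s :: l) = 0 :=
  formHat_zero_cons _ _ _

theorem formHat_derLetter_of_ne (δ : 𝓔.der) {l : List (Letter 𝕜 P.A (𝓔.der × P.B))}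
    (h : l ≠ []) : formHat (P.derLetter δ).2 l = 0 := by
  obtain ⟨s, l, rfl⟩ := List.exists_cons_of_ne_nil h
  exact P.formHat_derLetter_cons δ s l

theorem formHat_derLetter_snd (δ : 𝓔.der) (l : List (Letter 𝕜 P.A (𝓔.der × P.B))) :
    (formHat (P.derLetter δ).2 l).2 = 0 := by
  cases l with
  | nil => rfl
  | cons s l => rw [formHat_derLetter_cons]; rfl

theorem formDeriv_derLetter (δ : 𝓔.der) (b : 𝓔.der × P.B)
    (l : List (Letter 𝕜 P.A (𝓔.der × P.B))) :
    formDeriv P.semidirect (P.derLetter δ).2 b l = 0 :=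
  shuffleSum_eq_zero fun _ _ _ => P.formHat_derLetter_cons δ _ _

theorem semidirect_derLetter_derLetter (δ δ' : 𝓔.der)
    (l l' : List (Letter 𝕜 P.A (𝓔.der × P.B))) :
    (P.semidirect (0, formHat (P.derLetter δ).2 l) (0, formHat (P.derLetter δ').2 l')).1 = 0 ∧
    (P.semidirect (0, formHat (P.derLetter δ).2 l) (0, formHat (P.derLetter δ').2 l')).2.2 = 0 := by
  have h : ∀ (δ : 𝓔.der) l, formHat (P.derLetter δ).2 l = ((formHat (P.derLetter δ).2 l).1, 0) :=
    fun δ l => Prod.ext rfl (P.formHat_derLetter_snd δ l)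
  rw [h δ, h δ', semidirect_apply, semiBracket_der_der]
  exact ⟨map_zero _, map_zero _⟩

theorem formDeriv_der {k : ℕ} (X : P.Form k) (δ : 𝓔.der) (c : Fin k → P.A) :
    formDeriv P.semidirect (P.formIncl k X) (δ, 0) (inlList c) =
      (0, ∑ i, X (Function.update c i (P.prA (δ.1 (c i))))) := by
  rw [inlList, formDeriv_ofFn]
  refine Prod.ext ?_ ?_
  · rw [Prod.fst_sum]
    exact Finset.sum_eq_zero fun i _ => P.formHat_formIncl_fst X _
  · rw [Prod.snd_sum]
    refine Finset.sum_congr rfl fun i _ => ?_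
    change (formHat (P.formIncl k X) (inlList _)).2 = _
    rw [formHat_formIncl, semidirect_apply, semiBracket_der_A]

theorem fst_semidirect_der_B (δ : 𝓔.der) (b : P.B) :
    (P.semidirect (0, δ, 0) (0, 0, b)).1 = P.prA (δ.1 b) := by
  rw [semidirect_apply, semiBracket_der_B]

/-- An operator is a constant and takes no arguments, so only the splitting with empty `l₁`
survives. -/
theorem shuffleSum_act₂Y (δ : 𝓔.der) {i j n : ℕ} (X : P.Form i) (Y : P.Form j)
    (h : i + j = n + 1) (a : Fin n → P.A) :
    (shuffleSum (koszulFactor letterDeg) (fun l₁ l' =>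
      shuffleSum (koszulFactor letterDeg) (fun l₂ l₃ => formHat (P.formIncl j Y)
        (.inl (P.semidirect (0, formHat (P.derLetter δ).2 l₁)
          (0, formHat (P.formIncl i X) l₂)).1 :: l₃)) l') (inlList a)).2 =
      P.act₂Y δ X Y h a := by
  rw [shuffleSum_of_left_nil]
  · cases j with
    | zero =>
      rw [shuffleSum_eq_zero]
      · rfl
      · exact fun l₂ l₃ _ => formHat_zero_cons _ _ _
    | succ j =>
      rw [shuffleSum_inlList (p := i) (q := j) (by omega) a, Prod.snd_sum, act₂Y]
      · refine Finset.sum_congr rfl fun σ _ => ?_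
        rw [Prod.smul_snd, formHat_formIncl, formHat_formIncl_cons, formHat_derLetter_nil,
          fst_semidirect_der_B]
      · intro l₂ l₃ h
        rw [formHat_of_length (P.formIncl i X) h, br_zero_right, Prod.fst_zero, formHat_inl_zero]
  · intro l₁ l' h
    refine shuffleSum_eq_zero fun l₂ l₃ _ => ?_
    rw [formHat_derLetter_of_ne _ _ h, br_zero_left, Prod.fst_zero, formHat_inl_zero]

theorem shuffleSum_act₂X (δ : 𝓔.der) {i j n : ℕ} (X : P.Form i) (Y : P.Form j)
    (h : i + j = n + 1) (a : Fin n → P.A) :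
    (shuffleSum (koszulFactor letterDeg) (fun l₁ l' =>
      shuffleSum (koszulFactor letterDeg) (fun l₂ l₃ => formHat (P.formIncl i X)
        (.inl (P.semidirect (0, formHat (P.derLetter δ).2 l₁)
          (0, formHat (P.formIncl j Y) l₃)).1 :: l₂)) l') (inlList a)).2 =
      P.act₂X δ X Y h a := by
  rw [shuffleSum_of_left_nil]
  · cases i with
    | zero =>
      rw [shuffleSum_eq_zero]
      · rfl
      · exact fun l₂ l₃ _ => formHat_zero_cons _ _ _
    | succ i =>
      rw [shuffleSum_inlList (p := i) (q := j) (by omega) a, Prod.snd_sum, act₂X]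
      · refine Finset.sum_congr rfl fun σ _ => ?_
        rw [Prod.smul_snd, formHat_formIncl, formHat_formIncl_cons, formHat_derLetter_nil,
          fst_semidirect_der_B]
      · exact fun l₂ l₃ h => formHat_of_length _ (by simpa using h)
  · intro l₁ l' h
    refine shuffleSum_eq_zero fun l₂ l₃ _ => ?_
    rw [formHat_derLetter_of_ne _ _ h, br_zero_left, Prod.fst_zero, formHat_inl_zero]

variable [CharZero 𝕜]

theorem extension_one_snd (x : FormLetter 𝕜 P.A (𝓔.der × P.B)) {w : 𝓔.der × P.Forms}
    (hw : P.incl w = ofLetter x) {n : ℕ} (a : Fin n → P.A) :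
    (P.extension.bracket 1 ![w]).2 n a =
      (bracketSign [x] • univBracket P.semidirect (.inr x :: inlList a)).2 := by
  have h : (fun i => P.incl (![w] i)) = fun i => ofLetter (![x] i) := by
    funext i; fin_cases i; exact hw
  rw [extension_snd, h, altBracket_ofLetter_apply]
  rfl

theorem extension_two_snd (x y : FormLetter 𝕜 P.A (𝓔.der × P.B)) {v w : 𝓔.der × P.Forms}
    (hv : P.incl v = ofLetter x) (hw : P.incl w = ofLetter y) {n : ℕ} (a : Fin n → P.A) :
    (P.extension.bracket 2 ![v, w]).2 n a =
      (bracketSign [x, y] • univBracket P.semidirect (.inr x :: .inr y :: inlList a)).2 := by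
  have h : (fun i => P.incl (![v, w] i)) = fun i => ofLetter (![x, y] i) := by
    funext i
    fin_cases i
    · exact hv
    · exact hw
  rw [extension_snd, h, altBracket_ofLetter_apply]
  rfl

theorem extension_three_snd (x y z : FormLetter 𝕜 P.A (𝓔.der × P.B)) {u v w : 𝓔.der × P.Forms}
    (hu : P.incl u = ofLetter x) (hv : P.incl v = ofLetter y) (hw : P.incl w = ofLetter z)
    {n : ℕ} (a : Fin n → P.A) :
    (P.extension.bracket 3 ![u, v, w]).2 n a = (bracketSign [x, y, z] •
      univBracket P.semidirect (.inr x :: .inr y :: .inr z :: inlList a)).2 := by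
  have h : (fun i => P.incl (![u, v, w] i)) = fun i => ofLetter (![x, y, z] i) := by
    funext i
    fin_cases i
    · exact hu
    · exact hv
    · exact hw
  rw [extension_snd, h, altBracket_ofLetter_apply]
  rfl

theorem formsAlgebra_apply {k : ℕ} (X : Fin k → P.Forms) {n : ℕ} (a : Fin n → P.A) :
    P.formsAlgebra.bracket k X n a = (P.extension.bracket k fun i => (0, X i)).2 n a := by
  rw [extension_inr]

theorem isFormsAlgebra : P.IsFormsAlgebra P.formsAlgebra where
  isLThree := P.formsAlgebra_isLThree
  unary {k} X a := by
    have h : (fun i => ((0, ![P.of X] i) : 𝓔.der × P.Forms)) = ![(0, P.of X)] := by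
      funext i; fin_cases i; rfl
    rw [formsAlgebra_apply, h, P.extension_one_snd _ (P.incl_of X),
      bracketSign_smul_univBracket_one P.semidirect_self _ (inlList_all a), Prod.snd_sub]
    have h1 := P.shuffleSum_bott X a
    have h2 := P.shuffleSum_bottBracketTerm X a
    rw [bottDiff, ← h1, ← neg_eq_iff_eq_neg.2 h2, ← sub_eq_add_neg]
    rfl
  binary {p q} X Y a := by
    have h : (fun i => ((0, ![P.of X, P.of Y] i) : 𝓔.der × P.Forms)) =
        ![(0, P.of X), (0, P.of Y)] := by
      funext i; fin_cases i <;> rfl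
    rw [formsAlgebra_apply, h, P.extension_two_snd _ _ (P.incl_of X) (P.incl_of Y),
      bracketSign_smul_univBracket_two P.semidirect_self _ _ (inlList_all a), Prod.snd_add,
      Prod.snd_sub, bracket₂, ← shuffleSum_formDeriv_left, ← shuffleSum_formDeriv_right,
      ← shuffleSum_bracketB]
    rfl
  ternary {p q r n} X Y Z h a := by
    have h' : (fun i => ((0, ![P.of X, P.of Y, P.of Z] i) : 𝓔.der × P.Forms)) =
        ![(0, P.of X), (0, P.of Y), (0, P.of Z)] := by
      funext i; fin_cases i <;> rfl
    rw [formsAlgebra_apply, h', P.extension_three_snd _ _ _ (P.incl_of X) (P.incl_of Y)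
      (P.incl_of Z), bracketSign_smul_univBracket_three P.semidirect_self, Prod.snd_sub,
      Prod.snd_add, Prod.smul_snd, Prod.smul_snd, bracket₃, ← shuffleSum_beta_right,
      ← shuffleSum_beta_middle, ← shuffleSum_beta_left]
    rfl

/-- The same expansions of the curvature as for forms, with the constant `δ` of degree zero as first
entry. The terms in which `δ` would receive an insertion vanish, and the signs are those for `p =
0`. -/
theorem hasActionMaps : P.HasActionMaps P.extension where
  zero δ a := by
    rw [P.extension_one_snd _ (P.incl_der δ),
      bracketSign_smul_univBracket_one P.semidirect_self _ (inlList_all a),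
      shuffleSum_tautForm (fun b l => (P.semidirect (b, 0) (0, formHat (P.derLetter δ).2 l)).2)
        (fun l => by rw [br_zero_left]; rfl),
      shuffleSum_eq_zero fun l₁ l₂ _ => P.formHat_derLetter_cons δ _ _, sub_zero, Fin.sum_univ_one,
      Prod.smul_snd, semidirect_apply]
    have hnil : (inlList (Fin.removeNth 0 a) : List (Letter 𝕜 P.A (𝓔.der × P.B))) = [] := rfl
    -- The minus sign of `κ` comes from `[a, δ] = -δ(a)` in the semidirect product.
    rw [hnil, formHat_derLetter_nil, semiBracket_A_der]
    change (-1 : ℤˣ) ^ 0 • _ = _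
    rw [pow_zero, one_smul]
    exact map_neg P.prB _
  one δ k X a := by
    rw [P.extension_two_snd _ _ (P.incl_der δ) (P.incl_of X),
      bracketSign_smul_univBracket_two P.semidirect_self _ _ (inlList_all a),
      shuffleSum_eq_zero fun l₁ l₂ _ => P.formDeriv_derLetter δ _ _, shuffleSum_of_left_nil,
      shuffleSum_of_left_nil, zero_sub, formHat_derLetter_nil, Prod.snd_add, Prod.snd_neg]
    · change -(formDeriv P.semidirect (P.formIncl k X) (δ, 0) (inlList a)).2 +
        (P.semidirect (0, δ, 0) (0, formHat (P.formIncl k X) (inlList a))).2.2 = _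
      rw [formDeriv_der, formHat_formIncl, semidirect_apply, semiBracket_der_B]
      rfl
    · intro l₁ l₂ h
      rw [formHat_derLetter_of_ne _ _ h, br_zero_left]
      rfl
    · intro l₁ l₂ h
      rw [formHat_derLetter_of_ne _ _ h, formDeriv_zero]
  two δ i j n X Y h a := by
    rw [P.extension_three_snd _ _ _ (P.incl_der δ) (P.incl_of X) (P.incl_of Y),
      bracketSign_smul_univBracket_three P.semidirect_self,
      shuffleSum_eq_zero (F := fun l₁ l' => shuffleSum (koszulFactor letterDeg) (fun l₂ l₃ =>
        formHat (P.derLetter δ).2 (_ :: l₁)) l'), sub_zero,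
      Prod.snd_add, Prod.smul_snd, Prod.smul_snd, act₂, ← shuffleSum_act₂Y, ← shuffleSum_act₂X]
    · have h1 : ((P.derLetter δ).1 : ℤ).negOnePow = 1 := Int.negOnePow_zero
      have h2 : (((P.derLetter δ).1 : ℤ) + (P.formLetter X).1 + 1).negOnePow = (-1) ^ (i + 1) := by
        change ((0 : ℤ) + (i : ℤ) + 1).negOnePow = ((i + 1 : ℕ) : ℤ).negOnePow
        rw [zero_add, Nat.cast_add, Nat.cast_one]
      rw [h1, h2, one_smul]
      rfl
    · exact fun l₁ l' _ => shuffleSum_eq_zero fun l₂ l₃ _ => P.formHat_derLetter_cons δ _ _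

end SplitLiePair

end SplitPair

/-! ### Brackets with two entries in `Der(L)` -/

noncomputable section SplitPair

attribute [local instance] LieRing.ofAssociativeRing

variable {𝕜 R 𝓛 : Type*} [Field 𝕜] [CharZero 𝕜] [CommRing R] [Algebra 𝕜 R] [AddCommGroup 𝓛]
    [Module 𝕜 𝓛] [Module R 𝓛] [IsScalarTower 𝕜 R 𝓛]

namespace SplitLiePair

variable {𝓔 : LieRinehart 𝕜 R 𝓛} (P : SplitLiePair 𝓔)

theorem extension_der_der (δ δ' : 𝓔.der) :
    P.extension.bracket 2 ![(δ, 0), (δ', 0)] = (⁅δ, δ'⁆, 0) := by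
  refine Prod.ext (P.extension_two_fst _) (DFinsupp.ext fun n => AlternatingMap.ext fun a => ?_)
  rw [P.extension_two_snd _ _ (P.incl_der δ) (P.incl_der δ'),
    bracketSign_smul_univBracket_two P.semidirect_self _ _ (inlList_all a),
    shuffleSum_eq_zero fun l₁ l₂ _ => P.formDeriv_derLetter δ _ _,
    shuffleSum_eq_zero fun l₁ l₂ _ => P.formDeriv_derLetter δ' _ _, sub_zero, zero_add]
  change LinearMap.snd 𝕜 𝓔.der P.B _ = 0
  rw [map_shuffleSum]
  exact shuffleSum_eq_zero fun l₁ l₂ _ => (P.semidirect_derLetter_derLetter δ δ' l₁ l₂).2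

/-- In each term of the ternary bracket two entries are bracketed and the result is inserted into
the third. With two operators among the entries, either the third is an operator and has no
argument, or the bracketed two are operators and their bracket has no part in `A`. -/
theorem altBracket_three_eq_zero {X : Fin 3 → ⨁ k : ℕ, P.A [⋀^Fin k]→ₗ[𝕜] (𝓔.der × P.B)}
    {i j : Fin 3} (hij : i ≠ j) (hi : ∃ δ, X i = ofLetter (P.derLetter δ))
    (hj : ∃ δ, X j = ofLetter (P.derLetter δ)) : altBracket P.semidirect 3 X = 0 := by
  -- The slots `i` and `j` are kept as operators; only the remaining one is expanded into forms of
  -- fixed degree.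
  refine (Submodule.mem_bot 𝕜).1 (MultilinearMap.map_mem_of_mem_span _
    (fun l => {v | ∃ s : FormLetter 𝕜 P.A (𝓔.der × P.B),
      (l = i ∨ l = j → ∃ δ, s = P.derLetter δ) ∧ ofLetter s = v}) _ (fun v hv => ?_) fun l => ?_)
  · choose s hs hv using hv
    obtain rfl : (fun i => ofLetter (s i)) = v := funext hv
    have hterm : ∀ (x y z : FormLetter 𝕜 P.A (𝓔.der × P.B)), ((∃ δ, z = P.derLetter δ) ∨
        (∃ δ, x = P.derLetter δ) ∧ ∃ δ, y = P.derLetter δ) → ∀ l₁ l₂ l₃, formHat z.2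
          (.inl (P.semidirect (0, formHat x.2 l₁) (0, formHat y.2 l₂)).1 :: l₃) = 0 := by
      rintro x y z (⟨δ, rfl⟩ | ⟨⟨δ, rfl⟩, δ', rfl⟩) l₁ l₂ l₃
      · exact P.formHat_derLetter_cons δ _ _
      · rw [(P.semidirect_derLetter_derLetter δ δ' l₁ l₂).1, formHat_inl_zero]
    have h : ((∃ δ, s 0 = P.derLetter δ) ∧ ∃ δ, s 1 = P.derLetter δ) ∨
        ((∃ δ, s 0 = P.derLetter δ) ∧ ∃ δ, s 2 = P.derLetter δ) ∨
        ((∃ δ, s 1 = P.derLetter δ) ∧ ∃ δ, s 2 = P.derLetter δ) := by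
      have hi' := hs i (.inl rfl)
      have hj' := hs j (.inr rfl)
      clear hs hv hi hj
      fin_cases i <;> fin_cases j <;> first
        | exact absurd rfl hij
        | exact .inl ⟨hi', hj'⟩
        | exact .inl ⟨hj', hi'⟩
        | exact .inr (.inl ⟨hi', hj'⟩)
        | exact .inr (.inl ⟨hj', hi'⟩)
        | exact .inr (.inr ⟨hi', hj'⟩)
        | exact .inr (.inr ⟨hj', hi'⟩)
    have hp : ∀ {a b c : Prop}, a ∧ b ∨ a ∧ c ∨ b ∧ c →
        (c ∨ a ∧ b) ∧ (b ∨ a ∧ c) ∧ (a ∨ b ∧ c) := by tauto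
    refine (Submodule.mem_bot 𝕜).2 (DFinsupp.ext fun n => AlternatingMap.ext fun a => ?_)
    rw [altBracket_ofLetter_apply]
    change bracketSign [s 0, s 1, s 2] • univBracket P.semidirect
      (.inr (s 0) :: .inr (s 1) :: .inr (s 2) :: inlList a) = 0
    rw [bracketSign_smul_univBracket_three P.semidirect_self,
      shuffleSum_eq_zero (F := fun l₁ l' => shuffleSum _ (fun l₂ l₃ =>
        formHat (s 2).2 (_ :: l₃)) l'),
      shuffleSum_eq_zero (F := fun l₁ l' => shuffleSum _ (fun l₂ l₃ =>
        formHat (s 1).2 (_ :: l₂)) l'),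
      shuffleSum_eq_zero (F := fun l₁ l' => shuffleSum _ (fun l₂ l₃ =>
        formHat (s 0).2 (_ :: l₁)) l'), smul_zero, smul_zero, add_zero, sub_zero]
    · exact fun _ _ _ => shuffleSum_eq_zero fun _ _ _ => hterm _ _ _ (hp h).2.2 _ _ _
    · exact fun _ _ _ => shuffleSum_eq_zero fun _ _ _ => hterm _ _ _ (hp h).2.1 _ _ _
    · exact fun _ _ _ => shuffleSum_eq_zero fun _ _ _ => hterm _ _ _ (hp h).1 _ _ _
  · by_cases hl : l = i ∨ l = j
    · obtain ⟨δ, hδ⟩ : ∃ δ, X l = ofLetter (P.derLetter δ) := by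
        rcases hl with rfl | rfl
        · exact hi
        · exact hj
      exact Submodule.subset_span ⟨_, fun _ => ⟨δ, rfl⟩, hδ.symm⟩
    · refine Submodule.span_mono ?_ (mem_span_ofLetter (X l))
      rintro _ ⟨s, rfl⟩
      exact ⟨s, fun h => absurd h hl, rfl⟩

theorem isExtension : P.IsExtension P.formsAlgebra P.extension where
  incl := P.extension_inr
  proj_two := P.extension_two_fst
  proj_ne_two := P.extension_fst_of_ne_two
  lie := P.extension_der_der
  vanish k y hk i j hij hi hj := by
    by_cases hk3 : k = 3
    · subst hk3
      have hder : ∀ i, (y i).2 = 0 → ∃ δ, P.incl (y i) = ofLetter (P.derLetter δ) := fun i hi => by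
        refine ⟨(y i).1, ?_⟩
        rw [← incl_der, ← hi]
      refine P.incl_injective ?_
      rw [incl_extension, P.altBracket_three_eq_zero hij (hder i hi) (hder j hj)]
      exact (map_zero P.incl).symm
    · rw [P.extension_isLThree k (by omega)]
      rfl

end SplitLiePair

end SplitPair

/-- Smoothness enters through `LiePair.Decomposition.split`, which turns complementary subbundles
into complementary modules of sections. The rest holds for every `SplitLiePair` over a field of
characteristic zero. -/
theorem corollary4p3 {𝕜 : Type*} [RCLike 𝕜] {m : ℕ} {M : Type*} [TopologicalSpace M] [T2Space M]
    [SecondCountableTopology M] [ChartedSpace (EuclideanSpace ℝ (Fin m)) M] [IsManifold (𝓡 m) ∞ M]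
    {F : Type*} [NormedAddCommGroup F] [NormedSpace ℝ F] [NormedSpace 𝕜 F] [IsScalarTower ℝ 𝕜 F]
    [FiniteDimensional 𝕜 F]
    {L : M → Type*} [TopologicalSpace (TotalSpace F L)] [∀ x, AddCommGroup (L x)]
    [∀ x, Module 𝕜 (L x)] [∀ x, TopologicalSpace (L x)] [FiberBundle F L] [VectorBundle 𝕜 F L]
    [∀ x, Module ℝ (L x)] [VectorBundle ℝ F L] [ContMDiffVectorBundle ∞ F L (𝓡 m)]
    (𝓔 : LieAlgebroid 𝕜 m F L) (P : LiePair 𝓔) (D : P.Decomposition) :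
    ∃ 𝔤 : LInfinityAlgebra 𝕜 D.split.Forms D.split.formsDeg,
      D.split.IsFormsAlgebra 𝔤 ∧
      ∃ 𝔥 : LInfinityAlgebra 𝕜 (𝓔.der × D.split.Forms) D.split.sumDeg,
        𝔥.IsLThree ∧ D.split.IsExtension 𝔤 𝔥 ∧ D.split.HasActionMaps 𝔥 :=
  ⟨D.split.formsAlgebra, D.split.isFormsAlgebra, D.split.extension,
    D.split.extension_isLThree, D.split.isExtension, D.split.hasActionMaps⟩
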